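/- Let $K/k$ be a finite Galois extension of global fields with Galois group $G$. Let $S$ be a finite non-empty set of places of $k$ containing all archimedean places, and let $S_K$ be the set of places of $K$ above $S$. Let $\mathfrak m=\mathfrak m_f\mathfrak m_\infty$ be an $S$-modulus of $k$, that is, $\mathfrak m_f$ is a non-zero ideal of the ring $\mathcal O_{k,S}$ of $S$-integers and $\mathfrak m_\infty$ is a set of real places of $k$ (empty if $k$ is a function field). Let $S(\mathfrak m_f)$ be the finite set of places $v\notin S$ of $k$ dividing $\mathfrak m_f$. Let $\mathcal O_v$, $\mathcal O_w$ denote the rings of integers of the completions $k_v$, $K_w$ at finite places $v$ of $k$ and $w$ of $K$. Let $K^{\mathfrak m}$ be the group of all $x\in K^\times$ with $x-1\in\mathfrak m_f\mathcal O_w$ for every place $w$ of $K$ above a place in $S(\mathfrak m_f)$, and with $w(x)>0$ for every real place $w$ of $K$ above a place in $\mathfrak m_\infty$. For $v\in S(\mathfrak m_f)$ and $w\mid v$ put $1+\mathfrak m\mathcal O_v=1+\mathfrak m_f\mathcal O_v$ and $1+\mathfrak m\mathcal O_w=1+\mathfrak m_f\mathcal O_w$; the group $G$ acts naturally on $K^{\mathfrak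 m}$ and on $\prod_{w\mid v}(1+\mathfrak m\mathcal O_w)\subset\prod_{w\mid v}K_w^\times$. Then $$H^1(G,K^{\mathfrak m})\cong\prod_{v\in S(\mathfrak m_f)}H^1\Bigl(G,\prod_{w\mid v}(1+\mathfrak m\mathcal O_w)\Bigr).$$ Furthermore, if $K/k$ is cyclic, then $H^1(G,K^{\mathfrak m})$ is finite, $N\bigl(\prod_{w\mid v}(1+\mathfrak m\mathcal O_w)\bigr)\subseteq 1+\mathfrak m\mathcal O_v$ for all $v\in S(\mathfrak m_f)$, and $$|H^1(G,K^{\mathfrak m})|=\prod_{v\in S(\mathfrak m_f)}\Bigl[1+\mathfrak m\mathcal O_v:N\bigl(\prod_{w\mid v}(1+\mathfrak m\mathcal O_w)\bigr)\Bigr],$$ where $N:\prod_{w\mid v}K_w^\times\to k_v^\times$, $(x_w)_w\mapsto\prod_{w\mid v}N_{K_w/k_v}(x_w)$, is the norm. -/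

import Mathlib

open IsDedekindDomain NumberField
open scoped WithZero

noncomputable section

namespace RayClass

/-- A global field: a finite extension of `ℚ`, or a finite extension of `𝔽_p(t)` for a prime `p`. -/
def IsGlobalField (F : Type*) [Field F] : Prop :=
  NumberField F ∨
    ∃ (p : ℕ) (_ : Fact p.Prime) (_ : Algebra (RatFunc (ZMod p)) F),
      FiniteDimensional (RatFunc (ZMod p)) F

/-! ### Places and completions -/

/-- A finite (that is, non-archimedean) place of `F`, given by its valuation ring, a discrete
valuation ring with field of fractions `F`. -/
@[ext]
structure FinitePlace (F : Type*) [Field F] where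
  ring : ValuationSubring F
  isDVR : IsDiscreteValuationRing ring

attribute [instance] FinitePlace.isDVR

/-- A place of `F`, finite or archimedean. -/
inductive Place (F : Type*) [Field F] where
  | finite (w : FinitePlace F) : Place F
  | infinite (w : InfinitePlace F) : Place F

namespace FinitePlace

variable {F F' F'' : Type*} [Field F] [Field F'] [Field F'']

/-- The normalized valuation `F → ℤᵐ⁰` of a finite place. -/
abbrev val (w : FinitePlace F) : Valuation F ℤᵐ⁰ :=
  (IsDiscreteValuationRing.maximalIdeal w.ring).valuation F

/-- The completion `F_w`. -/
abbrev Completion (w : FinitePlace F) : Type _ :=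
  (IsDiscreteValuationRing.maximalIdeal w.ring).adicCompletion F

/-- The ring of integers `𝒪_w` of the completion `F_w`. -/
abbrev Integers (w : FinitePlace F) : ValuationSubring w.Completion :=
  (IsDiscreteValuationRing.maximalIdeal w.ring).adicCompletionIntegers F

lemma val_le_one_iff (w : FinitePlace F) (x : F) : w.val x ≤ 1 ↔ x ∈ w.ring := by
  constructor
  · intro h
    obtain ⟨a, rfl⟩ := IsDiscreteValuationRing.exists_lift_of_le_one h
    exact a.2
  · intro h
    exact HeightOneSpectrum.valuation_le_one _ (⟨x, h⟩ : w.ring)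

lemma isDVR_comap (f : F →+* F') (hf : f.IsIntegral) (w : FinitePlace F') :
    IsDiscreteValuationRing (w.ring.comap f) := by
  have h1 : w.ring.comap f = (w.val.comap f).valuationSubring := by
    ext x
    rw [ValuationSubring.mem_comap, ← val_le_one_iff]; rfl
  have h2 : ∃ x : F, x ≠ 0 ∧ w.val (f x) ≠ 1 := by
    by_contra! hc
    apply IsDiscreteValuationRing.not_isField w.ring
    have hmem : ∀ x : F, f x ∈ w.ring := fun x ↦ by
      rw [← val_le_one_iff]
      rcases eq_or_ne x 0 with rfl | hx
      · simp
      · exact (hc x hx).le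
    have hall : ∀ y : F', y ∈ w.ring := fun y ↦ by
      obtain ⟨p, hp, hy⟩ := hf y
      have : IsIntegral w.ring y := by
        refine ⟨p.map (f.codRestrict w.ring.toSubring hmem), hp.map _, ?_⟩
        rw [Polynomial.eval₂_map]
        exact hy
      obtain ⟨z, rfl⟩ := IsIntegrallyClosed.isIntegral_iff.mp this
      exact z.2
    refine ⟨⟨0, 1, zero_ne_one⟩, mul_comm, fun {a} ha ↦ ⟨⟨(a : F')⁻¹, hall _⟩, ?_⟩⟩
    ext
    exact mul_inv_cancel₀ (fun h ↦ ha (Subtype.ext h))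
  obtain ⟨x, hx0, hx1⟩ := h2
  have : Nontrivial (MonoidWithZeroHom.valueGroup (.ofClass (w.val.comap f))) := by
    rw [Subgroup.nontrivial_iff_exists_ne_one]
    refine ⟨Units.mk0 (w.val (f x)) (by simpa using hx0), ?_, ?_⟩
    · apply MonoidWithZeroHom.mem_valueGroup
      exact ⟨x, rfl⟩
    · intro h
      exact hx1 (by simpa using congrArg Units.val h)
  rw [h1]
  infer_instance

/-- The restriction of a finite place along an integral (that is, algebraic) embedding of
fields. -/
def comap (f : F →+* F') (hf : f.IsIntegral) (w : FinitePlace F') : FinitePlace F :=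
  ⟨w.ring.comap f, isDVR_comap f hf w⟩

lemma continuous_toCompletion (f : F →+* F') {v : FinitePlace F} {w : FinitePlace F'}
    (h : w.ring.comap f = v.ring) :
    Continuous ((algebraMap F' w.Completion).comp
      (f.comp (WithVal.equiv v.val : WithVal v.val →+* F))) := by
  refine continuous_of_continuousAt_zero _ ?_
  rw [ContinuousAt, map_zero, Filter.tendsto_def]
  intro s hs
  obtain ⟨γ, hγ⟩ := Valued.mem_nhds_zero.mp hs
  obtain ⟨π, hπ⟩ := HeightOneSpectrum.valuation_exists_uniformizer F
    (IsDiscreteValuationRing.maximalIdeal v.ring)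
  have hπ0 : π ≠ 0 := by
    rintro rfl
    rw [map_zero] at hπ
    exact WithZero.coe_ne_zero hπ.symm
  have hfπ0 : w.val (f π) ≠ 0 := by simpa using hπ0
  have hfπ : w.val (f π) < 1 := by
    have h1 : π⁻¹ ∉ v.ring := by
      rw [← val_le_one_iff, not_le, map_inv₀, val, hπ]
      decide
    rw [← h, ValuationSubring.mem_comap, ← val_le_one_iff, not_le, map_inv₀, map_inv₀] at h1
    exact (one_lt_inv₀ (zero_lt_iff.mpr hfπ0)).mp h1
  have hγ0 : MonoidWithZeroHom.ValueGroup₀.embedding γ.1 ≠ 0 := by simp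
  obtain ⟨n, hn⟩ := exists_pow_lt₀ hfπ (Units.mk0 _ hγ0)
  rw [Valued.mem_nhds_zero]
  refine ⟨Units.mk0 (Valued.v.restrict (WithVal.toVal v.val (π ^ n))) ?_, fun x hx ↦ hγ ?_⟩
  · rw [Ne, Valuation.restrict_eq_zero_iff]
    change v.val (π ^ n) ≠ 0
    simpa using fun h ↦ absurd h hπ0
  · rw [Set.mem_ofPred_eq, Units.val_mk0, Valuation.restrict_lt_iff] at hx
    replace hx : v.val x.ofVal < v.val (π ^ n) := hx
    have hmem : x.ofVal / π ^ n ∈ v.ring := by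
      rw [← val_le_one_iff, map_div₀]
      exact div_le_one_of_le₀ hx.le zero_le
    rw [← h, ValuationSubring.mem_comap, ← val_le_one_iff, map_div₀, map_div₀, map_pow, map_pow,
      div_le_one₀ (pow_pos (zero_lt_iff.mpr hfπ0) n)] at hmem
    rw [Set.mem_ofPred_eq, Valuation.restrict_lt_iff_lt_embedding]
    refine lt_of_le_of_lt ?_ hn
    refine le_trans (le_of_eq ?_) hmem
    exact HeightOneSpectrum.valuedAdicCompletion_eq_valuation' _ (f x.ofVal)

/-- If `v` is the restriction of `w` along `f : F → F'`, the continuous extension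
`F_v → F'_w` of `f`. -/
def completionMap (f : F →+* F') {v : FinitePlace F} {w : FinitePlace F'}
    (h : w.ring.comap f = v.ring) : v.Completion →+* w.Completion :=
  (UniformSpace.Completion.extensionHom _ (continuous_toCompletion f h)).comp
    (HeightOneSpectrum.adicCompletion.equiv F
      (IsDiscreteValuationRing.maximalIdeal v.ring)).toRingHom

lemma continuous_completionMap (f : F →+* F') {v : FinitePlace F} {w : FinitePlace F'}
    (h : w.ring.comap f = v.ring) : Continuous (completionMap f h) :=
  UniformSpace.Completion.continuous_extension.comp
    (HeightOneSpectrum.adicCompletion.continuous_toCompletion F _)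

lemma completionMap_algebraMap (f : F →+* F') {v : FinitePlace F} {w : FinitePlace F'}
    (h : w.ring.comap f = v.ring) (x : F) :
    completionMap f h (algebraMap F v.Completion x) = algebraMap F' w.Completion (f x) :=
  UniformSpace.Completion.extensionHom_coe _ (continuous_toCompletion f h) (WithVal.toVal _ x)

lemma completionMap_mem_integers (f : F →+* F') {v : FinitePlace F} {w : FinitePlace F'}
    (h : w.ring.comap f = v.ring) {x : v.Completion} (hx : x ∈ v.Integers) :
    completionMap f h x ∈ w.Integers := by
  have hdense : DenseRange (algebraMap F v.Completion) :=
    HeightOneSpectrum.denseRange_algebraMap _ _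
  have hopen : IsOpen (v.Integers : Set v.Completion) := Valued.isOpen_integer _
  have hclosed : IsClosed (completionMap f h ⁻¹' (w.Integers : Set w.Completion)) :=
    (Valued.isClosed_integer _).preimage (continuous_completionMap f h)
  have hsub : (v.Integers : Set v.Completion) ⊆
      closure (v.Integers ∩ Set.range (algebraMap F v.Completion)) :=
    hdense.open_subset_closure_inter hopen
  refine hclosed.closure_subset_iff.mpr ?_ (hsub hx)
  rintro _ ⟨ha, a, rfl⟩
  have ha' : a ∈ v.ring := by
    rw [← val_le_one_iff, ← HeightOneSpectrum.valuedAdicCompletion_eq_valuation']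
    exact ha
  rw [← h, ValuationSubring.mem_comap, ← val_le_one_iff,
    ← HeightOneSpectrum.valuedAdicCompletion_eq_valuation'] at ha'
  rw [Set.mem_preimage, completionMap_algebraMap]
  exact ha'

lemma completionMap_comp (f : F →+* F') (g : F' →+* F'') {u : FinitePlace F}
    {v : FinitePlace F'} {w : FinitePlace F''} (hf : v.ring.comap f = u.ring)
    (hg : w.ring.comap g = v.ring) (hgf : w.ring.comap (g.comp f) = u.ring) (x : u.Completion) :
    completionMap (g.comp f) hgf x = completionMap g hg (completionMap f hf x) := by
  refine congrFun (DenseRange.equalizer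
    (HeightOneSpectrum.denseRange_algebraMap _ _ : DenseRange (algebraMap F u.Completion))
    (continuous_completionMap _ hgf)
    ((continuous_completionMap _ hg).comp (continuous_completionMap _ hf)) ?_) x
  ext a
  simp [completionMap_algebraMap]

lemma completionMap_id {u : FinitePlace F} (h : u.ring.comap (RingHom.id F) = u.ring)
    (x : u.Completion) : completionMap (RingHom.id F) h x = x := by
  refine congrFun (DenseRange.equalizer
    (HeightOneSpectrum.denseRange_algebraMap _ _ : DenseRange (algebraMap F u.Completion))
    (continuous_completionMap _ h) continuous_id ?_) x
  ext a
  simp [completionMap_algebraMap]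

/-- The restriction to `𝒪_v → 𝒪_w` of `F_v → F'_w`. -/
def integersMap (f : F →+* F') {v : FinitePlace F} {w : FinitePlace F'}
    (h : w.ring.comap f = v.ring) : v.Integers →+* w.Integers :=
  (completionMap f h).restrict v.Integers w.Integers fun _ hx ↦ completionMap_mem_integers f h hx

end FinitePlace

/-! ### Places in an extension -/

section Extension

variable (k : Type*) {K : Type*} [Field k] [Field K] [Algebra k K] [FiniteDimensional k K]

/-- The finite place of `k` below a finite place of `K`. -/
def FinitePlace.under (w : FinitePlace K) : FinitePlace k :=
  w.comap (algebraMap k K) (algebraMap_isIntegral_iff.mpr inferInstance)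

/-- The place of `k` below a place of `K`. -/
def Place.under : Place K → Place k
  | .finite w => .finite (w.under k)
  | .infinite w => .infinite (w.comap (algebraMap k K))

variable {k}

/-- The set of the finite places `w ∣ v` of `K`. -/
def FinitePlace.Over (v : FinitePlace k) (K : Type*) [Field K] [Algebra k K]
    [FiniteDimensional k K] : Type _ :=
  {w : FinitePlace K // w.under k = v}

/-- The place `w ∘ σ` of `K`; its valuation ring is `σ⁻¹(𝒪)` for `𝒪` the valuation ring of `w`. -/
def FinitePlace.twist (σ : K ≃ₐ[k] K) (w : FinitePlace K) : FinitePlace K :=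
  w.comap (σ : K →+* K) (RingHom.isIntegral_of_surjective _ σ.surjective)

lemma FinitePlace.under_twist (σ : K ≃ₐ[k] K) (w : FinitePlace K) :
    (w.twist σ).under k = w.under k := by
  ext x
  change σ (algebraMap k K x) ∈ w.ring ↔ algebraMap k K x ∈ w.ring
  rw [σ.commutes]

/-- `w ↦ w ∘ σ` on the places above `v`. -/
def FinitePlace.Over.twist {v : FinitePlace k} (σ : K ≃ₐ[k] K) (w : v.Over K) : v.Over K :=
  ⟨w.1.twist σ, (w.1.under_twist σ).trans w.2⟩

/-- Only finitely many places of `K` lie above a given finite place of `k`. -/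
instance FinitePlace.finite_over [Algebra.IsSeparable k K] (v : FinitePlace k) :
    Finite (v.Over K) := by
  let B := integralClosure v.ring K
  have hv : ∀ (w : v.Over K) (a : k), algebraMap k K a ∈ w.1.ring ↔ a ∈ v.ring := by
    rintro ⟨w, rfl⟩ a
    exact Iff.rfl
  have hB : ∀ (w : v.Over K) (b : B), (b : K) ∈ w.1.ring := by
    intro w b
    have hle : ∀ a : v.ring, algebraMap k K a ∈ w.1.ring := fun a ↦ (hv w a).mpr a.2
    obtain ⟨p, hp, hy⟩ := b.2
    have : IsIntegral w.1.ring (b : K) := by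
      refine ⟨p.map (((algebraMap k K).comp v.ring.subtype).codRestrict
        w.1.ring.toSubring hle), hp.map _, ?_⟩
      rw [Polynomial.eval₂_map]
      exact hy
    obtain ⟨z, hz⟩ := IsIntegrallyClosed.isIntegral_iff.mp this
    rw [← hz]
    exact z.2
  let φ : (w : v.Over K) → B →+* w.1.ring := fun w ↦
    (algebraMap B K).codRestrict w.1.ring.toSubring (hB w)
  let c : v.Over K → Ideal B := fun w ↦ (IsLocalRing.maximalIdeal w.1.ring).comap (φ w)
  have hded : IsDedekindDomain B := integralClosure.isDedekindDomain v.ring k K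
  have hfrac : IsFractionRing B K := integralClosure.isFractionRing_of_finite_extension k K
  have hinj : Function.Injective (algebraMap v.ring B) := fun a b hab ↦
    Subtype.ext ((algebraMap k K).injective (congrArg Subtype.val hab))
  have : FaithfulSMul v.ring B := (faithfulSMul_iff_algebraMap_injective _ _).mpr hinj
  have : Module.IsTorsionFree v.ring B :=
    (Module.isTorsionFree_iff_algebraMap_injective).mpr hinj
  have hfin : Finite ((IsLocalRing.maximalIdeal v.ring).primesOver B) :=
    IsDedekindDomain.primesOver_finite _ B
  have hprime : ∀ w, (c w).IsPrime := fun w ↦ Ideal.comap_isPrime _ _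
  have hc : ∀ w, c w ∈ (IsLocalRing.maximalIdeal v.ring).primesOver B := by
    refine fun w ↦ ⟨hprime w, ⟨le_antisymm (fun a ha ↦ ?_) ?_⟩⟩
    · rw [Ideal.under, Ideal.mem_comap, Ideal.mem_comap, IsLocalRing.mem_maximalIdeal]
      intro hu
      obtain ⟨u, hu⟩ := hu
      have hu' : ((u : w.1.ring) : K) = algebraMap k K a := congrArg Subtype.val hu
      have hmul : ((u : w.1.ring) : K) * ((u⁻¹ : w.1.ringˣ) : w.1.ring) = 1 :=
        congrArg (Subtype.val : w.1.ring → K) (Units.mul_inv u)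
      have hinv : algebraMap k K (a : k)⁻¹ ∈ w.1.ring := by
        rw [map_inv₀, ← hu', ← eq_inv_of_mul_eq_one_right hmul]
        exact Subtype.prop _
      rw [hv] at hinv
      refine (IsLocalRing.mem_maximalIdeal a).mp ha
        (IsUnit.of_mul_eq_one ⟨(a : k)⁻¹, hinv⟩ (Subtype.ext (mul_inv_cancel₀ ?_)))
      intro h0
      rw [h0, map_zero] at hu'
      rw [hu', zero_mul] at hmul
      exact zero_ne_one hmul
    · exact IsLocalRing.le_maximalIdeal (Ideal.IsPrime.under v.ring (c w)).ne_top
  have hle : ∀ w₁ w₂ : v.Over K, c w₁ = c w₂ → w₁.1.ring ≤ w₂.1.ring := by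
    intro w₁ w₂ h x hx
    have hb : c w₂ ≠ ⊥ := Ideal.ne_bot_of_mem_primesOver
      (IsDiscreteValuationRing.not_a_field v.ring) (hc w₂)
    have hunit : ∀ (w : v.Over K) (d : B), d ∉ c w → (d : K)⁻¹ ∈ w.1.ring := by
      intro w d hd
      rw [Ideal.mem_comap, IsLocalRing.mem_maximalIdeal, mem_nonunits_iff, not_not] at hd
      obtain ⟨u, hu⟩ := hd
      have hmul : ((u : w.1.ring) : K) * ((u⁻¹ : w.1.ringˣ) : w.1.ring) = 1 :=
        congrArg (Subtype.val : w.1.ring → K) (Units.mul_inv u)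
      have hu' : ((u : w.1.ring) : K) = d := congrArg Subtype.val hu
      rw [← hu', ← eq_inv_of_mul_eq_one_right hmul]
      exact Subtype.prop _
    have hne : ∀ d : B, d ∉ c w₂ → (d : K) ≠ 0 := fun d hd h0 ↦ hd (by
      rw [show d = 0 from Subtype.ext h0]
      exact zero_mem _)
    obtain ⟨n, ⟨d, hd⟩, hnd | hnd⟩ := HeightOneSpectrum.exists_primeCompl_mul_eq_or_mul_eq
      (⟨c w₂, hprime w₂, hb⟩ : HeightOneSpectrum B) x
    · replace hnd := (eq_mul_inv_iff_mul_eq₀ (hne d hd)).mpr hnd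
      rw [hnd]
      exact mul_mem (hB w₂ n) (hunit w₂ d hd)
    · by_cases hn : n ∈ c w₂
      · refine absurd ?_ hd
        change d ∈ c w₂
        rw [← h] at hn ⊢
        have hφ : φ w₁ d = ⟨x, hx⟩ * φ w₁ n := Subtype.ext hnd.symm
        rw [Ideal.mem_comap, hφ]
        exact Ideal.mul_mem_left _ _ hn
      · replace hnd := (eq_mul_inv_iff_mul_eq₀ (hne n hn)).mpr hnd
        rw [hnd]
        exact mul_mem (hB w₂ d) (hunit w₂ n hn)
  refine Finite.of_injective (fun w ↦ (⟨c w, hc w⟩ :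
    (IsLocalRing.maximalIdeal v.ring).primesOver B)) fun w₁ w₂ h ↦ ?_
  have h' : c w₁ = c w₂ := congrArg Subtype.val h
  exact Subtype.ext (FinitePlace.ext (le_antisymm (hle _ _ h') (hle _ _ h'.symm)))

/-! ### The product of the completions above a place -/

/-- The group `∏_{w ∣ v} K_wˣ`. -/
def LocalUnits (v : FinitePlace k) (K : Type*) [Field K] [Algebra k K]
    [FiniteDimensional k K] : Type _ :=
  (w : v.Over K) → (w.1.Completion)ˣ

instance (v : FinitePlace k) : CommGroup (LocalUnits v K) :=
  inferInstanceAs (CommGroup ((w : v.Over K) → (w.1.Completion)ˣ))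

/-- The natural action of `Gal(K/k)` on `∏_{w ∣ v} K_wˣ`: the component at `w` of `σ x` is the
image of the component of `x` at `w ∘ σ` under the isomorphism `K_{w ∘ σ} → K_w` extending `σ`. -/
instance (v : FinitePlace k) : MulDistribMulAction (K ≃ₐ[k] K) (LocalUnits v K) where
  smul σ x := fun w ↦
    Units.map (FinitePlace.completionMap (v := (w.twist σ).1) (w := w.1) (σ : K →+* K) rfl)
      (x (w.twist σ))
  one_smul x := by
    funext w
    exact Units.ext (FinitePlace.completionMap_id rfl _)
  mul_smul σ τ x := by
    funext w
    exact Units.ext (FinitePlace.completionMap_comp (u := ((w.twist σ).twist τ).1)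
      (v := (w.twist σ).1) (w := w.1) (τ : K →+* K) (σ : K →+* K) rfl rfl rfl _)
  smul_one σ := by
    funext w
    exact map_one _
  smul_mul σ x y := by
    funext w
    exact map_mul _ _ _

lemma LocalUnits.smul_apply {v : FinitePlace k} (σ : K ≃ₐ[k] K) (x : LocalUnits v K)
    (w : v.Over K) :
    (σ • x) w = Units.map (FinitePlace.completionMap (v := (w.twist σ).1) (w := w.1)
      (σ : K →+* K) rfl) (x (w.twist σ)) := rfl

/-- The local norm `N_{K_w/k_v} : K_wˣ → k_vˣ`. -/
def localNorm {v : FinitePlace k} (w : v.Over K) : (w.1.Completion)ˣ →* (v.Completion)ˣ :=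
  letI : Algebra v.Completion w.1.Completion :=
    (FinitePlace.completionMap (algebraMap k K) (congrArg FinitePlace.ring w.2)).toAlgebra
  Units.map (Algebra.norm v.Completion)

/-- The norm `N : ∏_{w ∣ v} K_wˣ → k_vˣ`, the product of the local norms. -/
def normMap [Algebra.IsSeparable k K] (v : FinitePlace k) :
    LocalUnits v K →* (v.Completion)ˣ where
  toFun x := ∏ᶠ w : v.Over K, localNorm w (x w)
  map_one' := by
    refine finprod_eq_one_of_forall_eq_one fun w ↦ map_one (localNorm w)
  map_mul' x y := by
    rw [← finprod_mul_distrib (Set.toFinite _) (Set.toFinite _)]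
    exact finprod_congr fun w ↦ map_mul (localNorm w) _ _

end Extension

/-! ### Moduli -/

/-- The ring `𝒪_{F,S}` of `S`-integers of `F`. -/
def SIntegers {F : Type*} [Field F] (S : Set (Place F)) : Subring F where
  carrier := {a | ∀ w : FinitePlace F, Place.finite w ∉ S → a ∈ w.ring}
  mul_mem' ha hb w hw := mul_mem (ha w hw) (hb w hw)
  one_mem' w _ := one_mem w.ring
  add_mem' ha hb w hw := add_mem (ha w hw) (hb w hw)
  zero_mem' w _ := zero_mem w.ring
  neg_mem' ha w hw := neg_mem (ha w hw)

/-- An `S`-modulus `𝔪 = 𝔪_f 𝔪_∞` of `F`: a nonzero ideal `𝔪_f` of `𝒪_{F,S}` and a set `𝔪_∞` of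
real places of `F`. -/
structure Modulus (F : Type*) [Field F] (S : Set (Place F)) where
  fin : Ideal (SIntegers S)
  fin_ne_bot : fin ≠ ⊥
  inf : Set (InfinitePlace F)
  isReal : ∀ w ∈ inf, w.IsReal

namespace Modulus

variable {F : Type*} [Field F] {S : Set (Place F)} (m : Modulus F S)

/-- The ideal generated by `𝔪_f` in the valuation ring of `w`, for `w ∉ S`. -/
def localIdeal (w : FinitePlace F) : Ideal w.ring :=
  Ideal.span {y | ∃ a ∈ m.fin, (a : F) = y}

/-- The ideal `𝔪 𝒪_w` of the ring of integers of the completion `F_w`, for `w ∉ S`. -/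
def completedIdeal (w : FinitePlace F) : Ideal w.Integers :=
  (m.localIdeal w).map (algebraMap w.ring w.Integers)

/-- The support `S(𝔪_f)` of `𝔪_f`: the finite places `w ∣ 𝔪_f`. -/
def finSupport : Set (FinitePlace F) :=
  {w | Place.finite w ∉ S ∧ m.localIdeal w ≠ ⊤}

/-- The group `F^𝔪` of the `x ∈ Fˣ` with `x ≡ 1 mod 𝔪_f` and `w(x) > 0` for all real
`w ∣ 𝔪_∞`. -/
def rayGroup : Subgroup Fˣ where
  carrier := {x | (∀ w ∈ m.finSupport, ∃ y ∈ m.localIdeal w, (y : F) = (x : F) - 1) ∧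
    ∀ (w : InfinitePlace F) (hw : w ∈ m.inf),
      0 < InfinitePlace.embedding_of_isReal (m.isReal w hw) (x : F)}
  one_mem' := ⟨fun w _ ↦ ⟨0, zero_mem _, by simp⟩, fun w hw ↦ by simp⟩
  mul_mem' := by
    rintro a b ⟨ha, ha'⟩ ⟨hb, hb'⟩
    refine ⟨fun w hw ↦ ?_, fun w hw ↦ ?_⟩
    · obtain ⟨y, hy, hya⟩ := ha w hw
      obtain ⟨z, hz, hzb⟩ := hb w hw
      refine ⟨y * z + y + z, add_mem (add_mem (Ideal.mul_mem_right _ _ hy) hy) hz, ?_⟩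
      push_cast
      rw [hya, hzb]
      ring
    · rw [Units.val_mul, map_mul]
      exact mul_pos (ha' w hw) (hb' w hw)
  inv_mem' := by
    rintro a ⟨ha, ha'⟩
    refine ⟨fun w hw ↦ ?_, fun w hw ↦ ?_⟩
    · obtain ⟨y, hy, hya⟩ := ha w hw
      have hu : IsUnit (y + 1) := by
        have := (IsLocalRing.le_maximalIdeal hw.2) hy
        by_contra h
        have h1 := (IsLocalRing.mem_maximalIdeal _).mpr h
        exact (IsLocalRing.mem_maximalIdeal (1 : w.ring)).mp ((add_sub_cancel_left y 1) ▸ sub_mem h1 this) isUnit_one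
      obtain ⟨u, hu⟩ := hu
      have hua : ((u : w.ring) : F) = a := by
        rw [hu]
        push_cast
        rw [hya]
        ring
      have hui : ((u⁻¹ : w.ringˣ) : w.ring) = ((a⁻¹ : Fˣ) : F) := by
        rw [Units.val_inv_eq_inv_val, ← hua]
        refine eq_inv_of_mul_eq_one_left ?_
        exact congrArg (Subtype.val : w.ring → F) (Units.inv_mul u)
      refine ⟨-(y * ((u⁻¹ : w.ringˣ) : w.ring)), neg_mem (Ideal.mul_mem_right _ _ hy), ?_⟩
      push_cast
      rw [hui, hya, Units.val_inv_eq_inv_val]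
      field_simp
      ring
    · rw [Units.val_inv_eq_inv_val, map_inv₀]
      exact inv_pos.mpr (ha' w hw)

/-- The group `1 + 𝔪 𝒪_w`, as a subgroup of `F_wˣ`: the units of `𝒪_w` that are congruent to `1`
modulo `𝔪 𝒪_w`. For `w ∣ 𝔪_f` every element of `1 + 𝔪 𝒪_w` is a unit of `𝒪_w`
(see `mem_rayUnits_iff`). -/
def rayUnits (w : FinitePlace F) : Subgroup (w.Completion)ˣ :=
  (Units.map (Ideal.Quotient.mk (m.completedIdeal w)).toMonoidHom).ker.map
    (Units.map w.Integers.subtype.toMonoidHom)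

lemma mem_rayUnits {w : FinitePlace F} {u : (w.Completion)ˣ} :
    u ∈ m.rayUnits w ↔ ∃ y : (w.Integers)ˣ, (y : w.Integers) - 1 ∈ m.completedIdeal w ∧
      ((y : w.Integers) : w.Completion) = u := by
  refine ⟨?_, ?_⟩
  · rintro ⟨y, hy, rfl⟩
    exact ⟨y, Ideal.Quotient.eq.mp (congrArg Units.val hy), rfl⟩
  · rintro ⟨y, hy, h⟩
    exact ⟨y, Units.ext (Ideal.Quotient.eq.mpr hy), Units.ext h⟩

lemma completedIdeal_ne_top {w : FinitePlace F} (hw : w ∈ m.finSupport) :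
    m.completedIdeal w ≠ ⊤ := by
  have hle : m.completedIdeal w ≤ IsLocalRing.maximalIdeal w.Integers := by
    rw [completedIdeal, Ideal.map_le_iff_le_comap]
    intro x hx
    have hx' := (IsLocalRing.le_maximalIdeal hw.2) hx
    rw [Ideal.mem_comap, IsLocalRing.mem_maximalIdeal, mem_nonunits_iff,
      HeightOneSpectrum.adicCompletionIntegers.isUnit_iff_valued_eq_one]
    refine ne_of_lt ?_
    rw [HeightOneSpectrum.algebraMap_adicCompletionIntegers_apply,
      HeightOneSpectrum.valuedAdicCompletion_eq_valuation']
    exact (HeightOneSpectrum.valuation_lt_one_iff_mem _ _).mpr hx'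
  exact fun h ↦ Ideal.IsPrime.ne_top' (top_le_iff.mp (h ▸ hle))

/-- For `w ∣ 𝔪_f` the group `rayUnits` is the set `1 + 𝔪 𝒪_w`. -/
lemma mem_rayUnits_iff {w : FinitePlace F} (hw : w ∈ m.finSupport) {u : (w.Completion)ˣ} :
    u ∈ m.rayUnits w ↔ ∃ y ∈ m.completedIdeal w, (u : w.Completion) = 1 + y := by
  rw [mem_rayUnits]
  refine ⟨?_, ?_⟩
  · rintro ⟨y, hy, h⟩
    refine ⟨_, hy, ?_⟩
    rw [← h]
    push_cast
    ring
  · rintro ⟨y, hy, h⟩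
    have hu : IsUnit (1 + y) := by
      have h0 := (IsLocalRing.le_maximalIdeal (m.completedIdeal_ne_top hw)) hy
      by_contra h'
      have h1 := (IsLocalRing.mem_maximalIdeal _).mpr h'
      exact (IsLocalRing.mem_maximalIdeal (1 : w.Integers)).mp
        ((add_sub_cancel_right 1 y) ▸ sub_mem h1 h0) isUnit_one
    refine ⟨hu.unit, by simpa using hy, ?_⟩
    rw [h, IsUnit.unit_spec]
    push_cast
    rfl

end Modulus

/-! ### The modulus of an extension field and the Galois action -/

section Galois

variable {k : Type*} (K : Type*) [Field k] [Field K] [Algebra k K] [FiniteDimensional k K]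
  {S : Set (Place k)}

/-- The inclusion `𝒪_{k,S} → 𝒪_{K,S_K}`, where `S_K` is the set of the places of `K` above `S`. -/
def SIntegers.map (S : Set (Place k)) :
    SIntegers S →+* SIntegers (Place.under k ⁻¹' S : Set (Place K)) :=
  (algebraMap k K).restrict _ _ fun _ ha w hw ↦ ha (w.under k) hw

/-- The modulus `𝔪_K` of `K` induced by a modulus `𝔪` of `k`: its finite part is `𝔪_f 𝒪_{K,S}`,
its infinite part consists of the real places of `K` above `𝔪_∞`. -/
def Modulus.induced (m : Modulus k S) : Modulus K (Place.under k ⁻¹' S) where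
  fin := m.fin.map (SIntegers.map K S)
  fin_ne_bot h := by
    refine m.fin_ne_bot ((Ideal.map_eq_bot_iff_of_injective ?_).mp h)
    intro a b hab
    exact Subtype.ext ((algebraMap k K).injective (congrArg Subtype.val hab))
  inf := {w | w.IsReal ∧ w.comap (algebraMap k K) ∈ m.inf}
  isReal _ hw := hw.1

variable {K} (m : Modulus k S)

lemma Modulus.apply_mem_induced (σ : K ≃ₐ[k] K)
    {a : SIntegers (Place.under k ⁻¹' S : Set (Place K))} (ha : a ∈ (m.induced K).fin) :
    ∃ b ∈ (m.induced K).fin, (b : K) = σ a := by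
  let φ : SIntegers (Place.under k ⁻¹' S : Set (Place K)) →+*
      SIntegers (Place.under k ⁻¹' S : Set (Place K)) :=
    (σ : K →+* K).restrict _ _ fun a ha w hw ↦ ha (w.twist σ) (by
      rw [Set.mem_preimage, Place.under, FinitePlace.under_twist]
      exact hw)
  have hφ : φ.comp (SIntegers.map K S) = SIntegers.map K S := by
    ext x
    exact σ.commutes _
  refine ⟨φ a, ?_, rfl⟩
  have := Ideal.mem_map_of_mem φ ha
  rwa [Modulus.induced, Ideal.map_map, hφ] at this

/-- `σ` as a map between the valuation rings of `w ∘ σ` and `w`. -/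
def ringTwist (σ : K ≃ₐ[k] K) (w : FinitePlace K) : (w.twist σ).ring →+* w.ring :=
  (σ : K →+* K).restrict (w.twist σ).ring w.ring fun _ hx ↦ hx

lemma Modulus.map_localIdeal_le (σ : K ≃ₐ[k] K) (w : FinitePlace K) :
    ((m.induced K).localIdeal (w.twist σ)).map (ringTwist σ w) ≤ (m.induced K).localIdeal w := by
  rw [Modulus.localIdeal, Ideal.map_span, Ideal.span_le]
  rintro _ ⟨y, ⟨a, ha, hay⟩, rfl⟩
  obtain ⟨b, hb, hba⟩ := m.apply_mem_induced σ ha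
  refine Ideal.subset_span ⟨b, hb, ?_⟩
  rw [hba, hay]
  rfl

lemma Modulus.twist_mem_finSupport (σ : K ≃ₐ[k] K) {w : FinitePlace K}
    (hw : w ∈ (m.induced K).finSupport) : w.twist σ ∈ (m.induced K).finSupport := by
  refine ⟨?_, fun h ↦ hw.2 ?_⟩
  · rw [Set.mem_preimage, Place.under, FinitePlace.under_twist]
    exact hw.1
  · have := m.map_localIdeal_le σ w
    rwa [h, Ideal.map_top, top_le_iff] at this

lemma Modulus.smul_mem_rayGroup (σ : K ≃ₐ[k] K) {x : Kˣ} (hx : x ∈ (m.induced K).rayGroup) :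
    σ • x ∈ (m.induced K).rayGroup := by
  refine ⟨fun w hw ↦ ?_, fun w hw ↦ ?_⟩
  · obtain ⟨y, hy, hyx⟩ := hx.1 _ (m.twist_mem_finSupport σ hw)
    refine ⟨ringTwist σ w y, m.map_localIdeal_le σ w (Ideal.mem_map_of_mem _ hy), ?_⟩
    change σ y = σ x - 1
    rw [hyx, map_sub, map_one]
  · have hw' : w.comap (σ : K →+* K) ∈ (m.induced K).inf := by
      refine ⟨hw.1.comap _, ?_⟩
      rw [← InfinitePlace.comap_comp]
      convert! hw.2 using 2
      ext x
      exact σ.commutes x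
    have h := hx.2 _ hw'
    convert! h using 1
    apply Complex.ofReal_injective
    rw [InfinitePlace.embedding_of_isReal_apply, InfinitePlace.embedding_of_isReal_apply,
      InfinitePlace.comap_embedding_of_isReal _ (hw.1.comap _)]
    rfl

/-- The group `∏_{w ∣ v} (1 + 𝔪 𝒪_w)`, as a subgroup of `∏_{w ∣ v} K_wˣ`. -/
def Modulus.rayProduct (K : Type*) [Field K] [Algebra k K] [FiniteDimensional k K]
    (m : Modulus k S) (v : FinitePlace k) : Subgroup (LocalUnits v K) where
  carrier := {x | ∀ w : v.Over K, x w ∈ (m.induced K).rayUnits w.1}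
  mul_mem' ha hb w := mul_mem (ha w) (hb w)
  one_mem' w := one_mem ((m.induced K).rayUnits w.1)
  inv_mem' ha w := inv_mem (ha w)

lemma Modulus.smul_mem_rayProduct {v : FinitePlace k} (σ : K ≃ₐ[k] K) {x : LocalUnits v K}
    (hx : x ∈ m.rayProduct K v) : σ • x ∈ m.rayProduct K v := by
  intro w
  obtain ⟨y, hy, hyx⟩ := ((m.induced K).mem_rayUnits).mp (hx (w.twist σ))
  let ψ : (w.1.twist σ).Integers →+* w.1.Integers :=
    FinitePlace.integersMap (σ : K →+* K) rfl
  have hle : ((m.induced K).completedIdeal (w.1.twist σ)).map ψ ≤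
      (m.induced K).completedIdeal w.1 := by
    have hcomm : ψ.comp (algebraMap (w.1.twist σ).ring (w.1.twist σ).Integers) =
        (algebraMap w.1.ring w.1.Integers).comp (ringTwist σ w.1) := by
      refine RingHom.ext fun a ↦ Subtype.ext ?_
      exact FinitePlace.completionMap_algebraMap (v := w.1.twist σ) (w := w.1)
        (σ : K →+* K) rfl (a : K)
    rw [Modulus.completedIdeal, Ideal.map_map, hcomm, ← Ideal.map_map]
    exact Ideal.map_mono (m.map_localIdeal_le σ w.1)
  refine ((m.induced K).mem_rayUnits).mpr ⟨Units.map ψ.toMonoidHom y, ?_, ?_⟩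
  · have := hle (Ideal.mem_map_of_mem ψ hy)
    have heq : ψ ((y : (w.twist σ).1.Integers) - 1 : (w.twist σ).1.Integers) =
        (Units.map ψ.toMonoidHom y : w.1.Integers) - 1 :=
      (map_sub ψ _ _).trans (congrArg _ (map_one ψ))
    exact heq ▸ this
  · rw [LocalUnits.smul_apply]
    exact congrArg (FinitePlace.completionMap (v := w.1.twist σ) (w := w.1) (σ : K →+* K) rfl) hyx

/-- The Galois action on `K^𝔪`. -/
instance : MulDistribMulAction (K ≃ₐ[k] K) (m.induced K).rayGroup where
  smul σ x := ⟨σ • (x : Kˣ), m.smul_mem_rayGroup σ x.2⟩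
  one_smul x := Subtype.ext (one_smul _ (x : Kˣ))
  mul_smul σ τ x := Subtype.ext (mul_smul σ τ (x : Kˣ))
  smul_one σ := Subtype.ext (MulDistribMulAction.smul_one (N := Kˣ) σ)
  smul_mul σ x y := Subtype.ext (smul_mul' σ (x : Kˣ) (y : Kˣ))

/-- The Galois action on `∏_{w ∣ v} (1 + 𝔪 𝒪_w)`. -/
instance (v : FinitePlace k) : MulDistribMulAction (K ≃ₐ[k] K) (m.rayProduct K v) where
  smul σ x := ⟨σ • (x : LocalUnits v K), m.smul_mem_rayProduct σ x.2⟩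
  one_smul x := Subtype.ext (one_smul _ (x : LocalUnits v K))
  mul_smul σ τ x := Subtype.ext (mul_smul σ τ (x : LocalUnits v K))
  smul_one σ := Subtype.ext (MulDistribMulAction.smul_one (N := LocalUnits v K) σ)
  smul_mul σ x y := Subtype.ext (smul_mul' σ (x : LocalUnits v K) (y : LocalUnits v K))

end Galois

end RayClass

end

open IsDedekindDomain NumberField
open scoped WithZero

noncomputable section

namespace RayClass

/-! ### First cohomology of multiplicative Galois modules -/

section Cohomology

open groupCohomology

/-! The isomorphism is Hilbert 90 combined with weak approximation. Cocycles of G in Kˣ have the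
form σ ↦ σb/b, and the same holds in ∏_{w ∣ v} K_wˣ (`isMulCoboundary₁_localUnits`). Given local
cocycles σx_v/x_v with values in ∏(1 + 𝔪𝒪_w), take b ∈ Kˣ close to every x_v and positive at the
real places above 𝔪_∞: then σb/b lies in K^𝔪, and b/x_v shows that it has the prescribed local
classes (`exists_isMulCocycle₁`). Conversely, let σb/b be a cocycle in K^𝔪 which at each v equals
σu_v/u_v with u_v ∈ ∏(1 + 𝔪𝒪_w). Then b/u_v is G-invariant, and c ∈ kˣ close to all of these, with
the signs of b above 𝔪_∞, makes b/c an element of K^𝔪 with the same coboundary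
(`isMulCoboundary₁_of_forall`). Such signs can be realized in k because σb/b is positive at these
places, so b has equal signs at conjugate places; this is why 𝔪_∞ leaves no trace in the answer.

If G is generated by g, then H¹(G, U) is ker N modulo the image of g - 1. For U = ∏(1 + 𝔪𝒪_w) the
Herbrand quotient is 1, so the order of H¹ is also [U^G : NU], and U^G = 1 + 𝔪𝒪_v. The Herbrand
quotient is found on a subgroup 1 + ϖⁿL of finite index, where L is spanned over invariant integers
by the conjugates of one element. On L the additive cohomology vanishes by a direct formula, the
norm on 1 + ϖⁿL is the trace up to higher order, and successive approximation with compactness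
carries the vanishing over to units (`NormalLattice.relIndex_eq`, `relIndex_gDiff_eq`).

All local arguments take place in the algebra ∏_{w ∣ v} K_w with the action of the whole of G, so
decomposition groups and local degrees never enter: a normal basis of K/k with its trace-dual basis
serves for ∏ K_w over k_v too. The hypothesis that k is a global field is used only through
`HasFinitePlaces`. -/

/-- The map induced on cocycles by an equivariant homomorphism, followed by the projection to
`H¹`. -/
def cocyclesToH1 {G M M' : Type} [Group G] [CommGroup M] [CommGroup M']
    [MulDistribMulAction G M] [MulDistribMulAction G M'] (φ : M →* M')
    (hφ : ∀ (g : G) (x : M), φ (g • x) = g • φ x) :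
    cocycles₁ (Rep.ofMulDistribMulAction G M) →+ H1 (Rep.ofMulDistribMulAction G M') where
  toFun f := H1π (Rep.ofMulDistribMulAction G M') (cocyclesOfIsMulCocycle₁
    (f := fun g ↦ φ (Additive.toMul (f.1 g))) (fun g h ↦ by
      have h1 := congrArg φ (isMulCocycle₁_of_mem_cocycles₁ _ f.2 g h)
      rw [map_mul, hφ] at h1
      exact h1))
  map_zero' := by
    rw [← map_zero (H1π (Rep.ofMulDistribMulAction G M')).hom]
    congr 1
    exact cocycles₁_ext fun g ↦ map_one φ
  map_add' f f' := by
    rw [← map_add (H1π (Rep.ofMulDistribMulAction G M')).hom]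
    congr 1
    exact cocycles₁_ext fun g ↦ map_mul φ _ _

lemma H1π_cocyclesOfIsMulCocycle₁_eq_zero_iff {G M : Type} [Group G] [CommGroup M]
    [MulDistribMulAction G M] {f : G → M} (hf : IsMulCocycle₁ f) :
    H1π (Rep.ofMulDistribMulAction G M) (cocyclesOfIsMulCocycle₁ hf) = 0 ↔
      IsMulCoboundary₁ f := by
  rw [H1π_eq_zero_iff]
  exact ⟨fun h ↦ isMulCoboundary₁_of_mem_coboundaries₁ _ h,
    fun h ↦ (coboundariesOfIsMulCoboundary₁ h).2⟩

/-- A family of equivariant maps that is injective and surjective on classes of multiplicative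
cocycles induces an isomorphism on `H¹`. -/
theorem nonempty_H1_equiv_pi {G M ι : Type} [Group G] [CommGroup M] [MulDistribMulAction G M]
    {M' : ι → Type} [∀ i, CommGroup (M' i)] [∀ i, MulDistribMulAction G (M' i)]
    (φ : ∀ i, M →* M' i) (hφ : ∀ i (g : G) (x : M), φ i (g • x) = g • φ i x)
    (hinj : ∀ f : G → M, IsMulCocycle₁ f → (∀ i, IsMulCoboundary₁ fun g ↦ φ i (f g)) →
      IsMulCoboundary₁ f)
    (hsurj : ∀ f : ∀ i, G → M' i, (∀ i, IsMulCocycle₁ (f i)) →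
      ∃ f' : G → M, IsMulCocycle₁ f' ∧ ∀ i, IsMulCoboundary₁ fun g ↦ φ i (f' g) / f i g) :
    Nonempty (H1 (Rep.ofMulDistribMulAction G M) ≃+
      ((i : ι) → H1 (Rep.ofMulDistribMulAction G (M' i)))) := by
  -- Both sides are quotients of the same group of cocycles, by `p` and by `q`, so it suffices that
  -- the two kernels agree.
  let p : cocycles₁ (Rep.ofMulDistribMulAction G M) →+ H1 (Rep.ofMulDistribMulAction G M) :=
    (H1π (Rep.ofMulDistribMulAction G M)).hom.toAddMonoidHom
  let q : cocycles₁ (Rep.ofMulDistribMulAction G M) →+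
      ((i : ι) → H1 (Rep.ofMulDistribMulAction G (M' i))) :=
    AddMonoidHom.pi fun i ↦ cocyclesToH1 (φ i) (hφ i)
  have hp : Function.Surjective p :=
    (ModuleCat.epi_iff_surjective (H1π (Rep.ofMulDistribMulAction G M))).mp inferInstance
  have hq : Function.Surjective q := by
    intro y
    have hex : ∀ i, ∃ f : G → M' i, ∃ hf : IsMulCocycle₁ f,
        H1π (Rep.ofMulDistribMulAction G (M' i)) (cocyclesOfIsMulCocycle₁ hf) = y i := by
      intro i
      obtain ⟨f, hf⟩ := (ModuleCat.epi_iff_surjective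
        (H1π (Rep.ofMulDistribMulAction G (M' i)))).mp inferInstance (y i)
      exact ⟨_, isMulCocycle₁_of_mem_cocycles₁ _ f.2, hf⟩
    choose f hf hfy using hex
    obtain ⟨f', hf', h⟩ := hsurj f hf
    refine ⟨cocyclesOfIsMulCocycle₁ hf', funext fun i ↦ ?_⟩
    rw [← hfy i]
    refine (H1π_eq_iff _ _).mpr ?_
    exact (coboundariesOfIsMulCoboundary₁ (h i)).2
  have hker : p.ker = q.ker := by
    ext f
    have h1 : p f = 0 ↔ IsMulCoboundary₁ (M := M) fun g ↦ Additive.toMul (f.1 g) :=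
      H1π_cocyclesOfIsMulCocycle₁_eq_zero_iff (isMulCocycle₁_of_mem_cocycles₁ _ f.2)
    have h2 : q f = 0 ↔ ∀ i, IsMulCoboundary₁ fun g ↦ φ i (Additive.toMul (f.1 g)) := by
      rw [funext_iff]
      exact forall_congr' fun i ↦ H1π_cocyclesOfIsMulCocycle₁_eq_zero_iff _
    rw [AddMonoidHom.mem_ker, AddMonoidHom.mem_ker, h1, h2]
    refine ⟨fun ⟨x, hx⟩ i ↦ ⟨φ i x, fun g ↦ ?_⟩,
      hinj _ (isMulCocycle₁_of_mem_cocycles₁ _ f.2)⟩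
    rw [← hφ, ← map_div, hx]
  exact ⟨(QuotientAddGroup.quotientKerEquivOfSurjective p hp).symm.trans
    ((QuotientAddGroup.quotientAddEquivOfEq hker).trans
      (QuotientAddGroup.quotientKerEquivOfSurjective q hq))⟩

variable (G M : Type*) [Group G] [CommGroup M] [MulDistribMulAction G M]

/-- The norm endomorphism `x ↦ ∏ σ, σ x` of a multiplicative `G`-module. -/
def gNorm [Fintype G] : M →* M where
  toFun x := ∏ σ : G, σ • x
  map_one' := by simp
  map_mul' x y := by simp [smul_mul', Finset.prod_mul_distrib]

lemma gNorm_apply [Fintype G] (x : M) : gNorm G M x = ∏ σ : G, σ • x := rfl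

variable {G}

/-- The endomorphism `x ↦ g x / x` of a multiplicative `G`-module. -/
def gDiff (g : G) : M →* M where
  toFun x := g • x / x
  map_one' := by simp
  map_mul' x y := by rw [smul_mul', mul_div_mul_comm]

lemma gDiff_apply (g : G) (x : M) : gDiff M g x = g • x / x := rfl

end Cohomology

/-! ### First cohomology of cyclic groups -/

section Cyclic

open scoped CategoryTheory

open groupCohomology Rep.FiniteCyclicGroup

/-- The 2-periodic complex with differentials N and g - 1 computes the cohomology of a cyclic group.
The commutative structure on G is an argument here; `card_H1_of_cyclic` derives it from cyclicity.
-/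
lemma card_H1_of_forall_mem_zpowers {G M : Type} [CommGroup G] [Fintype G] [CommGroup M]
    [MulDistribMulAction G M] (g : G) (hg : ∀ x, x ∈ Subgroup.zpowers g) :
    Nat.card (H1 (Rep.ofMulDistribMulAction G M)) =
      (gDiff M g).range.relIndex (gNorm G M).ker := by
  let A := Rep.ofMulDistribMulAction G M
  have hsurj : Function.Surjective (groupCohomologyπOdd A g hg 1 odd_one) := by
    -- The projection is a homology projection composed with isomorphisms on either side, hence an
    -- epimorphism.
    refine (ModuleCat.epi_iff_surjective (groupCohomologyπOdd A g hg 1 odd_one)).mp ?_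
    have : CategoryTheory.Epi (CategoryTheory.ShortComplex.homologyπ (subCompNormHom A g) ≫
        (groupCohomologyIsoOdd A g hg 1 odd_one).inv) := CategoryTheory.epi_comp _ _
    have : CategoryTheory.Epi (subCompNormHom A g).moduleCatCyclesIso.inv :=
      CategoryTheory.IsSplitEpi.epi (hf := CategoryTheory.IsSplitEpi.of_iso _)
    exact CategoryTheory.epi_comp' ‹_› ‹_›
  have hnorm : ∀ x : M, A.norm.hom (Rep.toAdditive.symm (Additive.ofMul x)) =
      Rep.toAdditive.symm (Additive.ofMul (gNorm G M x)) := fun x ↦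
    Representation.norm_ofMulDistribMulAction_eq (G := G) (Additive.ofMul x)
  have hker : ∀ x : (gNorm G M).ker, Rep.toAdditive.symm (Additive.ofMul (x : M)) ∈
      LinearMap.ker A.norm.hom.toLinearMap := fun x ↦ by
    rw [LinearMap.mem_ker]
    exact (hnorm x).trans (congrArg _ x.2)
  let F : (gNorm G M).ker →* Multiplicative (H1 A) :=
    MonoidHom.mk' (fun x ↦ Multiplicative.ofAdd (groupCohomologyπOdd A g hg 1 odd_one
      ⟨Rep.toAdditive.symm (Additive.ofMul (x : M)), hker x⟩)) fun x y ↦ by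
        rw [← ofAdd_add, ← map_add]; rfl
  have hF : Function.Surjective F := fun y ↦ by
    obtain ⟨x, hx⟩ := hsurj y.toAdd
    refine ⟨⟨(Rep.toAdditive x.1).toMul, ?_⟩, congrArg Multiplicative.ofAdd hx⟩
    exact (hnorm _).symm.trans x.2
  have hFker : F.ker = (gDiff M g).range.subgroupOf (gNorm G M).ker := by
    ext x
    exact groupCohomologyπOdd_eq_zero_iff A g hg 1 odd_one
      ⟨Rep.toAdditive.symm (Additive.ofMul (x : M)), hker x⟩
  rw [Subgroup.relIndex, Subgroup.index, ← hFker]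
  exact (Nat.card_congr (QuotientGroup.quotientKerEquivOfSurjective F hF).toEquiv).symm

attribute [local instance] IsCyclic.commGroup in
/-- For a finite cyclic group generated by `g`, the order of `H¹` is the index of the image of
`g - 1` in the kernel of the norm. -/
theorem card_H1_of_cyclic {G M : Type} [Group G] [Fintype G] [CommGroup M]
    [MulDistribMulAction G M] (g : G) (hg : ∀ x, x ∈ Subgroup.zpowers g) :
    Nat.card (H1 (Rep.ofMulDistribMulAction G M)) =
      (gDiff M g).range.relIndex (gNorm G M).ker := by
  have : IsCyclic G := ⟨g, hg⟩
  exact card_H1_of_forall_mem_zpowers (G := G) g hg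

end Cyclic

/-! ### The Herbrand quotient -/

section Herbrand

variable {U : Type*} [CommGroup U]

/-- The index of the images is that of AV ∩ B in B, and the modular law gives AV ∩ B = A(V ∩ B) = A.
-/
lemma relIndex_map_mk (V A B : Subgroup U) (hAB : A ≤ B)
    (h : ∀ b ∈ B, b ∈ V → b ∈ A) :
    (A.map (QuotientGroup.mk' V)).relIndex (B.map (QuotientGroup.mk' V)) = A.relIndex B := by
  rw [← Subgroup.relIndex_comap, Subgroup.comap_map_eq, QuotientGroup.ker_mk',
    ← Subgroup.inf_relIndex_right]
  congr 1
  refine le_antisymm ?_ (le_inf le_sup_left hAB)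
  rintro x ⟨hx, hxB⟩
  obtain ⟨a, ha, v, hv, rfl⟩ := Subgroup.mem_sup.mp hx
  exact mul_mem ha (h v ((mul_mem_cancel_left (hAB ha)).mp hxB) hv)

/-- A finite abelian group with two endomorphisms `N`, `D` has trivial Herbrand quotient. -/
lemma relIndex_eq_of_finite [Finite U] (N D : U →* U) (h1 : ∀ x, N (D x) = 1)
    (h2 : ∀ x, D (N x) = 1) :
    D.range.relIndex N.ker = N.range.relIndex D.ker := by
  have hN : D.range ≤ N.ker := by rintro _ ⟨x, rfl⟩; exact h1 x
  have hD : N.range ≤ D.ker := by rintro _ ⟨x, rfl⟩; exact h2 x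
  have e1 := Subgroup.relIndex_mul_relIndex ⊥ D.range N.ker bot_le hN
  have e2 := Subgroup.relIndex_mul_relIndex ⊥ N.range D.ker bot_le hD
  simp only [Subgroup.relIndex_bot_left] at e1 e2
  have e3 := Subgroup.card_mul_index N.ker
  have e4 := Subgroup.card_mul_index D.ker
  rw [Subgroup.index_ker] at e3 e4
  have p1 : 0 < Nat.card N.range := Nat.card_pos
  have p2 : 0 < Nat.card D.range := Nat.card_pos
  -- By Lagrange both sides are the order of U, once as |ker N|·|im N| and once as |ker D|·|im D|.
  have : Nat.card D.range * Nat.card N.range * D.range.relIndex N.ker =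
      Nat.card D.range * Nat.card N.range * N.range.relIndex D.ker := by
    calc _ = (Nat.card D.range * D.range.relIndex N.ker) * Nat.card N.range := by ring
      _ = (Nat.card N.range * N.range.relIndex D.ker) * Nat.card D.range := by
        rw [e1, e2, e3, e4]
      _ = _ := by ring
  exact Nat.eq_of_mul_eq_mul_left (by positivity) this

/-- The kernel of `N` modulo the image of `D` does not change on passing to the quotient by a
subgroup on which the complex of `N` and `D` is exact. -/
lemma relIndex_quotient (V : Subgroup U) (N D : U →* U) (h2 : ∀ x, D (N x) = 1)
    (h1 : ∀ x, N (D x) = 1) (hNV : V ≤ V.comap N) (hDV : V ≤ V.comap D)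
    (hN : ∀ x ∈ V, N x = 1 → ∃ y ∈ V, D y = x) (hD : ∀ x ∈ V, D x = 1 → ∃ y ∈ V, N y = x) :
    (QuotientGroup.map V V D hDV).range.relIndex (QuotientGroup.map V V N hNV).ker =
      D.range.relIndex N.ker := by
  have hk : (QuotientGroup.map V V N hNV).ker = N.ker.map (QuotientGroup.mk' V) := by
    ext q
    obtain ⟨x, rfl⟩ := QuotientGroup.mk_surjective q
    constructor
    · intro h
      have hx : N x ∈ V := (QuotientGroup.eq_one_iff _).mp h
      -- Since D kills N x, exactness on V gives N x = N v with v ∈ V; dividing x by v reaches ker N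
      -- within the same class.
      obtain ⟨v, hv, hvx⟩ := hD _ hx (h2 x)
      refine ⟨x / v, ?_, ?_⟩
      · change N (x / v) = 1
        rw [map_div, hvx, div_self']
      · change ((x / v : U) : U ⧸ V) = x
        rw [QuotientGroup.mk_div, (QuotientGroup.eq_one_iff v).mpr hv, div_one]
    · rintro ⟨y, hy, hyx⟩
      rw [← hyx]
      change ((N y : U) : U ⧸ V) = 1
      rw [show N y = 1 from hy]; rfl
  have hr : (QuotientGroup.map V V D hDV).range = D.range.map (QuotientGroup.mk' V) := by
    ext q
    constructor
    · rintro ⟨y, rfl⟩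
      obtain ⟨x, rfl⟩ := QuotientGroup.mk_surjective y
      exact ⟨D x, ⟨x, rfl⟩, rfl⟩
    · rintro ⟨_, ⟨x, rfl⟩, rfl⟩
      exact ⟨x, rfl⟩
  rw [hk, hr]
  refine relIndex_map_mk V _ _ (by rintro _ ⟨x, rfl⟩; exact h1 x) fun b hb hbV ↦ ?_
  obtain ⟨y, -, hy⟩ := hN b hbV hb
  exact ⟨y, hy⟩

/-- Two endomorphisms `N`, `D` with `ND = DN = 1` have Herbrand quotient `1` if their complex is
exact on a subgroup of finite index. -/
theorem relIndex_eq_of_finiteIndex (V : Subgroup U) [Finite (U ⧸ V)] (N D : U →* U)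
    (h1 : ∀ x, N (D x) = 1) (h2 : ∀ x, D (N x) = 1)
    (hNV : V ≤ V.comap N) (hDV : V ≤ V.comap D)
    (hN : ∀ x ∈ V, N x = 1 → ∃ y ∈ V, D y = x) (hD : ∀ x ∈ V, D x = 1 → ∃ y ∈ V, N y = x) :
    D.range.relIndex N.ker = N.range.relIndex D.ker ∧ D.range.relIndex N.ker ≠ 0 := by
  -- The hypotheses are symmetric in N and D, so both indices descend to the finite group U/V.
  rw [← relIndex_quotient V N D h2 h1 hNV hDV hN hD, ← relIndex_quotient V D N h1 h2 hDV hNV hD hN]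
  refine ⟨relIndex_eq_of_finite _ _ ?_ ?_, Subgroup.index_ne_zero_of_finite⟩
  · intro q
    obtain ⟨x, rfl⟩ := QuotientGroup.mk_surjective q
    exact congrArg (QuotientGroup.mk' V) (h1 x)
  · intro q
    obtain ⟨x, rfl⟩ := QuotientGroup.mk_surjective q
    exact congrArg (QuotientGroup.mk' V) (h2 x)

end Herbrand

/-! ### Traces -/

section Trace

variable (G : Type*) {A : Type*} [Group G] [Fintype G] [CommRing A] [MulSemiringAction G A]

/-- The trace `x ↦ ∑ σ, σ x` of a ring with an action of a finite group. -/
def gTrace : A →+ A where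
  toFun x := ∑ σ : G, σ • x
  map_zero' := by simp
  map_add' x y := by simp [Finset.sum_add_distrib]

lemma gTrace_apply (x : A) : gTrace G x = ∑ σ : G, σ • x := rfl

variable {G}

lemma smul_gTrace (g : G) (x : A) : g • gTrace G x = gTrace G x := by
  rw [gTrace_apply, Finset.smul_sum]
  exact Fintype.sum_equiv (Equiv.mulLeft g) _ _ fun σ ↦ by simp [mul_smul]

lemma gTrace_smul (g : G) (x : A) : gTrace G (g • x) = gTrace G x := by
  rw [gTrace_apply]
  exact Fintype.sum_equiv (Equiv.mulRight g) _ _ fun σ ↦ by simp [mul_smul]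

lemma gTrace_mul_of_fixed {a : A} (ha : ∀ g : G, g • a = a) (x : A) :
    gTrace G (a * x) = a * gTrace G x := by
  simp_rw [gTrace_apply, smul_mul', ha, Finset.mul_sum]

lemma gTrace_of_fixed_mul {a : A} (ha : ∀ g : G, g • a = a) (x : A) :
    gTrace G (x * a) = gTrace G x * a := by
  rw [mul_comm, gTrace_mul_of_fixed ha, mul_comm]

end Trace

/-! ### Lattices with a normal basis -/

/-- A topological ring `A` with an action of a finite group `G`, a compact open invariant subring
`O`, an invariant topologically nilpotent unit `ϖ ∈ O`, and an element `α ∈ O` whose conjugates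
form a basis over the invariants, with the conjugates of `β` as the dual basis for the trace. -/
structure NormalLattice (G A : Type*) [Group G] [Fintype G] [CommRing A] [MulSemiringAction G A]
    [TopologicalSpace A] where
  O : Subring A
  smul_mem : ∀ (g : G) {x : A}, x ∈ O → g • x ∈ O
  isCompact : IsCompact (O : Set A)
  isOpen : IsOpen (O : Set A)
  ϖ : Aˣ
  ϖ_mem : (ϖ : A) ∈ O
  smul_ϖ : ∀ g : G, g • (ϖ : A) = ϖ
  separated : ∀ x : A, (∀ n : ℕ, ∃ y ∈ O, x = ϖ ^ n * y) → x = 0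
  α : A
  β : A
  α_mem : α ∈ O
  -- The dual element β need not be integral; `c` bounds its denominator and measures how far the
  -- lattice of the conjugates of α is from O.
  c : ℕ
  β_mem : ϖ ^ c * β ∈ O
  -- The next two relations express completeness of the pair of dual bases, which makes the
  -- expansion in conjugates of α reproduce each element; `trace_conj` is orthogonality.
  sum_conj : ∀ τ : G, τ ≠ 1 → ∑ σ : G, σ • α * (τ * σ) • β = 0
  sum_conj_one : ∑ σ : G, σ • α * σ • β = 1
  trace_conj : ∀ σ τ : G, σ ≠ τ → gTrace G (σ • α * τ • β) = 0

namespace NormalLattice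

variable {G A : Type*} [Group G] [Fintype G] [CommRing A] [MulSemiringAction G A]
    [TopologicalSpace A] (D : NormalLattice G A)

lemma smul_ϖ_pow (g : G) (n : ℕ) : g • (D.ϖ : A) ^ n = (D.ϖ : A) ^ n := by
  rw [smul_pow', D.smul_ϖ]

/-- The additive group `ϖⁿ O`. -/
def F (n : ℕ) : AddSubgroup A where
  carrier := {x | ∃ y ∈ D.O, x = (D.ϖ : A) ^ n * y}
  zero_mem' := ⟨0, zero_mem _, by simp⟩
  add_mem' := by
    rintro _ _ ⟨y, hy, rfl⟩ ⟨z, hz, rfl⟩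
    exact ⟨y + z, add_mem hy hz, by ring⟩
  neg_mem' := by
    rintro _ ⟨y, hy, rfl⟩
    exact ⟨-y, neg_mem hy, by ring⟩

lemma mem_F {n : ℕ} {x : A} : x ∈ D.F n ↔ ∃ y ∈ D.O, x = (D.ϖ : A) ^ n * y := Iff.rfl

lemma F_anti {n m : ℕ} (h : n ≤ m) : D.F m ≤ D.F n := by
  rintro _ ⟨y, hy, rfl⟩
  obtain ⟨d, rfl⟩ := Nat.exists_eq_add_of_le h
  exact ⟨(D.ϖ : A) ^ d * y, mul_mem (pow_mem D.ϖ_mem d) hy, by ring⟩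

lemma mul_mem_F {n m : ℕ} {x y : A} (hx : x ∈ D.F n) (hy : y ∈ D.F m) : x * y ∈ D.F (n + m) := by
  obtain ⟨x, hx, rfl⟩ := hx
  obtain ⟨y, hy, rfl⟩ := hy
  exact ⟨x * y, mul_mem hx hy, by ring⟩

lemma mul_mem_F_left {n : ℕ} {x y : A} (hx : x ∈ D.O) (hy : y ∈ D.F n) : x * y ∈ D.F n := by
  obtain ⟨y, hy, rfl⟩ := hy
  exact ⟨x * y, mul_mem hx hy, by ring⟩

lemma smul_mem_F {n : ℕ} {x : A} (g : G) (hx : x ∈ D.F n) : g • x ∈ D.F n := by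
  obtain ⟨x, hx, rfl⟩ := hx
  exact ⟨g • x, D.smul_mem g hx, by rw [smul_mul', D.smul_ϖ_pow]⟩

lemma gTrace_mem_F {n : ℕ} {x : A} (hx : x ∈ D.F n) : gTrace G x ∈ D.F n :=
  sum_mem fun g _ ↦ D.smul_mem_F g hx

/-- The coordinates of `x` in the basis of the conjugates of `α`. -/
def coord (x : A) (σ : G) : A := gTrace G (x * σ • D.β)

lemma smul_coord (g : G) (x : A) (σ : G) : g • D.coord x σ = D.coord x σ := smul_gTrace g _

lemma coord_smul (g : G) (x : A) (σ : G) : D.coord (g • x) σ = D.coord x (g⁻¹ * σ) := by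
  rw [coord, coord, ← gTrace_smul g (x * _), smul_mul', smul_smul, mul_inv_cancel_left]

/-- After the traces are expanded and the two sums exchanged, completeness of the dual bases leaves
only the term at the identity of G. -/
lemma sum_coord (x : A) : ∑ σ : G, D.coord x σ * σ • D.α = x := by
  classical
  simp_rw [coord, gTrace_apply, smul_mul', smul_smul, Finset.sum_mul]
  rw [Finset.sum_comm]
  have h : ∀ τ : G, ∑ σ : G, τ • x * (τ * σ) • D.β * σ • D.α =
      if τ = 1 then x else 0 := by
    intro τ
    have h' : ∑ σ : G, τ • x * (τ * σ) • D.β * σ • D.α =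
        τ • x * ∑ σ : G, σ • D.α * (τ * σ) • D.β := by
      rw [Finset.mul_sum]
      exact Finset.sum_congr rfl fun σ _ ↦ by ring
    rw [h']
    split_ifs with hτ
    · subst hτ
      simp [D.sum_conj_one]
    · rw [D.sum_conj τ hτ, mul_zero]
  simp_rw [h]
  simp

/-- The lattice `ϖⁿ L` of the elements with coordinates in `ϖⁿ O`. -/
def L (n : ℕ) : AddSubgroup A where
  carrier := {x | ∀ σ : G, D.coord x σ ∈ D.F n}
  zero_mem' σ := by
    rw [coord, zero_mul, map_zero]
    exact zero_mem _
  add_mem' hx hy σ := by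
    rw [coord, add_mul, map_add]
    exact add_mem (hx σ) (hy σ)
  neg_mem' hx σ := by
    rw [coord, neg_mul, map_neg]
    exact neg_mem (hx σ)

lemma mem_L {n : ℕ} {x : A} : x ∈ D.L n ↔ ∀ σ : G, D.coord x σ ∈ D.F n := Iff.rfl

lemma L_le_F (n : ℕ) : D.L n ≤ D.F n := by
  intro x hx
  rw [← D.sum_coord x]
  refine sum_mem fun σ _ ↦ ?_
  rw [mul_comm]
  exact D.mul_mem_F_left (D.smul_mem σ D.α_mem) (hx σ)

/-- Together with `L_le_F` this makes ϖⁿL and ϖⁿO commensurable. The loss `c` comes from the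
denominator of β, and products, which are controlled only in the filtration `F`, return to `L` at
this cost. -/
lemma F_le_L {n m : ℕ} (h : n + D.c ≤ m) : D.F m ≤ D.L n := by
  intro x hx σ
  obtain ⟨y, hy, rfl⟩ := D.F_anti h hx
  refine D.gTrace_mem_F ⟨y * σ • ((D.ϖ : A) ^ D.c * D.β), mul_mem hy (D.smul_mem σ D.β_mem), ?_⟩
  rw [smul_mul', D.smul_ϖ_pow]
  ring

lemma L_anti {n m : ℕ} (h : n ≤ m) : D.L m ≤ D.L n := fun _ hx σ ↦ D.F_anti h (hx σ)

lemma smul_mem_L {n : ℕ} {x : A} (g : G) (hx : x ∈ D.L n) : g • x ∈ D.L n := fun σ ↦ by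
  rw [coord_smul]
  exact hx _

lemma coord_mul {a : A} (ha : ∀ g : G, g • a = a) (x : A) (σ : G) :
    D.coord (a * x) σ = a * D.coord x σ := by
  rw [coord, mul_assoc, gTrace_mul_of_fixed ha, coord]

lemma coord_smul_α_self (σ : G) : D.coord (σ • D.α) σ = 1 := by
  rw [coord, ← smul_mul', gTrace_smul, ← D.sum_conj_one, gTrace_apply]
  simp_rw [smul_mul']

lemma coord_smul_α_of_ne {σ τ : G} (h : σ ≠ τ) : D.coord (σ • D.α) τ = 0 := D.trace_conj σ τ h

lemma mul_smul_α_mem_L {n : ℕ} {a : A} (ha : ∀ g : G, g • a = a) (haF : a ∈ D.F n) (σ : G) :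
    a * σ • D.α ∈ D.L n := by
  intro τ
  rw [D.coord_mul ha]
  rcases eq_or_ne σ τ with rfl | h
  · rwa [coord_smul_α_self, mul_one]
  · rw [D.coord_smul_α_of_ne h, mul_zero]
    exact zero_mem _

/-- The lattice L is not closed under multiplication by O, but a factor 1 + y with y ∈ ϖⁿO, n ≥ c,
is harmless: y x lies so deep in `F` that it falls back into `L i`. -/
lemma mul_mem_L {n : ℕ} (hn : D.c ≤ n) {i : ℕ} {u x : A} (hu : u - 1 ∈ D.F n) (hx : x ∈ D.L i) :
    u * x ∈ D.L i := by
  have : u * x = (u - 1) * x + x := by ring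
  rw [this]
  exact add_mem (D.F_le_L (by lia) (D.mul_mem_F hu (D.L_le_F i hx))) hx

lemma prod_one_add_sub_mem {ι : Type*} (s : Finset ι) (x : ι → A) {i : ℕ}
    (hx : ∀ j ∈ s, x j ∈ D.F i) :
    ∏ j ∈ s, (1 + x j) - 1 - ∑ j ∈ s, x j ∈ D.F (i + i) := by
  classical
  induction s using Finset.induction_on with
  | empty => simp
  | insert a s ha ih =>
    have ih' := ih fun j hj ↦ hx j (Finset.mem_insert_of_mem hj)
    have h1 : ∑ j ∈ s, x j ∈ D.F i := sum_mem fun j hj ↦ hx j (Finset.mem_insert_of_mem hj)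
    have h2 := D.mul_mem_F (hx a (Finset.mem_insert_self a s))
      (add_mem (D.F_anti (Nat.le_add_right i i) ih') h1)
    rw [Finset.prod_insert ha, Finset.sum_insert ha]
    have := add_mem ih' h2
    convert! this using 1
    ring

/-- Expanding the trace of β gives ∑ tr(α · σβ), where orthogonality leaves only σ = 1. In
particular tr α is invertible, which makes every invariant element a trace. -/
lemma trace_one : gTrace G D.α * gTrace G D.β = 1 := by
  classical
  rw [← gTrace_of_fixed_mul (fun g ↦ smul_gTrace g _), gTrace_apply G D.β, Finset.mul_sum,
    map_sum, Finset.sum_eq_single 1]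
  · simpa [coord] using D.coord_smul_α_self 1
  · intro σ _ hσ
    simpa [coord] using D.coord_smul_α_of_ne (Ne.symm hσ)
  · simp

/-- An invariant element is a multiple of the trace of `α`. -/
lemma eq_coord_mul_of_fixed {r : A} (hr : ∀ g : G, g • r = r) :
    r = D.coord r 1 * gTrace G D.α := by
  rw [coord, one_smul, gTrace_mul_of_fixed hr, mul_assoc, mul_comm (gTrace G D.β), D.trace_one,
    mul_one]

/-- The sum of the coordinates of `r` is determined by the trace of `r`. -/
lemma sum_coord_eq (r : A) : ∑ σ : G, D.coord r σ = D.coord (gTrace G r) 1 := by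
  simp_rw [coord, one_smul]
  rw [gTrace_mul_of_fixed (fun g ↦ smul_gTrace g _),
    ← gTrace_of_fixed_mul (fun g ↦ smul_gTrace g _), ← map_sum, ← Finset.mul_sum]
  rfl

lemma gTrace_eq (r : A) : gTrace G r = (∑ σ : G, D.coord r σ) * gTrace G D.α := by
  rw [sum_coord_eq]
  exact D.eq_coord_mul_of_fixed fun g ↦ smul_gTrace g _

/-- Additive Hilbert 90 for the lattices `ϖⁿ L`. -/
lemma exists_sub_smul_eq (g : G) (hg : ∀ x, x ∈ Subgroup.zpowers g) {n : ℕ} {x : A}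
    (hx : x ∈ D.L n) (htr : gTrace G x = 0) : ∃ l ∈ D.L n, l - g • l = x := by
  classical
  -- The solution is l = ∑ e_j(S_j), where S_j is the sum of gⁱx over i < j and e_j is the
  -- projection to the line of gʲα. As g S_j = S_{j+1} - x and g e_j(y) = e_{j+1}(g y), applying g
  -- shifts the index by one and subtracts ∑ e_{j+1}(x) = x.
  let S : ℕ → A := fun j ↦ ∑ i ∈ Finset.range j, g ^ i • x
  let e : ℕ → A → A := fun j y ↦ D.coord y (g ^ j) * g ^ j • D.α
  have hsum : ∀ f : G → A, ∑ j ∈ Finset.range (orderOf g), f (g ^ j) = ∑ σ : G, f σ := by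
    intro f
    refine Finset.sum_nbij (fun j ↦ g ^ j) (by simp) ?_ ?_ (by simp)
    · intro i hi j hj h
      exact pow_injOn_Iio_orderOf (by simpa using hi) (by simpa using hj) h
    · intro σ _
      obtain ⟨j, hj, h⟩ := (isOfFinOrder_of_finite g).mem_zpowers_iff_mem_range_orderOf.mp (hg σ)
        |> Finset.mem_image.mp
      exact ⟨j, by simpa using hj, h⟩
  have hS : ∀ j, g • S j = S (j + 1) - x := fun j ↦ by
    simp only [S]
    rw [Finset.smul_sum, Finset.sum_range_succ', pow_zero, one_smul, add_sub_cancel_right]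
    simp_rw [smul_smul, pow_succ']
  have he : ∀ j y, g • e j y = e (j + 1) (g • y) := fun j y ↦ by
    simp only [e]
    rw [smul_mul', D.smul_coord, D.coord_smul, smul_smul, pow_succ', inv_mul_cancel_left]
  have he_sub : ∀ j y z, e j (y - z) = e j y - e j z := fun j y z ↦ by
    simp only [e, coord]
    rw [sub_mul, map_sub, sub_mul]
  have hSn : S (orderOf g) = 0 := (hsum (· • x)).trans htr
  have hen : e (orderOf g) = e 0 := by simp only [e, pow_orderOf_eq_one, pow_zero]
  refine ⟨∑ j ∈ Finset.range (orderOf g), e j (S j), sum_mem fun j _ ↦ ?_, ?_⟩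
  · refine D.mul_smul_α_mem_L (fun g ↦ D.smul_coord g _ _) ?_ _
    exact (sum_mem fun i _ ↦ D.smul_mem_L _ hx : S j ∈ D.L n) _
  · have h1 : g • ∑ j ∈ Finset.range (orderOf g), e j (S j) =
        ∑ j ∈ Finset.range (orderOf g), (e (j + 1) (S (j + 1)) - e (j + 1) x) := by
      rw [Finset.smul_sum]
      exact Finset.sum_congr rfl fun j _ ↦ by rw [he, hS, he_sub]
    -- The cyclic shift of the index needs equal values at both ends. For e_j(S_j) this is S_{ord g}
    -- = tr x = 0 = S_0, the only use of the vanishing trace.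
    have hshift : ∀ f : ℕ → A, f (orderOf g) = f 0 →
        ∑ j ∈ Finset.range (orderOf g), f (j + 1) = ∑ j ∈ Finset.range (orderOf g), f j := by
      intro f hf
      have := Finset.sum_range_succ' f (orderOf g)
      rw [Finset.sum_range_succ, hf] at this
      exact (add_right_cancel this).symm
    rw [h1, Finset.sum_sub_distrib, hshift (fun j ↦ e j (S j)), hshift (fun j ↦ e j x),
      sub_sub_cancel]
    · rw [hsum (fun σ ↦ D.coord x σ * σ • D.α)]
      exact D.sum_coord x
    · rw [hen]
    · rw [hSn, hen]
      simp [S]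

section Topology

variable [IsTopologicalRing A]

lemma isCompact_F (n : ℕ) : IsCompact (D.F n : Set A) := by
  have : (D.F n : Set A) = (fun y ↦ (D.ϖ : A) ^ n * y) '' D.O := by
    ext x
    simp [mem_F, eq_comm]
  rw [this]
  exact D.isCompact.image (by fun_prop)

lemma isOpen_F (n : ℕ) : IsOpen (D.F n : Set A) := by
  have : (D.F n : Set A) = (fun y ↦ ((D.ϖ⁻¹ ^ n : Aˣ) : A) * y) ⁻¹' D.O := by
    ext x
    simp only [SetLike.mem_coe, mem_F, Set.mem_preimage]
    constructor
    · rintro ⟨y, hy, rfl⟩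
      rw [← mul_assoc, ← Units.val_pow_eq_pow_val, ← Units.val_mul]
      simpa using hy
    · intro h
      refine ⟨_, h, ?_⟩
      rw [← mul_assoc, ← Units.val_pow_eq_pow_val, ← Units.val_mul]
      simp
  rw [this]
  exact D.isOpen.preimage (by fun_prop)

variable [ContinuousConstSMul G A]

lemma continuous_coord (σ : G) : Continuous fun x ↦ D.coord x σ := by
  simp only [coord, gTrace_apply]
  exact continuous_finsetSum _ fun τ _ ↦
    (continuous_const_smul τ).comp (continuous_mul_const _)

variable [T2Space A]

lemma isClosed_L (n : ℕ) : IsClosed (D.L n : Set A) := by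
  have : (D.L n : Set A) = ⋂ σ : G, (fun x ↦ D.coord x σ) ⁻¹' D.F n := by
    ext x
    simp [mem_L]
  rw [this]
  exact isClosed_iInter fun σ ↦ (D.isCompact_F n).isClosed.preimage (D.continuous_coord σ)

lemma isCompact_L (n : ℕ) : IsCompact (D.L n : Set A) :=
  (D.isCompact_F n).of_isClosed_subset (D.isClosed_L n) (D.L_le_F n)

/-- A continuous function taking arbitrarily small values on `1 + ϖⁿ L` has a zero there. -/
lemma exists_eq_zero {Φ : A → A} (hΦ : Continuous Φ) (n : ℕ)
    (h : ∀ i, ∃ w, w - 1 ∈ D.L n ∧ Φ w ∈ D.L (n + i)) : ∃ w, w - 1 ∈ D.L n ∧ Φ w = 0 := by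
  -- The points of the compact set 1 + ϖⁿL with Φ(w) in `L (n + i)` form a decreasing sequence of
  -- nonempty closed sets. A common point is sent to an element divisible by all powers of ϖ.
  let T : Set A := (fun w ↦ w - 1) ⁻¹' D.L n
  have hT : IsCompact T := (Homeomorph.subRight (1 : A)).isCompact_preimage.mpr (D.isCompact_L n)
  have hc : ∀ i, IsClosed (T ∩ Φ ⁻¹' D.L (n + i)) := fun i ↦
    hT.isClosed.inter ((D.isClosed_L _).preimage hΦ)
  obtain ⟨w, hw⟩ := IsCompact.nonempty_iInter_of_sequence_nonempty_isCompact_isClosed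
    (fun i ↦ T ∩ Φ ⁻¹' D.L (n + i))
    (fun i ↦ Set.inter_subset_inter_right _ (Set.preimage_mono (D.L_anti (by lia))))
    (fun i ↦ h i) (hT.of_isClosed_subset (hc 0) Set.inter_subset_left) hc
  rw [Set.mem_iInter] at hw
  refine ⟨w, (hw 0).1, D.separated _ fun i ↦ ?_⟩
  exact D.F_anti (Nat.le_add_left i n) (D.L_le_F _ (hw i).2)

end Topology

end NormalLattice

lemma map_div_sub_one {U A : Type*} [CommGroup U] [CommRing A] (ι : U →* A) (a b : U) :
    ι (a / b) - 1 = ι b⁻¹ * (ι a - ι b) := by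
  rw [mul_sub, ← map_mul, ← map_mul, inv_mul_cancel, map_one, mul_comm, div_eq_mul_inv]

lemma map_gNorm {G U A : Type*} [Group G] [Fintype G] [CommGroup U] [MulDistribMulAction G U]
    [CommRing A] [MulSemiringAction G A] (ι : U →* A) (hι : ∀ (g : G) u, ι (g • u) = g • ι u)
    (u : U) : ι (gNorm G U u) = ∏ σ : G, σ • ι u := by
  rw [gNorm_apply, map_prod]
  simp_rw [hι]

lemma smul_gNorm {G U : Type*} [Group G] [Fintype G] [CommGroup U] [MulDistribMulAction G U]
    (g : G) (u : U) : g • gNorm G U u = gNorm G U u := by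
  rw [gNorm_apply, Finset.smul_prod']
  exact Fintype.prod_equiv (Equiv.mulLeft g) _ _ fun σ ↦ by simp [mul_smul]

lemma gNorm_smul {G U : Type*} [Group G] [Fintype G] [CommGroup U] [MulDistribMulAction G U]
    (g : G) (u : U) : gNorm G U (g • u) = gNorm G U u := by
  rw [gNorm_apply]
  exact Fintype.prod_equiv (Equiv.mulRight g) _ _ fun σ ↦ by simp [mul_smul]

/-! ### Cohomology of the unit groups 1 + ϖⁿL -/

namespace NormalLattice

variable {G A : Type*} [Group G] [Fintype G] [CommRing A] [MulSemiringAction G A]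
    [TopologicalSpace A] (D : NormalLattice G A)
    {U : Type*} [CommGroup U]

/-- The elements of `U` that lie in `1 + ϖⁿ L`. -/
def V (ι : U →* A) (hO : ∀ u, ι u ∈ D.O) {n : ℕ} (hn : D.c ≤ n) : Subgroup U where
  carrier := {u | ι u - 1 ∈ D.L n}
  one_mem' := by simp
  mul_mem' {a b} ha hb := by
    have : ι (a * b) - 1 = ι a * (ι b - 1) + (ι a - 1) := by rw [map_mul]; ring
    rw [Set.mem_ofPred_eq, this]
    exact add_mem (D.mul_mem_L hn (D.L_le_F _ ha) hb) ha
  inv_mem' {a} ha := by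
    have h1 : ι a⁻¹ - 1 = ι a⁻¹ * -(ι a - 1) := by
      rw [← one_div, map_div_sub_one, map_one, one_div, neg_sub]
    have h2 : ι a⁻¹ - 1 ∈ D.F n := by
      rw [h1]
      exact D.mul_mem_F_left (hO _) (neg_mem (D.L_le_F _ ha))
    rw [Set.mem_ofPred_eq, h1]
    exact D.mul_mem_L hn h2 (neg_mem ha)

lemma mem_V {ι : U →* A} {hO : ∀ u, ι u ∈ D.O} {n : ℕ} {hn : D.c ≤ n} {u : U} :
    u ∈ D.V ι hO hn ↔ ι u - 1 ∈ D.L n := Iff.rfl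

lemma exists_mem_V {ι : U →* A} {hO : ∀ u, ι u ∈ D.O} {n : ℕ} {hn : D.c ≤ n}
    (hU : ∀ x ∈ D.F n, ∃ u, ι u = 1 + x) {y : A} (hy : y - 1 ∈ D.L n) :
    ∃ w ∈ D.V ι hO hn, ι w = y := by
  obtain ⟨w, hw⟩ := hU _ (D.L_le_F _ hy)
  rw [add_sub_cancel] at hw
  exact ⟨w, by rwa [mem_V, hw], hw⟩

/-- On `1 + ϖⁱ L` the norm is approximated by the trace. -/
lemma norm_sub_mem {i : ℕ} (hi : D.c < i) {x : A} (hx : x ∈ D.L i) :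
    ∏ σ : G, σ • (1 + x) - 1 - gTrace G x ∈ D.L (i + 1) := by
  simp_rw [smul_add, smul_one]
  -- The terms of degree at least two lie in `F (i + i)`, which is inside `L (i + 1)` exactly
  -- because i + 1 + c ≤ 2i for i > c.
  exact D.F_le_L (by lia) (D.prod_one_add_sub_mem Finset.univ (fun σ : G ↦ σ • x)
    fun σ _ ↦ D.smul_mem_F σ (D.L_le_F _ hx))

/-- `1 + ϖⁿ L` has finite index in a group of units of `O`. -/
lemma finite_quotient_V [IsTopologicalRing A] {ι : U →* A} {hO : ∀ u, ι u ∈ D.O} {n : ℕ}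
    {hn : D.c ≤ n} : Finite (U ⧸ D.V ι hO hn) := by
  have : CompactSpace D.O := isCompact_iff_compactSpace.mp D.isCompact
  -- Units congruent modulo ϖ^(n+c) O have their quotient in 1 + ϖ^(n+c) O, hence in 1 + ϖⁿL. An
  -- open subgroup of the compact group O has finite index.
  let H : AddSubgroup D.O := (D.F (n + D.c)).comap D.O.subtype.toAddMonoidHom
  have hH : IsOpen (H : Set D.O) := (D.isOpen_F _).preimage continuous_subtype_val
  have : Finite (D.O ⧸ H) := AddSubgroup.quotient_finite_of_isOpen H hH
  let f : U → D.O ⧸ H := fun u ↦ QuotientAddGroup.mk ⟨ι u, hO u⟩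
  refine Finite.of_injective (β := Set.range f)
    (fun q ↦ ⟨f q.out, Set.mem_range_self _⟩) fun q q' h ↦ ?_
  have h1 := QuotientAddGroup.eq.mp (congrArg Subtype.val h)
  rw [← q.out_eq, ← q'.out_eq]
  refine QuotientGroup.eq.mpr ?_
  rw [mem_V, inv_mul_eq_div, map_div_sub_one]
  refine D.F_le_L le_rfl (D.mul_mem_F_left (hO _) ?_)
  rw [sub_eq_neg_add]
  exact h1

variable [MulDistribMulAction G U]

lemma smul_mem_V {ι : U →* A} (hι : ∀ (g : G) u, ι (g • u) = g • ι u) {hO : ∀ u, ι u ∈ D.O}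
    {n : ℕ} {hn : D.c ≤ n} {u : U} (g : G) (hu : u ∈ D.V ι hO hn) : g • u ∈ D.V ι hO hn := by
  rw [mem_V, hι]
  have : g • ι u - 1 = g • (ι u - 1) := by rw [smul_sub, smul_one]
  rw [this]
  exact D.smul_mem_L g hu

variable [IsTopologicalRing A] [ContinuousConstSMul G A] [T2Space A]

/-- The Tate cohomology group `Ĥ⁰` of `1 + ϖⁿ L` vanishes. -/
lemma exists_gNorm_eq {ι : U →* A} (hinj : Function.Injective ι)
    (hι : ∀ (g : G) u, ι (g • u) = g • ι u) {hO : ∀ u, ι u ∈ D.O}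
    {n : ℕ} (hn : D.c < n) (hU : ∀ x ∈ D.F n, ∃ u, ι u = 1 + x) {u : U}
    (hu : u ∈ D.V ι hO hn.le) (hfix : ∀ g : G, g • u = u) :
    ∃ w ∈ D.V ι hO hn.le, gNorm G U w = u := by
  -- Successive approximation: the error u/N(w) = 1 + r has r invariant, so r is the trace of an
  -- element e of the same depth, and replacing w by w(1 + e) gains one power of ϖ.
  have happrox : ∀ i, ∃ w, w - 1 ∈ D.L n ∧ ι u - ∏ σ : G, σ • w ∈ D.L (n + i) := by
    intro i
    induction i with
    | zero =>
      refine ⟨1, by simp, ?_⟩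
      simp only [smul_one, Finset.prod_const_one]
      exact hu
    | succ i ih =>
      obtain ⟨y, hy, hyi⟩ := ih
      obtain ⟨w, hw, rfl⟩ := D.exists_mem_V (hO := hO) (hn := hn.le) hU hy
      rw [← map_gNorm ι hι] at hyi
      have hNw : gNorm G U w ∈ D.V ι hO hn.le := prod_mem fun σ _ ↦ D.smul_mem_V hι σ hw
      let t : U := u / gNorm G U w
      let r : A := ι t - 1
      have hr : r ∈ D.L (n + i) := by
        simp only [r, t]
        rw [map_div_sub_one]
        exact D.mul_mem_L hn.le (D.L_le_F _ (inv_mem hNw)) hyi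
      have hrfix : ∀ g : G, g • r = r := fun g ↦ by
        simp only [r]
        rw [smul_sub, ← hι, smul_one, smul_div', hfix, smul_gNorm]
      have he := D.mul_smul_α_mem_L (fun g ↦ D.smul_coord g _ _) (hr 1) 1
      rw [one_smul] at he
      -- An invariant r has all coordinates equal, so one coordinate times α already has trace r.
      have htr : gTrace G (D.coord r 1 * D.α) = r := by
        rw [gTrace_mul_of_fixed (fun g ↦ D.smul_coord g _ _), ← D.eq_coord_mul_of_fixed hrfix]
      obtain ⟨w', hw', hw'y⟩ := D.exists_mem_V (hO := hO) (hn := hn.le) hU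
        (y := 1 + D.coord r 1 * D.α) (by
          rw [add_sub_cancel_left]; exact D.L_anti (Nat.le_add_right n i) he)
      have hN := D.norm_sub_mem (by lia) he
      rw [htr, ← hw'y, ← map_gNorm ι hι] at hN
      refine ⟨ι (w * w'), mul_mem hw hw', ?_⟩
      rw [← map_gNorm ι hι]
      have h1 : ι u - ι (gNorm G U (w * w')) =
          ι (gNorm G U w) * -(ι (gNorm G U w') - 1 - r) := by
        have : ι u = ι (gNorm G U w) * ι t := by rw [← map_mul, mul_div_cancel]
        rw [map_mul, map_mul, this]
        simp only [r]
        ring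
      rw [h1]
      exact D.mul_mem_L hn.le (D.L_le_F _ hNw) (neg_mem hN)
  obtain ⟨y, hy, hy0⟩ := D.exists_eq_zero (Φ := fun w ↦ ι u - ∏ σ : G, σ • w)
    (continuous_const.sub (continuous_finsetProd _ fun σ _ ↦ continuous_const_smul σ)) n happrox
  obtain ⟨w, hw, rfl⟩ := D.exists_mem_V hU hy
  refine ⟨w, hw, hinj ?_⟩
  rw [map_gNorm ι hι]
  exact (sub_eq_zero.mp hy0).symm

/-- The first cohomology of `1 + ϖⁿ L` for a cyclic group vanishes. -/
lemma exists_gDiff_eq {ι : U →* A} (hinj : Function.Injective ι)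
    (hι : ∀ (g : G) u, ι (g • u) = g • ι u) {hO : ∀ u, ι u ∈ D.O}
    {n : ℕ} (hn : D.c < n) (hU : ∀ x ∈ D.F n, ∃ u, ι u = 1 + x)
    (g : G) (hg : ∀ x, x ∈ Subgroup.zpowers g) {u : U}
    (hu : u ∈ D.V ι hO hn.le) (hNu : gNorm G U u = 1) :
    ∃ w ∈ D.V ι hO hn.le, gDiff U g w = u := by
  -- Successive approximation again: the error t = u w/g w = 1 + r has norm 1, so the trace of r is
  -- one order smaller than r. After a correction of that order the trace is zero and additive
  -- Hilbert 90 applies.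
  have happrox : ∀ i, ∃ w, w - 1 ∈ D.L n ∧ ι u * w - g • w ∈ D.L (n + i) := by
    intro i
    induction i with
    | zero =>
      refine ⟨1, by simp, ?_⟩
      simp only [smul_one, mul_one]
      exact hu
    | succ i ih =>
      obtain ⟨y, hy, hyi⟩ := ih
      obtain ⟨w, hw, rfl⟩ := D.exists_mem_V (hO := hO) (hn := hn.le) hU hy
      rw [← hι, ← map_mul] at hyi
      have hgw : g • w ∈ D.V ι hO hn.le := D.smul_mem_V hι g hw
      let t : U := u * w / g • w
      let r : A := ι t - 1
      have hr : r ∈ D.L (n + i) := by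
        simp only [r, t]
        rw [map_div_sub_one]
        exact D.mul_mem_L hn.le (D.L_le_F _ (inv_mem hgw)) hyi
      have hNt : ∏ σ : G, σ • (1 + r) = 1 := by
        simp only [r]
        rw [add_sub_cancel, ← map_gNorm ι hι, map_div, map_mul, gNorm_smul, hNu, one_mul, div_self',
          map_one]
      have htr : gTrace G r ∈ D.L (n + i + 1) := by
        have := D.norm_sub_mem (by lia) hr
        rw [hNt, sub_self, zero_sub] at this
        exact neg_mem_iff.mp this
      -- The coefficient s is chosen with tr(sα) = tr r; it inherits the smallness of the trace.
      let s : A := D.coord (gTrace G r) 1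
      have hs : ∀ g : G, g • s = s := fun g ↦ D.smul_coord g _ _
      have hsα : s * D.α ∈ D.L (n + i + 1) := by
        have := D.mul_smul_α_mem_L hs (htr 1) 1
        rwa [one_smul] at this
      obtain ⟨l, hl, hlx⟩ := D.exists_sub_smul_eq g hg (x := r - s * D.α)
        (sub_mem hr (D.L_anti (Nat.le_succ _) hsα)) (by
          rw [map_sub, gTrace_mul_of_fixed hs, D.gTrace_eq r, D.sum_coord_eq, sub_self])
      obtain ⟨w', hw', hw'y⟩ := D.exists_mem_V (hO := hO) (hn := hn.le) hU (y := 1 - l) (by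
          rw [sub_sub_cancel_left]; exact neg_mem (D.L_anti (Nat.le_add_right n i) hl))
      refine ⟨ι (w * w'), mul_mem hw hw', ?_⟩
      -- For w' = 1 - l the relation l - g l = r - sα cancels the linear part of the error. There
      -- remain sα and the quadratic term r l, both of higher order.
      have h1 : ι u * ι (w * w') - g • ι (w * w') = ι (g • w) * (s * D.α - r * l) := by
        have h2 : ι u * ι w = ι (g • w) * ι t := by rw [← map_mul, ← map_mul, mul_div_cancel]
        have h3 : ι t = 1 + r := (add_sub_cancel 1 (ι t)).symm
        rw [map_mul, smul_mul', ← hι, hw'y, smul_sub, smul_one]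
        linear_combination (1 - l) * h2 + ι (g • w) * (1 - l) * h3 - ι (g • w) * hlx
      rw [h1]
      exact D.mul_mem_L hn.le (D.L_le_F _ hgw) (sub_mem hsα
        (D.F_le_L (by lia) (D.mul_mem_F (D.L_le_F _ hr) (D.L_le_F _ hl))))
  obtain ⟨y, hy, hy0⟩ := D.exists_eq_zero (Φ := fun w ↦ ι u * w - g • w)
    ((continuous_const_mul _).sub (continuous_const_smul g)) n happrox
  obtain ⟨w, hw, rfl⟩ := D.exists_mem_V hU hy
  refine ⟨w, hw, ?_⟩
  rw [gDiff_apply, div_eq_iff_eq_mul]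
  refine hinj ?_
  rw [hι, map_mul]
  exact (sub_eq_zero.mp hy0).symm

/-- A group of units of `O` containing a neighbourhood of `1` has trivial Herbrand quotient. -/
theorem relIndex_eq (ι : U →* A) (hinj : Function.Injective ι)
    (hι : ∀ (g : G) u, ι (g • u) = g • ι u) (hO : ∀ u, ι u ∈ D.O)
    (n : ℕ) (hU : ∀ x ∈ D.F n, ∃ u, ι u = 1 + x)
    (g : G) (hg : ∀ x, x ∈ Subgroup.zpowers g) :
    (gDiff U g).range.relIndex (gNorm G U).ker = (gNorm G U).range.relIndex (gDiff U g).ker ∧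
      (gDiff U g).range.relIndex (gNorm G U).ker ≠ 0 := by
  -- The depth must be at least n, so that U contains 1 + ϖ^m O, and exceed c, so that the
  -- approximation gains in each step.
  have hm : D.c < max n (D.c + 1) := by lia
  have hU' : ∀ x ∈ D.F (max n (D.c + 1)), ∃ u, ι u = 1 + x := fun x hx ↦
    hU x (D.F_anti (le_max_left _ _) hx)
  have hfix : ∀ u : U, g • u = u → ∀ σ : G, σ • u = u := fun u hu σ ↦ by
    have : g ∈ MulAction.stabilizer G u := hu
    exact (Subgroup.zpowers_le.mpr this) (hg σ)
  have := D.finite_quotient_V (ι := ι) (hO := hO) (hn := hm.le)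
  refine relIndex_eq_of_finiteIndex (D.V ι hO hm.le) _ _ (fun x ↦ ?_) (fun x ↦ ?_)
    (fun x hx ↦ ?_) (fun x hx ↦ ?_) (fun x hx h ↦ ?_) (fun x hx h ↦ ?_)
  · rw [gDiff_apply, map_div, gNorm_smul, div_self']
  · rw [gDiff_apply, smul_gNorm, div_self']
  · exact prod_mem fun σ _ ↦ D.smul_mem_V hι σ hx
  · exact div_mem (D.smul_mem_V hι g hx) hx
  · exact D.exists_gDiff_eq hinj hι hm hU' g hg hx h
  · exact D.exists_gNorm_eq hinj hι hm hU' hx (hfix x (div_eq_one.mp h))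

end NormalLattice

/-! ### Weak approximation -/

namespace FinitePlace

variable {F : Type*} [Field F]

/-- A real absolute value defining the place `w`. -/
def abv (w : FinitePlace F) : AbsoluteValue F ℝ :=
  (IsDiscreteValuationRing.maximalIdeal w.ring).adicAbv (b := 2) one_lt_two

lemma abv_le_abv_iff (w : FinitePlace F) {x y : F} : w.abv x ≤ w.abv y ↔ w.val x ≤ w.val y :=
  NNReal.coe_le_coe.trans (WithZeroMulInt.toNNReal_strictMono one_lt_two).le_iff_le

lemma abv_lt_abv_iff (w : FinitePlace F) {x y : F} : w.abv x < w.abv y ↔ w.val x < w.val y :=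
  lt_iff_lt_of_le_iff_le w.abv_le_abv_iff

lemma abv_le_one_iff (w : FinitePlace F) {x : F} : w.abv x ≤ 1 ↔ x ∈ w.ring := by
  rw [← val_le_one_iff, ← map_one w.abv, abv_le_abv_iff, map_one]

lemma exists_val_lt_one (w : FinitePlace F) : ∃ π : F, π ≠ 0 ∧ w.val π < 1 := by
  obtain ⟨π, hπ⟩ := HeightOneSpectrum.valuation_exists_uniformizer F
    (IsDiscreteValuationRing.maximalIdeal w.ring)
  refine ⟨π, ?_, ?_⟩
  · rintro rfl
    rw [map_zero] at hπ
    exact WithZero.coe_ne_zero hπ.symm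
  · rw [val, hπ]
    decide

/-- Ramification rescales the normalized valuation, so values themselves do not restrict, only
inequalities between them; these are membership of a/b in the valuation ring. -/
lemma val_le_val_iff_of_comap {F' : Type*} [Field F'] {f : F →+* F'} {v : FinitePlace F}
    {w : FinitePlace F'} (h : w.ring.comap f = v.ring) {a b : F} :
    w.val (f a) ≤ w.val (f b) ↔ v.val a ≤ v.val b := by
  rcases eq_or_ne b 0 with rfl | hb
  · simp
  have h1 : 0 < v.val b := zero_lt_iff.mpr (by simpa using hb)
  have h2 : 0 < w.val (f b) := zero_lt_iff.mpr (by simpa using hb)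
  rw [← div_le_one₀ h1, ← div_le_one₀ h2, ← map_div₀, ← map_div₀, ← map_div₀, val_le_one_iff,
    val_le_one_iff, ← h, ValuationSubring.mem_comap]

lemma val_lt_one_iff_of_comap {F' : Type*} [Field F'] {f : F →+* F'} {v : FinitePlace F}
    {w : FinitePlace F'} (h : w.ring.comap f = v.ring) {a : F} :
    w.val (f a) < 1 ↔ v.val a < 1 := by
  have := lt_iff_lt_of_le_iff_le (val_le_val_iff_of_comap h (a := 1) (b := a))
  simpa using this

lemma val_eq_one_of_sub_one (w : FinitePlace F) {x : F} (h : w.val (x - 1) < 1) :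
    w.val x = 1 := by
  have h1 := Valuation.map_one_add_of_lt _ h
  rwa [add_sub_cancel] at h1

lemma isNontrivial_abv (w : FinitePlace F) : w.abv.IsNontrivial := by
  obtain ⟨π, h0, h1⟩ := w.exists_val_lt_one
  refine ⟨π, h0, ne_of_lt ?_⟩
  rwa [← map_one w.abv, abv_lt_abv_iff, map_one]

lemma isEquiv_abv_iff {w w' : FinitePlace F} : w.abv.IsEquiv w'.abv ↔ w = w' := by
  refine ⟨fun h ↦ ?_, fun h ↦ h ▸ .rfl⟩
  ext x
  rw [← abv_le_one_iff, ← abv_le_one_iff, h.le_one_iff]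

/-- The integer 2 has absolute value at most 1 at a finite place and exactly 2 at an archimedean
one. -/
lemma not_isEquiv_abv_infinitePlace (w : FinitePlace F) (u : InfinitePlace F) :
    ¬ w.abv.IsEquiv u.1 := by
  intro h
  have h2 : w.abv ((2 : ℕ) : F) ≤ 1 := w.abv_le_one_iff.mpr (natCast_mem w.ring 2)
  rw [h.le_one_iff] at h2
  have h3 : u ((2 : ℕ) : F) = (2 : ℕ) := u.map_natCast 2
  rw [← InfinitePlace.coe_apply, h3] at h2
  norm_num at h2

end FinitePlace

section Approximation

variable {F : Type*} [Field F]

/-- Weak approximation for finite sets of finite and of infinite places. -/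
theorem exists_approx {T : Set (FinitePlace F)} (hT : T.Finite) {T' : Set (InfinitePlace F)}
    (hT' : T'.Finite) (x a : FinitePlace F → F) (ha : ∀ w ∈ T, a w ≠ 0) (y : InfinitePlace F → F) :
    ∃ b : F, (∀ w ∈ T, w.val (b - x w) < w.val (a w)) ∧ ∀ w ∈ T', w (b - y w) < 1 := by
  have := hT.to_subtype
  have := hT'.to_subtype
  let u : T ⊕ T' → AbsoluteValue F ℝ := Sum.elim (fun w ↦ w.1.abv) (fun w ↦ w.1.1)
  have h1 : ∀ i, (u i).IsNontrivial := by
    rintro (w | w)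
    · exact w.1.isNontrivial_abv
    · exact w.1.isNontrivial
  have h2 : Pairwise fun i j ↦ ¬ (u i).IsEquiv (u j) := by
    rintro (w | w) (w' | w') hne h
    · exact hne (congrArg _ (Subtype.ext (FinitePlace.isEquiv_abv_iff.mp h)))
    · exact w.1.not_isEquiv_abv_infinitePlace w'.1 h
    · exact w'.1.not_isEquiv_abv_infinitePlace w.1 h.symm
    · exact hne (congrArg _ (Subtype.ext (InfinitePlace.eq_iff_isEquiv.mpr h)))
  let z : (i : T ⊕ T') → WithAbs (u i) := fun i ↦
    WithAbs.toAbs (u i) (Sum.elim (fun w ↦ x w.1) (fun w ↦ y w.1) i)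
  let s : (i : T ⊕ T') → Set (WithAbs (u i)) := fun i ↦
    Metric.ball (z i) (Sum.elim (fun w ↦ w.1.abv (a w.1)) (fun _ ↦ 1) i)
  have hs : (Set.univ.pi s) ∈ nhds z := by
    refine set_pi_mem_nhds Set.finite_univ fun i _ ↦ Metric.ball_mem_nhds _ ?_
    rcases i with w | w
    · exact w.1.abv.pos (ha w.1 w.2)
    · exact one_pos
  obtain ⟨b, hb⟩ := (AbsoluteValue.denseRange_algebraMap_pi h1 h2).exists_mem_open
    isOpen_interior ⟨z, mem_interior_iff_mem_nhds.mpr hs⟩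
  have hb' := interior_subset hb
  refine ⟨b, fun w hw ↦ ?_, fun w hw ↦ ?_⟩
  · have := hb' (Sum.inl ⟨w, hw⟩) (Set.mem_univ _)
    rw [mem_ball_iff_norm] at this
    exact w.abv_lt_abv_iff.mp this
  · have := hb' (Sum.inr ⟨w, hw⟩) (Set.mem_univ _)
    rw [mem_ball_iff_norm] at this
    exact this

lemma exists_approx_finite {T : Set (FinitePlace F)} (hT : T.Finite) (x a : FinitePlace F → F)
    (ha : ∀ w ∈ T, a w ≠ 0) : ∃ b : F, ∀ w ∈ T, w.val (b - x w) < w.val (a w) := by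
  obtain ⟨b, hb, -⟩ := exists_approx hT Set.finite_empty x a ha fun _ ↦ 0
  exact ⟨b, hb⟩

end Approximation

/-! ### Places above a given place -/

section Over

variable {k : Type*} {K : Type*} [Field k] [Field K] [Algebra k K] [FiniteDimensional k K]

namespace FinitePlace

lemma Over.algebraMap_mem_iff {v : FinitePlace k} (w : v.Over K) {a : k} :
    algebraMap k K a ∈ w.1.ring ↔ a ∈ v.ring := by
  obtain ⟨w, rfl⟩ := w
  exact Iff.rfl

lemma Over.comap_ring {v : FinitePlace k} (w : v.Over K) :
    w.1.ring.comap (algebraMap k K) = v.ring := congrArg FinitePlace.ring w.2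

lemma Over.val_le_val_iff {v : FinitePlace k} (w : v.Over K) {a b : k} :
    w.1.val (algebraMap k K a) ≤ w.1.val (algebraMap k K b) ↔ v.val a ≤ v.val b :=
  val_le_val_iff_of_comap w.comap_ring

lemma Over.val_lt_one_iff {v : FinitePlace k} (w : v.Over K) {a : k} :
    w.1.val (algebraMap k K a) < 1 ↔ v.val a < 1 :=
  val_lt_one_iff_of_comap w.comap_ring

lemma val_twist_lt_one_iff (w : FinitePlace K) (σ : K ≃ₐ[k] K) {a : K} :
    (w.twist σ).val a < 1 ↔ w.val (σ a) < 1 :=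
  (val_lt_one_iff_of_comap (f := (σ : K →+* K)) (v := w.twist σ) (w := w) rfl).symm

/-- The number of places above `v` is bounded by the degree. -/
lemma card_over_le {v : FinitePlace k} (s : Finset (v.Over K)) :
    s.card ≤ Module.finrank k K := by
  classical
  let T : Set (FinitePlace K) := Subtype.val '' (s : Set (v.Over K))
  have hT : T.Finite := s.finite_toSet.image _
  -- Elements close to 1 at one place and to 0 at the others are linearly independent over k: in a
  -- relation with c_i of largest value, the i-th term strictly dominates all others at the i-th
  -- place.
  have hex : ∀ w : s, ∃ b : K, ∀ w' : s,
      w'.1.1.val (b - if w' = w then 1 else 0) < 1 := by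
    intro w
    obtain ⟨b, hb⟩ := exists_approx_finite hT (fun w' ↦ if w' = w.1.1 then 1 else 0)
      (fun _ ↦ 1) (fun _ _ ↦ one_ne_zero)
    refine ⟨b, fun w' ↦ ?_⟩
    have := hb w'.1.1 ⟨w'.1, w'.2, rfl⟩
    rw [map_one] at this
    convert! this using 4
    exact ⟨fun h ↦ h ▸ rfl, fun h ↦ Subtype.ext (Subtype.ext h)⟩
  choose b hb using hex
  have hself : ∀ w : s, w.1.1.val (b w) = 1 := fun w ↦ by
    have := hb w w
    rw [if_pos rfl] at this
    exact w.1.1.val_eq_one_of_sub_one this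
  have hother : ∀ w w' : s, w' ≠ w → w'.1.1.val (b w) < 1 := fun w w' h ↦ by
    have := hb w w'
    rwa [if_neg h, sub_zero] at this
  have hli : LinearIndependent k b := by
    rw [Fintype.linearIndependent_iff]
    by_contra! hc
    obtain ⟨c, hc0, j, hj⟩ := hc
    have : Nonempty s := ⟨j⟩
    obtain ⟨i, hi⟩ := Finite.exists_max fun i ↦ v.val (c i)
    have hci : c i ≠ 0 := fun h ↦ by
      have := hi j
      rw [h, map_zero, le_zero_iff, map_eq_zero] at this
      exact hj this
    have hsum : c i • b i = -∑ l ∈ Finset.univ.erase i, c l • b l := by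
      rw [← Finset.add_sum_erase _ _ (Finset.mem_univ i)] at hc0
      exact eq_neg_of_add_eq_zero_left hc0
    have hlt : i.1.1.val (∑ l ∈ Finset.univ.erase i, c l • b l) <
        i.1.1.val (algebraMap k K (c i)) := by
      refine Valuation.map_sum_lt _ (by simpa using hci) fun l hl ↦ ?_
      rw [Algebra.smul_def, map_mul]
      refine lt_of_le_of_lt (mul_le_mul_left (i.1.val_le_val_iff.mpr (hi l)) _) ?_
      refine mul_lt_of_lt_one_right (zero_lt_iff.mpr (by simpa using hci)) ?_
      exact hother l i (Finset.ne_of_mem_erase hl).symm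
    rw [← Valuation.map_neg, ← hsum, Algebra.smul_def, map_mul, hself, mul_one] at hlt
    exact lt_irrefl _ hlt
  simpa using hli.fintype_card_le_finrank

/-- In contrast to `FinitePlace.finite_over`, the degree bound requires no separability, so it
applies to any finite extension of 𝔽_p(t). -/
lemma finite_over_of_finiteDimensional (v : FinitePlace k) : Finite (v.Over K) := by
  by_contra h
  rw [not_finite_iff_infinite] at h
  obtain ⟨s, hs⟩ := Infinite.exists_subset_card_eq (v.Over K) (Module.finrank k K + 1)
  have := card_over_le s
  lia

/-- The Galois group permutes the places above `v` transitively. -/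
theorem exists_twist_eq [IsGalois k K] {v : FinitePlace k} (w w' : v.Over K) :
    ∃ σ : K ≃ₐ[k] K, w.twist σ = w' := by
  classical
  by_contra! hc
  have hfin : Finite (v.Over K) := finite_over_of_finiteDimensional v
  let T : Set (FinitePlace K) := Set.range fun u : v.Over K ↦ u.1
  have hT : T.Finite := Set.finite_range _
  -- With b near 1 on the orbit of w and near 0 at the other places above v, the norm of b would be
  -- a unit at w and a non-unit at w', although both restrict to v.
  obtain ⟨b, hb⟩ := exists_approx_finite hT
    (fun u ↦ if ∃ σ : K ≃ₐ[k] K, (w.twist σ).1 = u then 1 else 0) (fun _ ↦ 1)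
    (fun _ _ ↦ one_ne_zero)
  have h1 : ∀ σ : K ≃ₐ[k] K, w.1.val (σ b) = 1 := by
    intro σ
    have h := hb _ ⟨w.twist σ, rfl⟩
    rw [if_pos ⟨σ, rfl⟩, map_one] at h
    refine w.1.val_eq_one_of_sub_one ?_
    rw [← map_one σ, ← map_sub]
    exact (val_twist_lt_one_iff w.1 σ).mp h
  have h2 : ∀ σ : K ≃ₐ[k] K, w'.1.val (σ b) < 1 := by
    intro σ
    have h := hb _ ⟨w'.twist σ, rfl⟩
    rw [if_neg, map_one, sub_zero] at h
    · exact (val_twist_lt_one_iff w'.1 σ).mp h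
    · rintro ⟨τ, hτ⟩
      refine hc (τ * σ⁻¹) (Subtype.ext (FinitePlace.ext (SetLike.ext fun x ↦ ?_)))
      have := congrArg (fun u : FinitePlace K ↦ σ⁻¹ x ∈ u.ring) hτ
      change τ (σ⁻¹ x) ∈ w.1.ring ↔ x ∈ w'.1.ring
      have hx : σ (σ⁻¹ x) = x := σ.apply_symm_apply x
      refine (iff_of_eq this).trans ?_
      change σ (σ⁻¹ x) ∈ w'.1.ring ↔ _
      rw [hx]
  have h3 := Algebra.norm_eq_prod_automorphisms k b
  have h4 : w.1.val (algebraMap k K (Algebra.norm k b)) = 1 := by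
    rw [h3, map_prod]
    exact Finset.prod_eq_one fun σ _ ↦ h1 σ
  have h5 : w'.1.val (algebraMap k K (Algebra.norm k b)) < 1 := by
    rw [h3, map_prod, ← Finset.mul_prod_erase _ _ (Finset.mem_univ 1)]
    refine mul_lt_one_of_lt_of_le (h2 1) (Finset.prod_le_one' fun σ _ ↦ (h2 σ).le)
  rw [w'.val_lt_one_iff, ← w.val_lt_one_iff, h4] at h5
  exact lt_irrefl _ h5

end FinitePlace

end Over

/-! ### Finiteness properties of the places of a global field -/

/-- Every nonzero element is a unit at almost all places, and all residue fields are finite. -/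
structure HasFinitePlaces (F : Type*) [Field F] : Prop where
  finite_val_ne_one : ∀ c : F, c ≠ 0 → {w : FinitePlace F | w.val c ≠ 1}.Finite
  finite_residueField : ∀ w : FinitePlace F, Finite (IsLocalRing.ResidueField w.ring)

/-! ### Passage of the finiteness properties to finite extensions -/

section Extension

variable {E F : Type*} [Field E] [Field F] [Algebra E F] [FiniteDimensional E F]

namespace FinitePlace

lemma val_algebraMap_eq_one_of_under {w : FinitePlace F} {a : E} (h : (w.under E).val a = 1) :
    w.val (algebraMap E F a) = 1 := by
  have h1 : ∀ b c : E, w.val (algebraMap E F b) ≤ w.val (algebraMap E F c) ↔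
      (w.under E).val b ≤ (w.under E).val c := fun b c ↦ val_le_val_iff_of_comap rfl
  have h2 := (h1 a 1).mpr (by rw [h, map_one])
  have h3 := (h1 1 a).mpr (by rw [h, map_one])
  rw [map_one, map_one] at h2 h3
  exact le_antisymm h2 h3

/-- A root of a monic polynomial with coefficients in the valuation ring and unit constant term is
a unit. -/
lemma val_eq_one_of_aeval_eq_zero (w : FinitePlace F) {p : Polynomial E} (hp : p.Monic)
    (hcoeff : ∀ i, w.val (algebraMap E F (p.coeff i)) ≤ 1)
    (h0 : w.val (algebraMap E F (p.coeff 0)) = 1) {c : F} (hc : Polynomial.aeval c p = 0) :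
    w.val c = 1 := by
  have hle : w.val c ≤ 1 := by
    by_contra! hlt
    rw [Polynomial.aeval_eq_sum_range, Finset.sum_range_succ, hp.coeff_natDegree, one_smul] at hc
    have h1 : w.val (∑ i ∈ Finset.range p.natDegree, p.coeff i • c ^ i) <
        w.val c ^ p.natDegree := by
      refine Valuation.map_sum_lt _ (pow_ne_zero _ (zero_lt_one.trans hlt).ne') fun i hi ↦ ?_
      rw [Algebra.smul_def, map_mul, map_pow]
      refine (mul_le_of_le_one_left' (hcoeff i)).trans_lt ?_
      exact pow_lt_pow_right₀ hlt (Finset.mem_range.mp hi)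
    rw [eq_neg_of_add_eq_zero_left hc, Valuation.map_neg, map_pow] at h1
    exact lt_irrefl _ h1
  refine le_antisymm hle ?_
  have h2 : Polynomial.aeval c p.divX * c + algebraMap E F (p.coeff 0) = 0 := by
    rw [← hc]
    conv_rhs => rw [← Polynomial.divX_mul_X_add p]
    simp
  have h3 : w.val (Polynomial.aeval c p.divX) ≤ 1 := by
    rw [Polynomial.aeval_eq_sum_range]
    refine Valuation.map_sum_le _ fun i _ ↦ ?_
    rw [Algebra.smul_def, map_mul, map_pow, Polynomial.coeff_divX]
    exact mul_le_one' (hcoeff _) (pow_le_one' hle i)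
  rw [← h0, eq_neg_of_add_eq_zero_right h2, Valuation.map_neg, map_mul]
  exact mul_le_of_le_one_left' h3

/-- Elements of the valuation ring with residues that are linearly independent over the residue
field below are linearly independent. -/
lemma linearIndependent_of_residue (w : FinitePlace F) {ι : Type*} [Fintype ι]
    (x : ι → w.ring)
    (h : ∀ c : ι → (w.under E).ring,
      IsLocalRing.residue w.ring (∑ i, ⟨algebraMap E F (c i), (c i).2⟩ * x i) = 0 →
        ∀ i, IsLocalRing.residue (w.under E).ring (c i) = 0) :
    LinearIndependent E fun i ↦ (x i : F) := by
  rw [Fintype.linearIndependent_iff]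
  by_contra! hc
  obtain ⟨c, hc0, j, hj⟩ := hc
  have : Nonempty ι := ⟨j⟩
  -- Dividing a relation by a coefficient of largest value makes all coefficients integral and one
  -- of them 1, so its reduction is a nontrivial relation between residues.
  obtain ⟨i, hi⟩ := Finite.exists_max fun i ↦ (w.under E).val (c i)
  have hci : c i ≠ 0 := fun h ↦ by
    have := hi j
    rw [h, map_zero, le_zero_iff, map_eq_zero] at this
    exact hj this
  have hmem : ∀ l, c l / c i ∈ (w.under E).ring := fun l ↦ by
    rw [← val_le_one_iff, map_div₀]
    exact div_le_one_of_le₀ (hi l) zero_le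
  have h1 := h (fun l ↦ ⟨c l / c i, hmem l⟩) (by
    rw [← map_zero (IsLocalRing.residue w.ring)]
    congr 1
    refine Subtype.ext ?_
    have : ∀ l, algebraMap E F (c l / c i) * (x l : F) =
        (algebraMap E F (c i))⁻¹ * (c l • (x l : F)) := fun l ↦ by
      rw [map_div₀, Algebra.smul_def]
      ring
    rw [AddSubmonoidClass.coe_finsetSum]
    refine (Finset.sum_congr rfl fun l _ ↦ this l).trans ?_
    rw [← Finset.mul_sum, hc0, mul_zero]
    rfl) i
  have h2 : (⟨c i / c i, hmem i⟩ : (w.under E).ring) = 1 := Subtype.ext (div_self hci)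
  rw [h2, map_one] at h1
  exact one_ne_zero h1

/-- Lifts of independent residues are independent over E, so the residue degree is at most the
degree of F over E. -/
lemma finite_residueField_of_under (w : FinitePlace F)
    [Finite (IsLocalRing.ResidueField (w.under E).ring)] :
    Finite (IsLocalRing.ResidueField w.ring) := by
  let φ : (w.under E).ring →+* w.ring := (algebraMap E F).restrict _ _ fun _ hx ↦ hx
  have hφ : IsLocalHom φ := by
    refine ⟨fun a ha ↦ ?_⟩
    have ha0 : (a : E) ≠ 0 := fun h ↦ ha.ne_zero (Subtype.ext
      (show algebraMap E F a = 0 by rw [h, map_zero]))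
    obtain ⟨u, hu⟩ := ha
    have hinv : (a : E)⁻¹ ∈ (w.under E).ring := by
      change algebraMap E F (a : E)⁻¹ ∈ w.ring
      have h1 : ((u : w.ring) : F) = algebraMap E F a := congrArg Subtype.val hu
      have h2 : ((u : w.ring) : F) * ((u⁻¹ : w.ringˣ) : w.ring) = 1 :=
        congrArg (Subtype.val : w.ring → F) (Units.mul_inv u)
      rw [map_inv₀, ← h1, ← eq_inv_of_mul_eq_one_right h2]
      exact Subtype.prop _
    exact IsUnit.of_mul_eq_one ⟨_, hinv⟩ (Subtype.ext (mul_inv_cancel₀ ha0))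
  let _ : Algebra (IsLocalRing.ResidueField (w.under E).ring) (IsLocalRing.ResidueField w.ring) :=
    (IsLocalRing.ResidueField.map φ).toAlgebra
  have hrank : Module.rank (IsLocalRing.ResidueField (w.under E).ring)
      (IsLocalRing.ResidueField w.ring) ≤ Module.finrank E F := by
    refine rank_le fun s hs ↦ ?_
    choose x hx using fun i : s ↦ IsLocalRing.residue_surjective (R := w.ring) i.1
    have := w.linearIndependent_of_residue (E := E) x fun c hc ↦ by
      refine Fintype.linearIndependent_iff.mp hs _ ?_
      rw [← hc, map_sum]
      refine Finset.sum_congr rfl fun i _ ↦ ?_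
      rw [Algebra.smul_def, map_mul, hx]
      rfl
    simpa using this.fintype_card_le_finrank
  have : Module.Finite (IsLocalRing.ResidueField (w.under E).ring)
      (IsLocalRing.ResidueField w.ring) :=
    Module.rank_lt_aleph0_iff.mp (hrank.trans_lt (Cardinal.natCast_lt_aleph0))
  exact Module.finite_of_finite (IsLocalRing.ResidueField (w.under E).ring)

end FinitePlace

/-- Outside the finitely many places above those where a nonzero coefficient of the minimal
polynomial of c is not a unit, c is a root of a monic integral polynomial with unit constant term.
-/
lemma HasFinitePlaces.of_finiteDimensional (h : HasFinitePlaces E) : HasFinitePlaces F where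
  finite_val_ne_one c hc := by
    let p := minpoly E c
    have hint : IsIntegral E c := Algebra.IsIntegral.isIntegral c
    let T : Set (FinitePlace E) := ⋃ i ∈ p.support, {v | v.val (p.coeff i) ≠ 1}
    have hT : T.Finite := Set.Finite.biUnion p.support.finite_toSet fun i hi ↦
      h.finite_val_ne_one _ (Polynomial.mem_support_iff.mp hi)
    have hT' : (⋃ v ∈ T, Set.range fun w : v.Over F ↦ w.1).Finite := hT.biUnion fun v _ ↦ by
      have : Finite (v.Over F) := v.finite_over_of_finiteDimensional
      exact Set.finite_range _
    refine hT'.subset fun w hw ↦ ?_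
    rw [Set.mem_iUnion₂]
    refine ⟨w.under E, ?_, ⟨w, rfl⟩, rfl⟩
    by_contra hwT
    have hunit : ∀ i ∈ p.support, w.val (algebraMap E F (p.coeff i)) = 1 := fun i hi ↦ by
      refine FinitePlace.val_algebraMap_eq_one_of_under ?_
      by_contra hne
      exact hwT (Set.mem_iUnion₂.mpr ⟨i, hi, hne⟩)
    refine hw (w.val_eq_one_of_aeval_eq_zero (minpoly.monic hint) (fun i ↦ ?_) ?_
      (minpoly.aeval E c))
    · by_cases hi : i ∈ p.support
      · exact (hunit i hi).le
      · rw [Polynomial.notMem_support_iff.mp hi]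
        simp
    · exact hunit 0 (Polynomial.mem_support_iff.mpr (minpoly.coeff_zero_ne_zero hint hc))
  finite_residueField w := by
    have := h.finite_residueField (w.under E)
    exact w.finite_residueField_of_under (E := E)

end Extension

/-! ### Places containing a Dedekind domain with finite quotients -/

section Base

variable {A E : Type*} [CommRing A] [IsDedekindDomain A] [Ring.HasFiniteQuotients A] [Field E]
  [Algebra A E] [IsFractionRing A E]

namespace FinitePlace

/-- The center on `A` of a place whose valuation ring contains `A`. -/
def center (v : FinitePlace E) (hv : ∀ a : A, algebraMap A E a ∈ v.ring) : Ideal A :=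
  (IsLocalRing.maximalIdeal v.ring).comap ((algebraMap A E).codRestrict v.ring.toSubring hv)

lemma mem_center {v : FinitePlace E} {hv : ∀ a : A, algebraMap A E a ∈ v.ring} {a : A} :
    a ∈ v.center hv ↔ v.val (algebraMap A E a) < 1 :=
  (HeightOneSpectrum.valuation_lt_one_iff_mem (K := E)
    (IsDiscreteValuationRing.maximalIdeal v.ring) ⟨algebraMap A E a, hv a⟩).symm

lemma val_eq_one_of_notMem_center {v : FinitePlace E} {hv : ∀ a : A, algebraMap A E a ∈ v.ring}
    {a : A} (ha : a ∉ v.center hv) : v.val (algebraMap A E a) = 1 :=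
  le_antisymm ((v.val_le_one_iff _).mpr (hv a)) (not_lt.mp fun h ↦ ha (mem_center.mpr h))

instance (v : FinitePlace E) (hv : ∀ a : A, algebraMap A E a ∈ v.ring) : (v.center hv).IsPrime :=
  Ideal.comap_isPrime _ _

lemma center_ne_bot (v : FinitePlace E) (hv : ∀ a : A, algebraMap A E a ∈ v.ring) :
    v.center hv ≠ ⊥ := by
  intro h
  have hunit : ∀ a : A, a ≠ 0 → v.val (algebraMap A E a) = 1 := fun a ha ↦
    val_eq_one_of_notMem_center (hv := hv) (by rwa [h, Ideal.mem_bot])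
  obtain ⟨π, hπ0, hπ⟩ := v.exists_val_lt_one
  obtain ⟨a, b, hb, rfl⟩ := IsFractionRing.div_surjective (A := A) π
  rw [map_div₀, hunit a (by rintro rfl; simp at hπ0), hunit b (nonZeroDivisors.ne_zero hb),
    div_one] at hπ
  exact lt_irrefl _ hπ

/-- Every element of the valuation ring is a fraction with denominator prime to the center. -/
lemma exists_eq_div_of_mem {v : FinitePlace E} (hv : ∀ a : A, algebraMap A E a ∈ v.ring) {x : E}
    (hx : x ∈ v.ring) : ∃ n d : A, d ∉ v.center hv ∧ x = algebraMap A E n / algebraMap A E d := by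
  have hne : ∀ d : A, d ∉ v.center hv → algebraMap A E d ≠ 0 := fun d hd h ↦ hd (by
    rw [mem_center, h, map_zero]
    exact zero_lt_one)
  obtain ⟨n, ⟨d, hd⟩, hnd | hnd⟩ := HeightOneSpectrum.exists_primeCompl_mul_eq_or_mul_eq
    (⟨v.center hv, inferInstance, v.center_ne_bot hv⟩ : HeightOneSpectrum A) x
  · exact ⟨n, d, hd, (eq_div_iff (hne d hd)).mpr hnd⟩
  · have hn : n ∉ v.center hv := fun hn ↦ by
      have h1 := congrArg v.val hnd
      rw [map_mul, val_eq_one_of_notMem_center (a := d) hd] at h1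
      have h2 : v.val x * v.val (algebraMap A E n) < 1 :=
        (mul_le_of_le_one_left' ((v.val_le_one_iff x).mpr hx)).trans_lt (mem_center.mp hn)
      exact h2.ne h1
    exact ⟨d, n, hn, (eq_div_iff (hne n hn)).mpr hnd⟩

lemma ring_le_of_center_eq {v v' : FinitePlace E} (hv : ∀ a : A, algebraMap A E a ∈ v.ring)
    (hv' : ∀ a : A, algebraMap A E a ∈ v'.ring) (h : v.center hv = v'.center hv') :
    v.ring ≤ v'.ring := by
  intro x hx
  obtain ⟨n, d, hd, rfl⟩ := exists_eq_div_of_mem hv hx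
  rw [h] at hd
  rw [← val_le_one_iff, map_div₀, val_eq_one_of_notMem_center hd, div_one, val_le_one_iff]
  exact hv' n

variable (A) in
-- A place is determined by its center, and a nonzero element of A lies in only finitely many ideals
-- since its quotient ring is finite. This is applied to the numerator and the denominator of c.
lemma finite_val_ne_one_of_algebraMap_mem {c : E} (hc : c ≠ 0) :
    {v : FinitePlace E | (∀ a : A, algebraMap A E a ∈ v.ring) ∧ v.val c ≠ 1}.Finite := by
  have key : ∀ a : A, a ≠ 0 →
      {v : FinitePlace E | (∀ a : A, algebraMap A E a ∈ v.ring) ∧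
        v.val (algebraMap A E a) < 1}.Finite := by
    intro a ha
    have hfin : Finite (A ⧸ Ideal.span {a}) :=
      Ring.HasFiniteQuotients.finiteQuotient (by simpa using ha)
    have hfin' : Finite {I : Ideal A | Ideal.span {a} ≤ I} :=
      Finite.of_injective (fun I ↦ I.1.map (Ideal.Quotient.mk (Ideal.span {a}))) fun I J h ↦ by
        have h' := congrArg (Ideal.comap (Ideal.Quotient.mk (Ideal.span {a}))) h
        simp only [Ideal.comap_map_mk I.2, Ideal.comap_map_mk J.2] at h'
        exact Subtype.ext h'
    rw [← Set.finite_coe_iff]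
    refine Finite.of_injective (fun v ↦ (⟨v.1.center v.2.1, ?_⟩ :
      {I : Ideal A | Ideal.span {a} ≤ I})) fun v v' h ↦ ?_
    · rw [Set.mem_ofPred_eq, Ideal.span_singleton_le_iff_mem, mem_center]
      exact v.2.2
    · have h' : v.1.center v.2.1 = v'.1.center v'.2.1 := congrArg Subtype.val h
      exact Subtype.ext (FinitePlace.ext (le_antisymm (ring_le_of_center_eq _ _ h')
        (ring_le_of_center_eq _ _ h'.symm)))
  obtain ⟨a, b, hb, rfl⟩ := IsFractionRing.div_surjective (A := A) c
  have ha : a ≠ 0 := by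
    rintro rfl
    simp at hc
  refine ((key a ha).union (key b (nonZeroDivisors.ne_zero hb))).subset ?_
  rintro v ⟨hv, hv1⟩
  by_contra hcon
  rw [Set.mem_union, not_or] at hcon
  refine hv1 ?_
  rw [map_div₀, val_eq_one_of_notMem_center (hv := hv) fun h ↦ hcon.1 ⟨hv, mem_center.mp h⟩,
    val_eq_one_of_notMem_center (hv := hv) fun h ↦ hcon.2 ⟨hv, mem_center.mp h⟩, div_one]

lemma finite_residueField_of_algebraMap_mem (v : FinitePlace E)
    (hv : ∀ a : A, algebraMap A E a ∈ v.ring) : Finite (IsLocalRing.ResidueField v.ring) := by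
  have hfin : Finite (A ⧸ v.center hv) :=
    Ring.HasFiniteQuotients.finiteQuotient (v.center_ne_bot hv)
  let ψ : A →+* IsLocalRing.ResidueField v.ring := (IsLocalRing.residue v.ring).comp
    ((algebraMap A E).codRestrict v.ring.toSubring hv)
  have hψ : ∀ a ∈ v.center hv, ψ a = 0 := fun a ha ↦ (IsLocalRing.residue_eq_zero_iff _).mpr ha
  let χ : A ⧸ v.center hv →+* IsLocalRing.ResidueField v.ring := Ideal.Quotient.lift _ ψ hψ
  refine Finite.of_surjective (fun p : (A ⧸ v.center hv) × (A ⧸ v.center hv) ↦ χ p.1 / χ p.2)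
    fun y ↦ ?_
  obtain ⟨x, rfl⟩ := IsLocalRing.residue_surjective y
  obtain ⟨n, d, hd, hx⟩ := exists_eq_div_of_mem hv x.2
  refine ⟨(Ideal.Quotient.mk _ n, Ideal.Quotient.mk _ d), ?_⟩
  have hd0 : ψ d ≠ 0 := fun h ↦ hd ((IsLocalRing.residue_eq_zero_iff _).mp h)
  change ψ n / ψ d = _
  rw [div_eq_iff hd0]
  change IsLocalRing.residue v.ring _ = IsLocalRing.residue v.ring _ * IsLocalRing.residue v.ring _
  rw [← map_mul]
  congr 1
  refine Subtype.ext ?_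
  change algebraMap A E n = x * algebraMap A E d
  rw [hx, div_mul_cancel₀]
  intro h
  refine hd ?_
  rw [mem_center, h, map_zero]
  exact zero_lt_one

end FinitePlace

end Base

section RingHom

variable {A E : Type*} [CommRing A] [IsDedekindDomain A] [Ring.HasFiniteQuotients A] [Field E]

/-- An explicit homomorphism takes the place of the algebra structure because F(X) is used as
fraction field of F[X] in two ways, with X ↦ X and X ↦ X⁻¹. -/
lemma FinitePlace.finite_val_ne_one_of_ringHom_mem (φ : A →+* E) (hinj : Function.Injective φ)
    (hsurj : ∀ x, ∃ a b, x = φ a / φ b) {c : E} (hc : c ≠ 0) :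
    {v : FinitePlace E | (∀ a, φ a ∈ v.ring) ∧ v.val c ≠ 1}.Finite := by
  let _ : Algebra A E := φ.toAlgebra
  have : FaithfulSMul A E := (faithfulSMul_iff_algebraMap_injective _ _).mpr hinj
  have : IsFractionRing A E := IsFractionRing.of_field _ _ hsurj
  exact FinitePlace.finite_val_ne_one_of_algebraMap_mem A hc

lemma FinitePlace.finite_residueField_of_ringHom_mem (φ : A →+* E) (hinj : Function.Injective φ)
    (hsurj : ∀ x, ∃ a b, x = φ a / φ b) (v : FinitePlace E) (hv : ∀ a, φ a ∈ v.ring) : Finite (IsLocalRing.ResidueField v.ring) := by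
  let _ : Algebra A E := φ.toAlgebra
  have : FaithfulSMul A E := (faithfulSMul_iff_algebraMap_injective _ _).mpr hinj
  have : IsFractionRing A E := IsFractionRing.of_field _ _ hsurj
  exact v.finite_residueField_of_algebraMap_mem hv

end RingHom

lemma hasFinitePlaces_rat : HasFinitePlaces ℚ where
  finite_val_ne_one c hc := by
    refine (FinitePlace.finite_val_ne_one_of_algebraMap_mem ℤ hc).subset fun v hv ↦ ⟨?_, hv⟩
    exact fun a ↦ by simp
  finite_residueField v := v.finite_residueField_of_algebraMap_mem (A := ℤ) fun a ↦ by simp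

instance (F : Type*) [Field F] [Finite F] : Ring.HasFiniteQuotients (Polynomial F) where
  finiteQuotient {I} hI := by
    obtain ⟨f, hf⟩ := IsPrincipalIdealRing.principal I
    rw [Ideal.submodule_span_eq] at hf
    have hf0 : f ≠ 0 := fun h ↦ hI (by rw [hf, h]; simp)
    subst hf
    have : Module.Finite F (AdjoinRoot f) := (AdjoinRoot.powerBasis hf0).finite
    exact Module.finite_of_finite F (M := AdjoinRoot f)

/-! ### The rational function field -/

section RatFunc

open Polynomial

variable (F : Type*) [Field F] [Finite F]

/-- The embedding `F[X] → F(X)` with `X ↦ X⁻¹`. -/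
def polyInv : F[X] →+* RatFunc F := eval₂RingHom (algebraMap F (RatFunc F)) (RatFunc.X)⁻¹

/-- Reversing the coefficients exchanges X and X⁻¹ up to a power of X, which reduces the claim to
the standard embedding. -/
lemma polyInv_injective : Function.Injective (polyInv F) := by
  rw [injective_iff_map_eq_zero]
  intro f hf
  have hX : (RatFunc.X : RatFunc F) ≠ 0 := RatFunc.X_ne_zero
  let _ : Invertible (RatFunc.X : RatFunc F)⁻¹ := invertibleOfNonzero (inv_ne_zero hX)
  have h1 : eval₂ (algebraMap F (RatFunc F)) (⅟(RatFunc.X : RatFunc F)⁻¹) f.reverse = 0 :=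
    (eval₂_reverse_eq_zero_iff _ _ f).mpr hf
  rw [invOf_eq_inv, inv_inv, ← aeval_def, RatFunc.aeval_X_left_eq_algebraMap,
    FaithfulSMul.algebraMap_eq_zero_iff, reverse_eq_zero] at h1
  exact h1

lemma polyInv_div_surjective (x : RatFunc F) : ∃ a b, x = polyInv F a / polyInv F b := by
  have hX : (RatFunc.X : RatFunc F) ≠ 0 := RatFunc.X_ne_zero
  have key : ∀ f : F[X], algebraMap F[X] (RatFunc F) f =
      polyInv F f.reverse * RatFunc.X ^ f.natDegree := by
    intro f
    let _ : Invertible (RatFunc.X : RatFunc F) := invertibleOfNonzero hX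
    have := eval₂_reverse_mul_pow (algebraMap F (RatFunc F)) RatFunc.X f
    rw [invOf_eq_inv, ← aeval_def RatFunc.X, RatFunc.aeval_X_left_eq_algebraMap] at this
    exact this.symm
  obtain ⟨f, g, hg, rfl⟩ := IsFractionRing.div_surjective (A := F[X]) x
  have hXi : polyInv F X = (RatFunc.X)⁻¹ := by simp [polyInv]
  refine ⟨f.reverse * X ^ g.natDegree, g.reverse * X ^ f.natDegree, ?_⟩
  rw [key, key, map_mul, map_mul, map_pow, map_pow, hXi]
  have hg0 : polyInv F g.reverse ≠ 0 := by
    rw [Ne, map_eq_zero_iff _ (polyInv_injective F), reverse_eq_zero]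
    exact nonZeroDivisors.ne_zero hg
  rw [inv_pow, inv_pow]
  field_simp

/-- Nonzero constants are roots of unity, so their value cannot exceed 1. -/
lemma algebraMap_mem_ring (v : FinitePlace (RatFunc F)) (c : F) :
    algebraMap F (RatFunc F) c ∈ v.ring := by
  have := Fintype.ofFinite F
  rcases eq_or_ne c 0 with rfl | hc
  · rw [map_zero]
    exact zero_mem _
  rw [← FinitePlace.val_le_one_iff]
  by_contra! h
  have h1 := FiniteField.pow_card_sub_one_eq_one c hc
  have h2 := congrArg (fun c ↦ v.val (algebraMap F (RatFunc F) c)) h1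
  simp only [map_pow, map_one] at h2
  exact (one_lt_pow₀ h (Nat.sub_pos_of_lt Fintype.one_lt_card).ne').ne' h2

/-- A place of `F(X)` is finite over one of `F[X]` and `F[X⁻¹]`. -/
lemma mem_ring_or_polyInv_mem_ring (v : FinitePlace (RatFunc F)) :
    (∀ f : F[X], algebraMap F[X] (RatFunc F) f ∈ v.ring) ∨ ∀ f : F[X], polyInv F f ∈ v.ring := by
  have key : ∀ y ∈ v.ring, ∀ f : F[X], eval₂ (algebraMap F (RatFunc F)) y f ∈ v.ring := by
    intro y hy f
    rw [eval₂_eq_sum]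
    exact sum_mem fun i _ ↦ mul_mem (algebraMap_mem_ring F v _) (pow_mem hy i)
  rcases v.ring.mem_or_inv_mem RatFunc.X with h | h
  · left
    intro f
    rw [← RatFunc.aeval_X_left_eq_algebraMap]
    exact key _ h f
  · exact Or.inr (key _ h)

lemma hasFinitePlaces_ratFunc : HasFinitePlaces (RatFunc F) := by
  have hinj := polyInv_injective F
  refine ⟨fun c hc ↦ ?_, fun v ↦ ?_⟩
  · refine ((FinitePlace.finite_val_ne_one_of_algebraMap_mem F[X] hc).union
      (FinitePlace.finite_val_ne_one_of_ringHom_mem _ hinj (polyInv_div_surjective F) hc)).subset ?_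
    intro v hv
    exact (mem_ring_or_polyInv_mem_ring F v).imp (fun h ↦ ⟨h, hv⟩) (fun h ↦ ⟨h, hv⟩)
  · exact (mem_ring_or_polyInv_mem_ring F v).elim v.finite_residueField_of_algebraMap_mem
      (v.finite_residueField_of_ringHom_mem _ hinj (polyInv_div_surjective F))

end RatFunc

theorem IsGlobalField.hasFinitePlaces {F : Type*} [Field F] (h : IsGlobalField F) :
    HasFinitePlaces F := by
  obtain h | ⟨p, _, _, _⟩ := h
  · exact hasFinitePlaces_rat.of_finiteDimensional
  · exact (hasFinitePlaces_ratFunc (ZMod p)).of_finiteDimensional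

/-! ### Completions -/

namespace FinitePlace

variable {F : Type*} [Field F]

lemma valued_algebraMap (w : FinitePlace F) (x : F) :
    Valued.v (algebraMap F w.Completion x) = w.val x :=
  HeightOneSpectrum.valuedAdicCompletion_eq_valuation' _ x

lemma mem_integers_iff (w : FinitePlace F) {x : w.Completion} : x ∈ w.Integers ↔ Valued.v x ≤ 1 :=
  Iff.rfl

lemma algebraMap_mem_integers_iff (w : FinitePlace F) {x : F} :
    algebraMap F w.Completion x ∈ w.Integers ↔ x ∈ w.ring := by
  rw [mem_integers_iff, valued_algebraMap, val_le_one_iff]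

/-- `F` is dense in its completion. -/
lemma exists_valued_sub_le (w : FinitePlace F) (x : w.Completion) {a : w.Completion} (ha : a ≠ 0) :
    ∃ b : F, Valued.v (algebraMap F w.Completion b - x) ≤ Valued.v a := by
  have hopen : IsOpen {y : w.Completion | Valued.v (y - x) ≤ Valued.v a} := by
    have : {y : w.Completion | Valued.v (y - x) ≤ Valued.v a} =
        (fun y ↦ a⁻¹ * (y - x)) ⁻¹' (w.Integers : Set w.Completion) := by
      ext y
      rw [Set.mem_preimage, SetLike.mem_coe, mem_integers_iff, map_mul, map_inv₀,
        inv_mul_le_one₀ (zero_lt_iff.mpr (by simpa using ha))]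
      rfl
    rw [this]
    exact (Valued.isOpen_integer _).preimage (by fun_prop)
  obtain ⟨b, hb⟩ := (HeightOneSpectrum.denseRange_algebraMap F
    (IsDiscreteValuationRing.maximalIdeal w.ring)).exists_mem_open hopen
    ⟨x, by simp⟩
  exact ⟨b, hb⟩

lemma mem_maximalIdeal_integers_iff (w : FinitePlace F) {x : w.Integers} :
    x ∈ IsLocalRing.maximalIdeal w.Integers ↔ Valued.v (x : w.Completion) < 1 := by
  rw [IsLocalRing.mem_maximalIdeal, mem_nonunits_iff,
    HeightOneSpectrum.adicCompletionIntegers.isUnit_iff_valued_eq_one]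
  exact ⟨fun h ↦ lt_of_le_of_ne x.2 h, fun h ↦ h.ne⟩

/-- By density each integer of the completion is congruent to an element of the valuation ring
modulo the maximal ideal, so the residue field does not grow. -/
lemma finite_residueField_integers (w : FinitePlace F)
    [Finite (IsLocalRing.ResidueField w.ring)] :
    Finite (IsLocalRing.ResidueField w.Integers) := by
  let θ : w.ring →+* IsLocalRing.ResidueField w.Integers :=
    (IsLocalRing.residue w.Integers).comp (algebraMap w.ring w.Integers)
  have hθ : ∀ a ∈ IsLocalRing.maximalIdeal w.ring, θ a = 0 := fun a ha ↦ by
    refine (IsLocalRing.residue_eq_zero_iff _).mpr ((w.mem_maximalIdeal_integers_iff).mpr ?_)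
    rw [HeightOneSpectrum.algebraMap_adicCompletionIntegers_apply,
      HeightOneSpectrum.valuedAdicCompletion_eq_valuation']
    exact (HeightOneSpectrum.valuation_lt_one_iff_mem _ _).mpr ha
  refine Finite.of_surjective (α := IsLocalRing.ResidueField w.ring)
    (Ideal.Quotient.lift (IsLocalRing.maximalIdeal w.ring) θ hθ) fun y ↦ ?_
  obtain ⟨x, rfl⟩ := IsLocalRing.residue_surjective y
  obtain ⟨π, hπ0, hπ⟩ := w.exists_val_lt_one
  obtain ⟨b, hb⟩ := w.exists_valued_sub_le (x : w.Completion)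
    (a := algebraMap F w.Completion π) (by simpa using hπ0)
  rw [valued_algebraMap] at hb
  have hb' : b ∈ w.ring := by
    rw [← algebraMap_mem_integers_iff, ← sub_add_cancel (algebraMap F w.Completion b) x]
    exact add_mem ((mem_integers_iff _).mpr (hb.trans hπ.le)) x.2
  refine ⟨Ideal.Quotient.mk _ ⟨b, hb'⟩, ?_⟩
  rw [Ideal.Quotient.lift_mk]
  refine Ideal.Quotient.eq.mpr ?_
  rw [w.mem_maximalIdeal_integers_iff]
  exact hb.trans_lt hπ

/-- The ring of integers of a completion with finite residue field is compact. -/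
lemma isCompact_integers (w : FinitePlace F) [Finite (IsLocalRing.ResidueField w.ring)] :
    IsCompact (w.Integers : Set w.Completion) := by
  let _ : (Valued.v : Valuation w.Completion ℤᵐ⁰).RankOne :=
    Valuation.IsRankOneDiscrete.rankOne _ (e := 2) one_lt_two
  have h1 : CompleteSpace (Valued.integer w.Completion) :=
    (Valued.isClosed_integer w.Completion).completeSpace_coe
  have h2 : IsDiscreteValuationRing (Valued.integer w.Completion) :=
    inferInstanceAs (IsDiscreteValuationRing w.Integers)
  have h3 : Finite (IsLocalRing.ResidueField (Valued.integer w.Completion)) :=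
    w.finite_residueField_integers
  exact isCompact_iff_compactSpace.mpr (Valued.integer.compactSpace_iff_completeSpace_and_isDiscreteValuationRing_and_finite_residueField.mpr
    ⟨h1, h2, h3⟩)

end FinitePlace

namespace FinitePlace

variable {F F' : Type*} [Field F] [Field F']

lemma completionMap_congr {f g : F →+* F'} (hfg : f = g) {v : FinitePlace F} {w : FinitePlace F'}
    (hf : w.ring.comap f = v.ring) (hg : w.ring.comap g = v.ring) (x : v.Completion) :
    completionMap f hf x = completionMap g hg x := by
  subst hfg
  rfl

lemma completionMap_mem_integers_iff (f : F →+* F') {v : FinitePlace F} {w : FinitePlace F'}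
    (h : w.ring.comap f = v.ring) {x : v.Completion} :
    completionMap f h x ∈ w.Integers ↔ x ∈ v.Integers := by
  refine ⟨fun hx ↦ ?_, completionMap_mem_integers f h⟩
  by_contra hx'
  rw [mem_integers_iff, not_le] at hx'
  obtain ⟨π, hπ⟩ := HeightOneSpectrum.valuation_exists_uniformizer F
    (IsDiscreteValuationRing.maximalIdeal v.ring)
  have hπ0 : π ≠ 0 := by
    rintro rfl
    rw [map_zero] at hπ
    exact WithZero.coe_ne_zero hπ.symm
  have hπ1 : w.val (f π) < 1 := by
    rw [val_lt_one_iff_of_comap h, val, hπ]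
    decide
  have hx0 : x ≠ 0 := by
    rintro rfl
    rw [map_zero] at hx'
    exact not_lt_zero hx'
  -- The value group is ℤ and π is a uniformizer, so a non-integral x leaves πx of value at least 1.
  -- If the image of x were integral, multiplying by the image of (πx)⁻¹ would make f(π)⁻¹ integral.
  have h1 : (algebraMap F v.Completion π * x)⁻¹ ∈ v.Integers := by
    rw [mem_integers_iff, map_inv₀, map_mul, valued_algebraMap]
    refine inv_le_one_of_one_le₀ ?_
    rw [val, hπ]
    have h0 : Valued.v x ≠ 0 := (zero_lt_one.trans hx').ne'
    rw [WithZero.exp_neg, one_le_inv_mul₀ (WithZero.exp_pos)]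
    rw [← WithZero.lt_mul_exp_iff_le h0]
    calc WithZero.exp (1 : ℤ) = 1 * WithZero.exp 1 := (one_mul _).symm
      _ < _ := mul_lt_mul_of_pos_right hx' WithZero.exp_pos
  have h2 := mul_mem (completionMap_mem_integers f h h1) hx
  rw [← map_mul, mul_inv, mul_assoc, inv_mul_cancel₀ hx0, mul_one, map_inv₀,
    completionMap_algebraMap, mem_integers_iff, map_inv₀, valued_algebraMap] at h2
  have h3 : w.val (f π) ≠ 0 := by simpa using hπ0
  exact (one_lt_inv₀ (zero_lt_iff.mpr h3)).mpr hπ1 |>.not_ge h2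

end FinitePlace

/-! ### The algebra `∏_{w ∣ v} K_w` -/

section LocalAlg

variable {k : Type*} [Field k]

/-- The ring `∏_{w ∣ v} K_w`. -/
def LocalAlg (v : FinitePlace k) (K : Type*) [Field K] [Algebra k K] [FiniteDimensional k K] :
    Type _ :=
  (w : v.Over K) → w.1.Completion

variable {v : FinitePlace k} {K : Type*} [Field K] [Algebra k K] [FiniteDimensional k K]

namespace LocalAlg

instance : CommRing (LocalAlg v K) :=
  inferInstanceAs (CommRing ((w : v.Over K) → w.1.Completion))

instance : TopologicalSpace (LocalAlg v K) :=
  inferInstanceAs (TopologicalSpace ((w : v.Over K) → w.1.Completion))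

instance : IsTopologicalRing (LocalAlg v K) :=
  inferInstanceAs (IsTopologicalRing ((w : v.Over K) → w.1.Completion))

instance : T2Space (LocalAlg v K) :=
  inferInstanceAs (T2Space ((w : v.Over K) → w.1.Completion))

/-- The projection to a factor. -/
def proj (w : v.Over K) : LocalAlg v K →+* w.1.Completion :=
  Pi.evalRingHom (fun w : v.Over K ↦ w.1.Completion) w

lemma continuous_proj (w : v.Over K) : Continuous (proj w) := continuous_apply w

@[ext]
lemma ext {x y : LocalAlg v K} (h : ∀ w, proj w x = proj w y) : x = y := funext h

instance : MulSemiringAction (K ≃ₐ[k] K) (LocalAlg v K) where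
  smul σ x := fun w ↦
    FinitePlace.completionMap (v := (w.twist σ).1) (w := w.1) (σ : K →+* K) rfl (x (w.twist σ))
  one_smul x := by
    funext w
    exact FinitePlace.completionMap_id rfl _
  mul_smul σ τ x := by
    funext w
    exact FinitePlace.completionMap_comp (u := ((w.twist σ).twist τ).1)
      (v := (w.twist σ).1) (w := w.1) (τ : K →+* K) (σ : K →+* K) rfl rfl rfl _
  smul_zero σ := by
    funext w
    exact map_zero _
  smul_add σ x y := by
    funext w
    exact map_add _ _ _
  smul_one σ := by
    funext w
    exact map_one _
  smul_mul σ x y := by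
    funext w
    exact map_mul _ _ _

lemma proj_smul (σ : K ≃ₐ[k] K) (x : LocalAlg v K) (w : v.Over K) :
    proj w (σ • x) = FinitePlace.completionMap (v := (w.twist σ).1) (w := w.1) (σ : K →+* K) rfl
      (proj (w.twist σ) x) := rfl

instance : ContinuousConstSMul (K ≃ₐ[k] K) (LocalAlg v K) where
  continuous_const_smul σ := continuous_pi fun w ↦
    (FinitePlace.continuous_completionMap (v := (w.twist σ).1) (w := w.1) (σ : K →+* K) rfl).comp
      (continuous_apply (w.twist σ))

variable (v K) in
/-- The diagonal embedding of `K`. -/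
def diag : K →+* LocalAlg v K :=
  RingHom.pi fun w : v.Over K ↦ algebraMap K w.1.Completion

lemma proj_diag (w : v.Over K) (x : K) : proj w (diag v K x) = algebraMap K w.1.Completion x := rfl

lemma smul_diag (σ : K ≃ₐ[k] K) (x : K) : σ • diag v K x = diag v K (σ x) := by
  refine LocalAlg.ext fun w ↦ ?_
  exact FinitePlace.completionMap_algebraMap (v := (w.twist σ).1) (w := w.1) (σ : K →+* K) rfl x

variable (v K) in
/-- The diagonal embedding of `k_v`. -/
def ofBase : v.Completion →+* LocalAlg v K :=
  RingHom.pi fun w : v.Over K ↦ FinitePlace.completionMap (algebraMap k K) w.comap_ring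

lemma proj_ofBase (w : v.Over K) (x : v.Completion) :
    proj w (ofBase v K x) = FinitePlace.completionMap (algebraMap k K) w.comap_ring x := rfl

lemma continuous_ofBase : Continuous (ofBase v K) :=
  continuous_pi fun w ↦ FinitePlace.continuous_completionMap (algebraMap k K) w.comap_ring

lemma ofBase_algebraMap (x : k) :
    ofBase v K (algebraMap k v.Completion x) = diag v K (algebraMap k K x) := by
  refine LocalAlg.ext fun w ↦ ?_
  exact FinitePlace.completionMap_algebraMap (algebraMap k K) w.comap_ring x

lemma smul_ofBase (σ : K ≃ₐ[k] K) (x : v.Completion) : σ • ofBase v K x = ofBase v K x := by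
  refine LocalAlg.ext fun w ↦ ?_
  rw [proj_smul, proj_ofBase, proj_ofBase,
    ← FinitePlace.completionMap_comp (u := v) (v := (w.twist σ).1) (w := w.1) (algebraMap k K)
      (σ : K →+* K) (w.twist σ).comap_ring rfl]
  · exact FinitePlace.completionMap_congr (RingHom.ext fun x ↦ σ.commutes x) _ _ _
  · refine SetLike.ext fun x ↦ ?_
    change σ (algebraMap k K x) ∈ w.1.ring ↔ _
    rw [σ.commutes, w.algebraMap_mem_iff]

variable (v K) in
/-- The ring `∏_{w ∣ v} 𝒪_w`. -/
def integers : Subring (LocalAlg v K) where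
  carrier := {x | ∀ w, proj w x ∈ w.1.Integers}
  mul_mem' ha hb w := mul_mem (ha w) (hb w)
  one_mem' w := one_mem w.1.Integers
  add_mem' ha hb w := add_mem (ha w) (hb w)
  zero_mem' w := zero_mem w.1.Integers
  neg_mem' ha w := neg_mem (ha w)

lemma smul_mem_integers (σ : K ≃ₐ[k] K) {x : LocalAlg v K} (hx : x ∈ integers v K) :
    σ • x ∈ integers v K := fun w ↦
  FinitePlace.completionMap_mem_integers (v := (w.twist σ).1) (w := w.1) (σ : K →+* K) rfl
    (hx (w.twist σ))

lemma isOpen_integers : IsOpen (integers v K : Set (LocalAlg v K)) := by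
  have : Finite (v.Over K) := v.finite_over_of_finiteDimensional
  have h : (integers v K : Set (LocalAlg v K)) =
      Set.univ.pi fun w : v.Over K ↦ (w.1.Integers : Set w.1.Completion) := by
    ext x
    exact ⟨fun h w _ ↦ h w, fun h w ↦ h w trivial⟩
  rw [h]
  exact isOpen_set_pi Set.finite_univ fun w _ ↦ Valued.isOpen_integer _

lemma isCompact_integers (h : HasFinitePlaces K) :
    IsCompact (integers v K : Set (LocalAlg v K)) := by
  have h' : (integers v K : Set (LocalAlg v K)) =
      Set.univ.pi fun w : v.Over K ↦ (w.1.Integers : Set w.1.Completion) := by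
    ext x
    exact ⟨fun h w _ ↦ h w, fun h w ↦ h w trivial⟩
  rw [h']
  refine isCompact_univ_pi fun w ↦ ?_
  have := h.finite_residueField w.1
  exact w.1.isCompact_integers

lemma exists_pow_mul_diag_mem {π : k} (hπ : v.val π < 1) (x : K) :
    ∃ n : ℕ, diag v K (algebraMap k K π ^ n * x) ∈ integers v K := by
  have : Finite (v.Over K) := v.finite_over_of_finiteDimensional
  have := Fintype.ofFinite (v.Over K)
  have hex : ∀ w : v.Over K, ∃ n : ℕ, w.1.val (algebraMap k K π ^ n * x) ≤ 1 := by
    intro w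
    rcases eq_or_ne x 0 with rfl | hx
    · exact ⟨0, by simp⟩
    have hx' : (w.1.val x)⁻¹ ≠ 0 := by simpa using hx
    obtain ⟨n, hn⟩ := exists_pow_lt₀ (w.val_lt_one_iff.mpr hπ) (Units.mk0 _ hx')
    refine ⟨n, ?_⟩
    rw [map_mul, map_pow]
    exact (mul_le_mul_left hn.le _).trans (by
      rw [Units.val_mk0, inv_mul_cancel₀ (by simpa using hx)])
  choose n hn using hex
  refine ⟨Finset.univ.sup n, fun w ↦ ?_⟩
  rw [proj_diag, FinitePlace.mem_integers_iff, FinitePlace.valued_algebraMap]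
  obtain ⟨d, hd⟩ := Nat.exists_eq_add_of_le (Finset.le_sup (f := n) (Finset.mem_univ w))
  rw [hd, add_comm, pow_add, mul_assoc, map_mul, map_pow]
  exact mul_le_one' (pow_le_one' (w.val_lt_one_iff.mpr hπ).le _) (hn w)

end LocalAlg

end LocalAlg

/-! ### Normal bases and their dual bases -/

/-- The trace form is G-invariant, so the basis dual to the conjugates of α consists of the
conjugates of one β. Orthogonality says QP = 1 for the square matrices of conjugates; the
completeness relations are the entries of PQ = 1. -/
lemma exists_dual_normal_basis (k K : Type*) [Field k] [Field K] [Algebra k K]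
    [FiniteDimensional k K] [IsGalois k K] :
    ∃ α β : K, (∀ σ τ : K ≃ₐ[k] K, σ ≠ τ → ∑ ρ : K ≃ₐ[k] K, ρ (σ α * τ β) = 0) ∧
      (∑ σ : K ≃ₐ[k] K, σ α * σ β = 1) ∧
      ∀ τ : K ≃ₐ[k] K, τ ≠ 1 → ∑ σ : K ≃ₐ[k] K, σ α * (τ * σ) β = 0 := by
  classical
  let b := IsGalois.normalBasis k K
  let d := (Algebra.traceForm k K).dualBasis (traceForm_nondegenerate k K) b
  have htr : ∀ σ τ : K ≃ₐ[k] K, ∑ ρ : K ≃ₐ[k] K, ρ (σ (b 1) * τ (d 1)) =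
      if σ = τ then 1 else 0 := by
    intro σ τ
    have h1 := LinearMap.BilinForm.apply_dualBasis_left (B := Algebra.traceForm k K)
      (traceForm_nondegenerate k K) b 1 (τ⁻¹ * σ)
    have h2 : b (τ⁻¹ * σ) = (τ⁻¹ * σ) (b 1) := IsGalois.normalBasis_apply _
    rw [Algebra.traceForm_apply, h2] at h1
    have h3 := congrArg (algebraMap k K) h1
    rw [trace_eq_sum_automorphisms] at h3
    rw [← Equiv.sum_comp (Equiv.mulRight τ)] at h3
    rw [show (if σ = τ then (1 : K) else 0) =
      algebraMap k K (if τ⁻¹ * σ = 1 then 1 else 0) by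
        simp [inv_mul_eq_one, eq_comm (a := τ), apply_ite (algebraMap k K)], ← h3]
    refine Finset.sum_congr rfl fun ρ _ ↦ ?_
    simp [mul_comm, AlgEquiv.mul_apply]
    exact Or.inl rfl
  have hPQ : (Matrix.of fun τ σ : K ≃ₐ[k] K ↦ (τ * σ) (b 1)) *
      (Matrix.of fun σ τ : K ≃ₐ[k] K ↦ (τ * σ) (d 1)) = 1 := by
    rw [mul_eq_one_comm]
    ext σ σ'
    rw [Matrix.mul_apply, Matrix.one_apply, eq_comm, eq_comm (a := σ), ← htr σ' σ]
    refine Finset.sum_congr rfl fun τ _ ↦ ?_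
    simp [mul_comm]
  have hsum : ∀ τ : K ≃ₐ[k] K, ∑ σ : K ≃ₐ[k] K, σ (b 1) * (τ * σ) (d 1) =
      if 1 = τ then 1 else 0 := by
    intro τ
    have := congrFun (congrFun hPQ 1) τ
    rw [Matrix.mul_apply, Matrix.one_apply] at this
    simpa using this
  refine ⟨b 1, d 1, fun σ τ h ↦ ?_, ?_, fun τ h ↦ ?_⟩
  · rw [htr, if_neg h]
  · simpa using hsum 1
  · rw [hsum, if_neg h.symm]

namespace FinitePlace

variable {F F' : Type*} [Field F] [Field F']

lemma valued_completionMap_le_iff (f : F →+* F') {v : FinitePlace F} {w : FinitePlace F'}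
    (h : w.ring.comap f = v.ring) {x : v.Completion} {a : F} (ha : a ≠ 0) :
    Valued.v (completionMap f h x) ≤ w.val (f a) ↔ Valued.v x ≤ v.val a := by
  have h1 := completionMap_mem_integers_iff f h (x := x / algebraMap F v.Completion a)
  rw [map_div₀, completionMap_algebraMap, mem_integers_iff, mem_integers_iff, map_div₀, map_div₀,
    valued_algebraMap, valued_algebraMap, div_le_one₀ (zero_lt_iff.mpr (by simpa using ha)),
    div_le_one₀ (zero_lt_iff.mpr (by simpa using ha))] at h1
  exact h1

/-- Every finite place extends to a separable extension. -/
lemma nonempty_over {k : Type*} (K : Type*) [Field k] [Field K] [Algebra k K]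
    [FiniteDimensional k K] [Algebra.IsSeparable k K] (v : FinitePlace k) :
    Nonempty (v.Over K) := by
  let B := integralClosure v.ring K
  have hded : IsDedekindDomain B := integralClosure.isDedekindDomain v.ring k K
  have hfrac : IsFractionRing B K := integralClosure.isFractionRing_of_finite_extension k K
  have hinj : Function.Injective (algebraMap v.ring B) := fun a b hab ↦
    Subtype.ext ((algebraMap k K).injective (congrArg Subtype.val hab))
  have : FaithfulSMul v.ring B := (faithfulSMul_iff_algebraMap_injective _ _).mpr hinj
  have : Module.IsTorsionFree v.ring B :=
    (Module.isTorsionFree_iff_algebraMap_injective).mpr hinj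
  have : Algebra.IsIntegral v.ring B := integralClosure.AlgebraIsIntegral
  -- The required place is the localization of the integral closure at a prime above the maximal
  -- ideal. It restricts to exactly `v.ring`, because the inverse of an element outside `v.ring`
  -- lies in that prime.
  obtain ⟨P, hP⟩ : Nonempty ((IsLocalRing.maximalIdeal v.ring).primesOver B) := inferInstance
  have hb : P ≠ ⊥ := Ideal.ne_bot_of_mem_primesOver
      (IsDiscreteValuationRing.not_a_field v.ring) hP
  let Q : HeightOneSpectrum B := ⟨P, hP.1, hb⟩
  have hdvr : IsDiscreteValuationRing (Q.valuation K).valuationSubring := inferInstance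
  refine ⟨⟨⟨(Q.valuation K).valuationSubring, hdvr⟩, ?_⟩⟩
  have hle : ∀ a : v.ring, Q.valuation K (algebraMap k K a) ≤ 1 := fun a ↦
    Q.valuation_le_one (K := K) (algebraMap v.ring B a)
  refine FinitePlace.ext (SetLike.ext fun a ↦ ?_)
  change Q.valuation K (algebraMap k K a) ≤ 1 ↔ a ∈ v.ring
  refine ⟨fun h ↦ ?_, fun h ↦ hle ⟨a, h⟩⟩
  by_contra ha
  have ha0 : a ≠ 0 := fun h0 ↦ ha (h0 ▸ zero_mem _)
  have hinv : a⁻¹ ∈ v.ring := (v.ring.mem_or_inv_mem a).resolve_left ha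
  have hmax : (⟨a⁻¹, hinv⟩ : v.ring) ∈ IsLocalRing.maximalIdeal v.ring := by
    rw [IsLocalRing.mem_maximalIdeal, mem_nonunits_iff]
    rintro hu
    obtain ⟨b, hb⟩ := hu.exists_right_inv
    have hb' : a⁻¹ * (b : k) = 1 := congrArg Subtype.val hb
    refine ha ?_
    rw [inv_mul_eq_one₀ ha0] at hb'
    rw [hb']
    exact b.2
  have hmem : algebraMap v.ring B ⟨a⁻¹, hinv⟩ ∈ P := by
    have := hP.2.over
    rw [this] at hmax
    exact hmax
  have hlt := (Q.valuation_lt_one_iff_mem (K := K) _).mpr hmem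
  change Q.valuation K (algebraMap k K a⁻¹) < 1 at hlt
  rw [map_inv₀, map_inv₀] at hlt
  have h0 : 0 < Q.valuation K (algebraMap k K a) := zero_lt_iff.mpr (by simpa using ha0)
  exact (inv_lt_one₀ h0).mp hlt |>.not_ge h

end FinitePlace

/-! ### Approximation and invariants in ∏_{w ∣ v} K_w -/

namespace LocalAlg

variable {k : Type*} [Field k] {v : FinitePlace k} {K : Type*} [Field K] [Algebra k K]
  [FiniteDimensional k K]

variable (v K) in
/-- The subgroup `a ∏_{w ∣ v} 𝒪_w`. -/
def ball (a : k) : AddSubgroup (LocalAlg v K) where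
  carrier := {x | ∀ w, Valued.v (proj w x) ≤ w.1.val (algebraMap k K a)}
  zero_mem' w := by simp
  add_mem' {x y} hx hy w := by
    rw [map_add]
    exact Valuation.map_add_le _ (hx w) (hy w)
  neg_mem' {x} hx w := by
    rw [map_neg, Valuation.map_neg]
    exact hx w

lemma mem_ball {a : k} {x : LocalAlg v K} :
    x ∈ ball v K a ↔ ∀ w, Valued.v (proj w x) ≤ w.1.val (algebraMap k K a) := Iff.rfl

lemma mem_ball_one {x : LocalAlg v K} : x ∈ ball v K 1 ↔ x ∈ integers v K := by
  simp only [mem_ball, map_one]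
  exact Iff.rfl

lemma mul_mem_ball {a b : k} {x y : LocalAlg v K} (hx : x ∈ ball v K a) (hy : y ∈ ball v K b) :
    x * y ∈ ball v K (a * b) := fun w ↦ by
  rw [map_mul, map_mul, map_mul, map_mul]
  exact mul_le_mul' (hx w) (hy w)

lemma ofBase_mem_ball_iff [Nonempty (v.Over K)] {a : k} (ha : a ≠ 0) {x : v.Completion} :
    ofBase v K x ∈ ball v K a ↔ Valued.v x ≤ v.val a := by
  rw [mem_ball]
  simp only [proj_ofBase, FinitePlace.valued_completionMap_le_iff _ _ ha, forall_const]

lemma diag_mem_ball (a : k) : diag v K (algebraMap k K a) ∈ ball v K a := fun w ↦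
  (w.1.valued_algebraMap _).le

lemma ball_anti {a b : k} (h : v.val b ≤ v.val a) : ball v K b ≤ ball v K a := fun _ hx w ↦
  (hx w).trans (w.val_le_val_iff.mpr h)

lemma smul_mem_ball {a : k} (ha : a ≠ 0) (σ : K ≃ₐ[k] K) {x : LocalAlg v K}
    (hx : x ∈ ball v K a) : σ • x ∈ ball v K a := fun w ↦ by
  rw [proj_smul, ← σ.commutes]
  exact (FinitePlace.valued_completionMap_le_iff (v := (w.twist σ).1) (w := w.1) (σ : K →+* K) rfl
    (by simpa using ha)).mpr (hx (w.twist σ))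

lemma isClosed_ball {a : k} (ha : a ≠ 0) : IsClosed (ball v K a : Set (LocalAlg v K)) := by
  have : (ball v K a : Set (LocalAlg v K)) = ⋂ w : v.Over K,
      (fun x ↦ (algebraMap K w.1.Completion (algebraMap k K a))⁻¹ * proj w x) ⁻¹'
        (w.1.Integers : Set w.1.Completion) := by
    ext x
    rw [Set.mem_iInter]
    refine forall_congr' fun w ↦ ?_
    rw [Set.mem_preimage, SetLike.mem_coe, FinitePlace.mem_integers_iff, map_mul, map_inv₀,
      FinitePlace.valued_algebraMap, inv_mul_le_one₀ (zero_lt_iff.mpr (by simpa using ha))]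
  rw [this]
  refine isClosed_iInter fun w ↦ (Valued.isClosed_integer _).preimage ?_
  exact continuous_const.mul (continuous_proj w)

lemma eq_zero_of_forall_mem_ball {π : k} (hπ : v.val π < 1) {x : LocalAlg v K}
    (hx : ∀ n : ℕ, x ∈ ball v K (π ^ n)) : x = 0 := by
  refine LocalAlg.ext fun w ↦ ?_
  rw [map_zero]
  by_contra h0
  obtain ⟨n, hn⟩ := exists_pow_lt₀ (w.val_lt_one_iff.mpr hπ)
    (Units.mk0 (Valued.v (proj w x)) (by simpa using h0))
  have := hx n w
  rw [map_pow, map_pow] at this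
  exact hn.not_ge this

/-- Weak approximation of elements of finitely many `∏_{w ∣ v} K_w` by elements of `K`. -/
lemma exists_diag_sub_mem_ball {T : Set (FinitePlace k)} (hT : T.Finite)
    {T' : Set (InfinitePlace K)} (hT' : T'.Finite) (x : ∀ v, LocalAlg v K) (a : FinitePlace k → k)
    (ha : ∀ v, a v ≠ 0) (y : InfinitePlace K → K) :
    ∃ b : K, (∀ v ∈ T, diag v K b - x v ∈ ball v K (a v)) ∧ ∀ w ∈ T', w (b - y w) < 1 := by
  have hfin : {w : FinitePlace K | w.under k ∈ T}.Finite := by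
    refine (hT.biUnion (t := fun v ↦ Set.range fun w : v.Over K ↦ w.1) fun v _ ↦ ?_).subset ?_
    · have := v.finite_over_of_finiteDimensional (K := K)
      exact Set.finite_range _
    · intro w hw
      exact Set.mem_biUnion hw ⟨⟨w, rfl⟩, rfl⟩
  -- Density in each single completion first replaces the components by elements of K, to which weak
  -- approximation in K applies.
  have hex : ∀ w : FinitePlace K, ∃ b : K, Valued.v (algebraMap K w.Completion b -
      proj ⟨w, rfl⟩ (x (w.under k))) ≤ w.val (algebraMap k K (a (w.under k))) := by
    intro w
    obtain ⟨b, hb⟩ := w.exists_valued_sub_le (proj ⟨w, rfl⟩ (x (w.under k)))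
      (a := algebraMap K w.Completion (algebraMap k K (a (w.under k)))) (by simpa using ha _)
    exact ⟨b, by rwa [FinitePlace.valued_algebraMap] at hb⟩
  choose x' hx' using hex
  obtain ⟨b, hb, hb'⟩ := exists_approx hfin hT' x' (fun w ↦ algebraMap k K (a (w.under k)))
    (fun w _ ↦ by simpa using ha _) y
  refine ⟨b, fun v hv ↦ ?_, hb'⟩
  rintro ⟨w, rfl⟩
  have h1 := hb w hv
  rw [← FinitePlace.valued_algebraMap, map_sub] at h1
  have h2 := Valuation.map_add_le _ h1.le (hx' w)
  rw [sub_add_sub_cancel] at h2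
  exact h2

lemma exists_diag_sub_mem (x : LocalAlg v K) {a : k} (ha : a ≠ 0) :
    ∃ b : K, diag v K b - x ∈ ball v K a := by
  classical
  obtain ⟨b, hb, -⟩ := exists_diag_sub_mem_ball (K := K) (Set.finite_singleton v)
    (T' := ∅) Set.finite_empty (fun v' ↦ if h : v' = v then h ▸ x else 0) (fun _ ↦ a)
    (fun _ ↦ ha) 0
  exact ⟨b, by simpa using hb v rfl⟩

lemma exists_pow_mul_mem {π : k} (hπ : v.val π < 1) (x : LocalAlg v K) :
    ∃ n : ℕ, diag v K (algebraMap k K π ^ n) * x ∈ integers v K := by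
  obtain ⟨b, hb⟩ := exists_diag_sub_mem x (one_ne_zero (α := k))
  obtain ⟨n, hn⟩ := exists_pow_mul_diag_mem hπ b
  refine ⟨n, ?_⟩
  rw [mem_ball_one] at hb
  have hπ' : diag v K (algebraMap k K π ^ n) ∈ integers v K := by
    rw [← map_pow, ← mem_ball_one]
    refine ball_anti ?_ (diag_mem_ball (π ^ n))
    rw [map_one, map_pow]
    exact pow_le_one' hπ.le n
  have : diag v K (algebraMap k K π ^ n) * x = diag v K (algebraMap k K π ^ n * b) -
      diag v K (algebraMap k K π ^ n) * (diag v K b - x) := by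
    rw [map_mul]
    ring
  rw [this]
  exact sub_mem hn (mul_mem hπ' hb)

variable [IsGalois k K]

/-- With t of trace 1 and b ∈ K close to x, the element Tr(tb) of k is close to Tr(tx) = x Tr(t) =
x. The denominator πⁿ of t is compensated by taking b closer to x. -/
lemma exists_algebraMap_sub_mem {x : LocalAlg v K} (hx : ∀ σ : K ≃ₐ[k] K, σ • x = x) {a : k}
    (ha : a ≠ 0) : ∃ c : k, diag v K (algebraMap k K c) - x ∈ ball v K a := by
  obtain ⟨t, ht⟩ := Algebra.trace_surjective k K 1
  obtain ⟨π, hπ0, hπ⟩ := v.exists_val_lt_one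
  obtain ⟨n, hn⟩ := exists_pow_mul_diag_mem hπ t
  obtain ⟨b, hb⟩ := exists_diag_sub_mem x (mul_ne_zero ha (pow_ne_zero n hπ0))
  refine ⟨Algebra.trace k K (t * b), ?_⟩
  have h1 : diag v K t * (diag v K b - x) ∈ ball v K a := by
    intro w
    have h2 := hb w
    have h3 := (mem_ball_one.mpr hn) w
    rw [map_one, map_one, map_mul, map_mul, map_mul, proj_diag, FinitePlace.valued_algebraMap,
      mul_comm] at h3
    rw [map_mul, map_mul] at h2
    rw [map_mul, map_mul]
    refine (mul_le_mul_right h2 _).trans ?_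
    rw [mul_left_comm, map_pow]
    exact mul_le_of_le_one_right' h3
  have h4 : diag v K (algebraMap k K (Algebra.trace k K (t * b))) - x =
      ∑ σ : K ≃ₐ[k] K, σ • (diag v K t * (diag v K b - x)) := by
    have h5 : ∑ σ : K ≃ₐ[k] K, σ • diag v K t = 1 := by
      simp only [smul_diag]
      rw [← map_sum, ← trace_eq_sum_automorphisms, ht, map_one, map_one]
    have h6 : x = ∑ σ : K ≃ₐ[k] K, σ • diag v K t * x := by
      rw [← Finset.sum_mul, h5, one_mul]
    conv_lhs => rw [h6]
    rw [trace_eq_sum_automorphisms, map_sum, ← Finset.sum_sub_distrib]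
    refine Finset.sum_congr rfl fun σ _ ↦ ?_
    rw [smul_mul', smul_sub, hx, smul_diag, smul_diag, map_mul, map_mul]
    ring
  rw [h4]
  exact sum_mem fun σ _ ↦ smul_mem_ball ha σ h1

lemma ofBase_injective : Function.Injective (ofBase v K) := by
  obtain ⟨w⟩ := v.nonempty_over K
  intro x y h
  exact (FinitePlace.completionMap (algebraMap k K) w.comap_ring).injective
    (congrArg (proj w) h)

/-- The invariants of `∏_{w ∣ v} K_w` under the Galois group are `k_v`. -/
theorem exists_ofBase_eq (h : HasFinitePlaces k) {x : LocalAlg v K}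
    (hx : ∀ σ : K ≃ₐ[k] K, σ • x = x) : ∃ y, ofBase v K y = x := by
  have := v.nonempty_over K
  obtain ⟨π, hπ0, hπ⟩ := v.exists_val_lt_one
  -- Scaling by a power of π ∈ k preserves invariance and makes x integral, so that approximating
  -- elements stay in the compact set 𝒪_v.
  wlog hxO : x ∈ integers v K generalizing x
  · obtain ⟨n, hn⟩ := exists_pow_mul_mem hπ x
    have hfix : ∀ σ : K ≃ₐ[k] K, σ • (diag v K (algebraMap k K π ^ n) * x) =
        diag v K (algebraMap k K π ^ n) * x := by
      intro σ
      rw [smul_mul', hx, smul_diag, map_pow, σ.commutes]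
    obtain ⟨y, hy⟩ := this hfix hn
    refine ⟨(algebraMap k v.Completion π ^ n)⁻¹ * y, ?_⟩
    have h1 : ofBase v K (algebraMap k v.Completion π ^ n)⁻¹ *
        diag v K (algebraMap k K π ^ n) = 1 := by
      rw [← map_pow, ← map_pow, ← ofBase_algebraMap, ← map_mul, inv_mul_cancel₀, map_one]
      simpa using fun h ↦ absurd h hπ0
    rw [map_mul, hy, ← mul_assoc, h1, one_mul]
  have := h.finite_residueField v
  -- The elements of 𝒪_v agreeing with x modulo πⁿ form decreasing nonempty compact sets; a common
  -- point maps to x.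
  let s : ℕ → Set v.Completion := fun n ↦
    (v.Integers : Set v.Completion) ∩ {y | ofBase v K y - x ∈ ball v K (π ^ n)}
  have hclosed : ∀ n, IsClosed {y | ofBase v K y - x ∈ ball v K (π ^ n)} := fun n ↦
    (isClosed_ball (pow_ne_zero n hπ0)).preimage (continuous_ofBase.sub continuous_const)
  have hne : (⋂ n, s n).Nonempty := by
    refine IsCompact.nonempty_iInter_of_sequence_nonempty_isCompact_isClosed s ?_ ?_ ?_ ?_
    · rintro n y ⟨h1, h2⟩
      refine ⟨h1, ball_anti ?_ h2⟩
      rw [map_pow, map_pow]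
      exact pow_le_pow_right_of_le_one' hπ.le n.le_succ
    · intro n
      obtain ⟨c, hc⟩ := exists_algebraMap_sub_mem hx (pow_ne_zero n hπ0)
      rw [← ofBase_algebraMap] at hc
      refine ⟨algebraMap k v.Completion c, ?_, hc⟩
      rw [SetLike.mem_coe, FinitePlace.mem_integers_iff, ← map_one v.val,
        ← ofBase_mem_ball_iff (K := K) one_ne_zero, ← sub_add_cancel (ofBase v K _) x]
      refine add_mem (ball_anti ?_ hc) (mem_ball_one.mpr hxO)
      rw [map_pow, map_one]
      exact pow_le_one' hπ.le n
    · exact v.isCompact_integers.inter_right (hclosed 0)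
    · exact fun n ↦ v.isCompact_integers.isClosed.inter (hclosed n)
  obtain ⟨y, hy⟩ := hne
  rw [Set.mem_iInter] at hy
  exact ⟨y, sub_eq_zero.mp (eq_zero_of_forall_mem_ball hπ fun n ↦ (hy n).2)⟩

/-- The normal lattice in `∏_{w ∣ v} K_w` defined by a normal basis of `K` over `k`. -/
lemma exists_normalLattice (h : HasFinitePlaces K) (v : FinitePlace k) :
    ∃ D : NormalLattice (K ≃ₐ[k] K) (LocalAlg v K), D.O = integers v K ∧
      ∃ π : k, π ≠ 0 ∧ v.val π < 1 ∧ (D.ϖ : LocalAlg v K) = diag v K (algebraMap k K π) := by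
  obtain ⟨π, hπ0, hπ⟩ := v.exists_val_lt_one
  obtain ⟨α, β, h1, h2, h3⟩ := exists_dual_normal_basis k K
  obtain ⟨n, hn⟩ := exists_pow_mul_diag_mem hπ α
  have hp0 : algebraMap k K π ^ n ≠ 0 := pow_ne_zero n (by simpa using hπ0)
  obtain ⟨c, hc⟩ := exists_pow_mul_diag_mem hπ ((algebraMap k K π ^ n)⁻¹ * β)
  -- Rescaling α by πⁿ and β by π⁻ⁿ makes α integral and, as π is fixed by G, preserves all duality
  -- relations.
  have hkey : ∀ σ τ : K ≃ₐ[k] K, σ (algebraMap k K π ^ n * α) *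
      τ ((algebraMap k K π ^ n)⁻¹ * β) = σ α * τ β := by
    intro σ τ
    rw [map_mul, map_mul, map_inv₀, map_pow, map_pow, σ.commutes, τ.commutes]
    field_simp
  refine ⟨{
    O := integers v K
    smul_mem := fun g _ hx ↦ smul_mem_integers g hx
    isCompact := isCompact_integers h
    isOpen := isOpen_integers
    ϖ := Units.map (diag v K).toMonoidHom (Units.mk0 (algebraMap k K π) (by simpa using hπ0))
    ϖ_mem := mem_ball_one.mp (ball_anti (by rw [map_one]; exact hπ.le) (diag_mem_ball π))
    smul_ϖ := fun g ↦ (smul_diag g _).trans (congrArg (diag v K) (g.commutes π))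
    separated := ?_
    α := diag v K (algebraMap k K π ^ n * α)
    β := diag v K ((algebraMap k K π ^ n)⁻¹ * β)
    α_mem := hn
    c := c
    β_mem := by
      rw [map_mul, map_pow] at hc
      exact hc
    sum_conj := ?_
    sum_conj_one := ?_
    trace_conj := ?_ }, rfl, π, hπ0, hπ, rfl⟩
  · intro x hx
    refine eq_zero_of_forall_mem_ball hπ fun n ↦ ?_
    obtain ⟨y, hy, rfl⟩ := hx n
    have := mul_mem_ball (diag_mem_ball (π ^ n)) (mem_ball_one.mpr hy)
    rw [mul_one, map_pow, map_pow] at this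
    exact this
  · intro τ hτ
    simp only [smul_diag, ← map_mul, hkey]
    rw [← map_sum, h3 τ hτ, map_zero]
  · simp only [← map_mul] at h2
    simp only [smul_diag, ← map_mul, hkey]
    rw [← map_sum, h2, map_one]
  · intro σ τ hστ
    simp only [smul_diag, ← map_mul, hkey, gTrace_apply]
    rw [← map_sum, h1 σ τ hστ, map_zero]

end LocalAlg

/-! ### Norms -/

/-- Under an arbitrary linear order of the index set the matrix is block triangular. -/
lemma det_blockDiagonal' {R ι : Type*} [CommRing R] [Fintype ι] [DecidableEq ι] {n : ι → Type*}
    [∀ i, Fintype (n i)] [∀ i, DecidableEq (n i)] (d : ∀ i, Matrix (n i) (n i) R) :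
    (Matrix.blockDiagonal' d).det = ∏ i, (d i).det := by
  let _ : LinearOrder ι := LinearOrder.lift' (Fintype.equivFin ι) (Fintype.equivFin ι).injective
  rw [(Matrix.blockTriangular_blockDiagonal' d).det_fintype]
  refine Finset.prod_congr rfl fun i _ ↦ ?_
  let e : n i ≃ {a : Σ i, n i // a.1 = i} :=
    { toFun := fun a ↦ ⟨⟨i, a⟩, rfl⟩
      invFun := fun a ↦ a.2 ▸ a.1.2
      left_inv := fun a ↦ rfl
      right_inv := by rintro ⟨⟨j, a⟩, rfl⟩; rfl }
  rw [← Matrix.det_submatrix_equiv_self e]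
  congr 1
  ext a b
  exact Matrix.blockDiagonal'_apply_eq d i a b

lemma norm_pi {F ι : Type*} [CommRing F] [Fintype ι] {L : ι → Type*} [∀ i, CommRing (L i)]
    [∀ i, Algebra F (L i)] [∀ i, Module.Free F (L i)] [∀ i, Module.Finite F (L i)]
    (x : ∀ i, L i) : Algebra.norm F x = ∏ i, Algebra.norm F (x i) := by
  classical
  let b := fun i ↦ Module.Free.chooseBasis F (L i)
  rw [Algebra.norm_eq_matrix_det (Pi.basis b)]
  simp_rw [fun i ↦ Algebra.norm_eq_matrix_det (b i) (x i)]
  rw [← det_blockDiagonal']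
  congr 1
  ext ⟨i, p⟩ ⟨j, q⟩
  rw [Algebra.leftMulMatrix_eq_repr_mul, Pi.basis_repr, Pi.basis_apply]
  rcases eq_or_ne i j with rfl | h
  · rw [Matrix.blockDiagonal'_apply_eq, Algebra.leftMulMatrix_eq_repr_mul]
    simp
  · rw [Matrix.blockDiagonal'_apply_ne _ _ _ h]
    simp [h]

lemma norm_pi_of_finite {F ι : Type*} [Field F] [Fintype ι] {L : ι → Type*} [∀ i, Field (L i)]
    [∀ i, Algebra F (L i)] (h : Module.Finite F (∀ i, L i)) (x : ∀ i, L i) :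
    Algebra.norm F x = ∏ i, Algebra.norm F (x i) := by
  have : ∀ i, Module.Finite F (L i) := fun i ↦
    Module.Finite.of_surjective (LinearMap.proj (R := F) (φ := L) i) (Function.surjective_eval i)
  exact norm_pi x

section

variable {k : Type*} [Field k] {v : FinitePlace k} {K : Type*} [Field K] [Algebra k K]
  [FiniteDimensional k K]

/-- `K_w` as an algebra over `k_v`. -/
@[reducible]
def completionAlgebra (w : v.Over K) : Algebra v.Completion w.1.Completion :=
  (FinitePlace.completionMap (algebraMap k K) w.comap_ring).toAlgebra

attribute [local instance] completionAlgebra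

instance : Algebra v.Completion (LocalAlg v K) :=
  inferInstanceAs (Algebra v.Completion ((w : v.Over K) → w.1.Completion))

lemma smul_localAlg (y : v.Completion) (x : LocalAlg v K) :
    y • x = LocalAlg.ofBase v K y * x := rfl

/-- The inclusion `∏_{w ∣ v} K_wˣ → ∏_{w ∣ v} K_w`. -/
def LocalUnits.coe : LocalUnits v K →* LocalAlg v K where
  toFun x w := (x w : w.1.Completion)
  map_one' := rfl
  map_mul' _ _ := rfl

lemma LocalUnits.proj_coe (x : LocalUnits v K) (w : v.Over K) :
    LocalAlg.proj w (LocalUnits.coe x) = x w := rfl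

lemma LocalUnits.coe_injective : Function.Injective (LocalUnits.coe (v := v) (K := K)) :=
  fun _ _ h ↦ funext fun w ↦ Units.ext (congrFun h w)

lemma LocalUnits.coe_smul (σ : K ≃ₐ[k] K) (x : LocalUnits v K) :
    LocalUnits.coe (σ • x) = σ • LocalUnits.coe x := rfl

variable [IsGalois k K]

/-- The coordinates are G-invariant, hence in k_v, so that `coord` inverts the linear combination
map. This also shows that ∏ K_w is finite over k_v. -/
lemma exists_basis_localAlg (h : HasFinitePlaces k)
    (D : NormalLattice (K ≃ₐ[k] K) (LocalAlg v K)) :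
    ∃ b : Module.Basis (K ≃ₐ[k] K) v.Completion (LocalAlg v K), ∀ σ, b σ = σ • D.α := by
  classical
  let Φ : ((K ≃ₐ[k] K) → v.Completion) →ₗ[v.Completion] LocalAlg v K :=
    Fintype.linearCombination v.Completion fun σ : K ≃ₐ[k] K ↦ σ • D.α
  have hΦ : ∀ c, Φ c = ∑ σ, LocalAlg.ofBase v K (c σ) * σ • D.α := fun c ↦ rfl
  have hcoord : ∀ c τ, D.coord (Φ c) τ = LocalAlg.ofBase v K (c τ) := by
    intro c τ
    have hadd : ∀ x y, D.coord (x + y) τ = D.coord x τ + D.coord y τ := by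
      intro x y
      rw [NormalLattice.coord, NormalLattice.coord, NormalLattice.coord, add_mul, map_add]
    let ψ : LocalAlg v K →+ LocalAlg v K := AddMonoidHom.mk' (fun x ↦ D.coord x τ) hadd
    have : ψ (Φ c) = ∑ σ, ψ (LocalAlg.ofBase v K (c σ) * σ • D.α) := by rw [hΦ, map_sum]
    refine this.trans ?_
    rw [Finset.sum_eq_single τ]
    · refine (D.coord_mul (fun g ↦ LocalAlg.smul_ofBase g _) _ _).trans ?_
      rw [D.coord_smul_α_self, mul_one]
    · intro σ _ hσ
      refine (D.coord_mul (fun g ↦ LocalAlg.smul_ofBase g _) _ _).trans ?_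
      rw [D.coord_smul_α_of_ne hσ, mul_zero]
    · simp
  have hbij : Function.Bijective Φ := by
    refine ⟨fun c c' hc ↦ funext fun τ ↦ LocalAlg.ofBase_injective (K := K) ?_, fun x ↦ ?_⟩
    · rw [← hcoord, ← hcoord, hc]
    · choose c hc using fun σ ↦ LocalAlg.exists_ofBase_eq h fun g ↦ D.smul_coord g x σ
      refine ⟨c, ?_⟩
      rw [hΦ]
      simp_rw [hc, D.sum_coord]
  refine ⟨Module.Basis.ofEquivFun (LinearEquiv.ofBijective Φ hbij).symm, fun σ ↦ ?_⟩
  rw [Module.Basis.coe_ofEquivFun, LinearEquiv.symm_symm]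
  change Φ (Pi.single σ 1) = _
  rw [hΦ, Finset.sum_eq_single σ]
  · simp
  · intro τ _ hτ
    simp [hτ]
  · simp

/-- The norm of `∏_{w ∣ v} K_w` over `k_v` is the product of the conjugates. -/
lemma ofBase_norm (h : HasFinitePlaces k) (D : NormalLattice (K ≃ₐ[k] K) (LocalAlg v K))
    (x : LocalAlg v K) :
    LocalAlg.ofBase v K (Algebra.norm v.Completion x) = ∏ σ : K ≃ₐ[k] K, σ • x := by
  classical
  obtain ⟨b, hb⟩ := exists_basis_localAlg h D
  -- With M the matrix of multiplication by x in the basis τα and P = (ρτα), applying each ρ to the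
  -- columns of M gives diag(ρx) P = P M. As Q inverts P, the determinant of M is ∏ ρx.
  let P : Matrix (K ≃ₐ[k] K) (K ≃ₐ[k] K) (LocalAlg v K) := Matrix.of fun ρ τ ↦ (ρ * τ) • D.α
  let Q : Matrix (K ≃ₐ[k] K) (K ≃ₐ[k] K) (LocalAlg v K) := Matrix.of fun τ ρ ↦ (ρ * τ) • D.β
  let M := Algebra.leftMulMatrix b x
  have hPQ : P * Q = 1 := by
    refine Matrix.ext fun ρ ρ' ↦ ?_
    have h1 : (P * Q) ρ ρ' = ρ • ∑ τ, τ • D.α * (ρ⁻¹ * ρ' * τ) • D.β := by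
      rw [Matrix.mul_apply, Finset.smul_sum]
      refine Finset.sum_congr rfl fun τ _ ↦ ?_
      rw [smul_mul', smul_smul, smul_smul, mul_assoc, mul_inv_cancel_left]
      rfl
    rw [h1, Matrix.one_apply]
    split_ifs with hρ
    · rw [hρ]
      simp only [inv_mul_cancel, one_mul]
      rw [D.sum_conj_one, smul_one]
    · rw [D.sum_conj _ (fun h ↦ hρ (inv_mul_eq_one.mp h)), smul_zero]
  have hmul : Matrix.diagonal (fun ρ : K ≃ₐ[k] K ↦ ρ • x) * P =
      P * (LocalAlg.ofBase v K).mapMatrix M := by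
    refine Matrix.ext fun ρ σ ↦ ?_
    rw [Matrix.diagonal_mul, Matrix.mul_apply]
    have h1 : x * σ • D.α = ∑ τ, LocalAlg.ofBase v K (M τ σ) * τ • D.α := by
      rw [← hb, ← b.sum_repr (x * b σ)]
      refine Finset.sum_congr rfl fun τ _ ↦ ?_
      rw [← Algebra.leftMulMatrix_eq_repr_mul, smul_localAlg, hb]
    have h2 := congrArg (ρ • ·) h1
    simp only [smul_mul', Finset.smul_sum, LocalAlg.smul_ofBase, smul_smul] at h2
    refine h2.trans (Finset.sum_congr rfl fun τ _ ↦ ?_)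
    exact mul_comm _ _
  have hdet := congrArg Matrix.det hmul
  rw [Matrix.det_mul, Matrix.det_mul, Matrix.det_diagonal, mul_comm, ← RingHom.map_det] at hdet
  have hu : IsUnit P.det := by
    refine IsUnit.of_mul_eq_one Q.det ?_
    rw [← Matrix.det_mul, hPQ, Matrix.det_one]
  rw [Algebra.norm_eq_matrix_det b]
  exact (hu.mul_left_cancel hdet).symm

lemma ofBase_normMap (h : HasFinitePlaces k) (D : NormalLattice (K ≃ₐ[k] K) (LocalAlg v K))
    (x : LocalUnits v K) :
    LocalAlg.ofBase v K (normMap v x : (v.Completion)ˣ) =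
      ∏ σ : K ≃ₐ[k] K, σ • LocalUnits.coe x := by
  rw [← ofBase_norm h D]
  obtain ⟨b, -⟩ := exists_basis_localAlg h D
  have hfin : Module.Finite v.Completion (LocalAlg v K) := Module.Finite.of_basis b
  have := Fintype.ofFinite (v.Over K)
  congr 1
  refine Eq.trans ?_ (norm_pi_of_finite (F := v.Completion) (L := fun w : v.Over K ↦ w.1.Completion)
    hfin (fun w ↦ (x w : w.1.Completion))).symm
  have h1 : normMap v x = ∏ w : v.Over K, localNorm w (x w) := finprod_eq_prod_of_fintype _
  rw [h1, Units.coe_prod]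
  rfl

/-! ### Hilbert 90 for the product of the completions -/

/-- The sum s = ∑ f(σ) σ(b) satisfies f(τ) τ(s) = s. Independence of characters with values in one
completion K_{w₀} gives b with s nonzero at w₀; this relation and transitivity of G on the places
above v make s nonzero at every place, so s⁻¹ is the required unit. -/
theorem isMulCoboundary₁_localUnits {f : (K ≃ₐ[k] K) → LocalUnits v K}
    (hf : groupCohomology.IsMulCocycle₁ f) : groupCohomology.IsMulCoboundary₁ f := by
  obtain ⟨w₀⟩ := v.nonempty_over K
  have hne : ∃ b : K, ∑ σ : K ≃ₐ[k] K, (f σ w₀ : w₀.1.Completion) *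
      algebraMap K w₀.1.Completion (σ b) ≠ 0 := by
    by_contra! hall
    let χ : (K ≃ₐ[k] K) → (K →* w₀.1.Completion) := fun σ ↦
      ((algebraMap K w₀.1.Completion).comp (σ : K →+* K)).toMonoidHom
    have hχ : Function.Injective χ := fun σ τ h ↦ AlgEquiv.ext fun b ↦
      (algebraMap K w₀.1.Completion).injective (DFunLike.congr_fun h b)
    have hli := (linearIndependent_monoidHom K w₀.1.Completion).comp χ hχ
    have h0 := Fintype.linearIndependent_iff.mp hli (fun σ ↦ (f σ w₀ : w₀.1.Completion)) (by
      refine funext fun b ↦ ?_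
      rw [Finset.sum_apply]
      exact hall b) 1
    exact (f 1 w₀).ne_zero h0
  obtain ⟨b, hb⟩ := hne
  let s : LocalAlg v K := ∑ σ : K ≃ₐ[k] K, LocalUnits.coe (f σ) * LocalAlg.diag v K (σ b)
  have hs : ∀ τ : K ≃ₐ[k] K, LocalUnits.coe (f τ) * τ • s = s := by
    intro τ
    have h1 : s = ∑ σ : K ≃ₐ[k] K, LocalUnits.coe (f (τ * σ)) * LocalAlg.diag v K ((τ * σ) b) :=
      (Equiv.sum_comp (Equiv.mulLeft τ) fun σ ↦
        LocalUnits.coe (f σ) * LocalAlg.diag v K (σ b)).symm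
    conv_rhs => rw [h1]
    rw [Finset.smul_sum, Finset.mul_sum]
    refine Finset.sum_congr rfl fun σ _ ↦ ?_
    rw [hf τ σ, map_mul, LocalUnits.coe_smul, smul_mul', LocalAlg.smul_diag, AlgEquiv.mul_apply]
    ring
  have hs0 : ∀ w, LocalAlg.proj w s ≠ 0 := by
    intro w
    obtain ⟨τ, rfl⟩ := FinitePlace.exists_twist_eq w w₀
    rw [← hs τ, map_mul, LocalUnits.proj_coe, LocalAlg.proj_smul]
    refine mul_ne_zero (f τ w).ne_zero ((map_ne_zero _).mpr ?_)
    rw [map_sum]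
    exact hb
  let u : LocalUnits v K := fun w ↦ Units.mk0 (LocalAlg.proj w s) (hs0 w)
  have hu : LocalUnits.coe u = s := rfl
  refine ⟨u⁻¹, fun τ ↦ ?_⟩
  rw [smul_inv', div_inv_eq_mul, inv_mul_eq_iff_eq_mul, mul_comm]
  apply LocalUnits.coe_injective
  rw [map_mul, LocalUnits.coe_smul, hu, hs]

end

/-! ### Local generators of a modulus -/

namespace Modulus

section

variable {F : Type*} [Field F] {S : Set (Place F)} (m : Modulus F S)

/-- `a` generates `𝔪_f` locally at `w`. -/
structure IsGenerator (w : FinitePlace F) (a : F) : Prop where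
  ne_zero : a ≠ 0
  mem : ∃ b ∈ m.fin, (b : F) = a
  val_le : ∀ b ∈ m.fin, w.val (b : F) ≤ w.val a

lemma exists_mem_fin_ne_zero : ∃ b ∈ m.fin, (b : F) ≠ 0 := by
  obtain ⟨b, hb, hb0⟩ := Submodule.exists_mem_ne_zero_of_ne_bot m.fin_ne_bot
  exact ⟨b, hb, fun h ↦ hb0 (Subtype.ext h)⟩

/-- The valuation ring is noetherian, so some nonzero element of 𝔪_f generates a maximal ideal among
those generated by single such elements. Ideals of a valuation ring are comparable, whence it has
the largest value. -/
lemma exists_isGenerator {w : FinitePlace F} (hw : Place.finite w ∉ S) :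
    ∃ a, m.IsGenerator w a := by
  let A : Set (Ideal w.ring) := {I | ∃ y : w.ring, (y : F) ≠ 0 ∧ (∃ b ∈ m.fin, (b : F) = y) ∧
    Ideal.span {y} = I}
  have hA : A.Nonempty := by
    obtain ⟨b, hb, hb0⟩ := m.exists_mem_fin_ne_zero
    exact ⟨_, ⟨b, b.2 w hw⟩, hb0, ⟨b, hb, rfl⟩, rfl⟩
  obtain ⟨_, ⟨y, hy0, hy, rfl⟩, hmax⟩ := set_has_maximal_iff_noetherian.mpr
    (inferInstanceAs (IsNoetherian w.ring w.ring)) A hA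
  refine ⟨y, hy0, hy, fun b hb ↦ ?_⟩
  rcases eq_or_ne (b : F) 0 with h0 | h0
  · rw [h0, map_zero]
    exact zero_le
  by_contra! hlt
  let z : w.ring := ⟨b, b.2 w hw⟩
  have hdvd : (y : F) / z ∈ w.ring := by
    rw [← FinitePlace.val_le_one_iff, map_div₀]
    exact div_le_one_of_le₀ hlt.le zero_le
  have hyz : y = z * ⟨(y : F) / z, hdvd⟩ := Subtype.ext (mul_div_cancel₀ _ h0).symm
  refine hmax (Ideal.span {z}) ⟨z, h0, ⟨b, hb, rfl⟩, rfl⟩ (lt_of_le_of_ne ?_ fun h ↦ ?_)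
  · rw [Ideal.span_singleton_le_span_singleton]
    exact ⟨_, hyz⟩
  · obtain ⟨c, hc⟩ := Ideal.mem_span_singleton.mp (h ▸ Ideal.mem_span_singleton_self z)
    have hc' : (b : F) = y * c := congrArg Subtype.val hc
    refine hlt.not_ge ?_
    rw [hc', map_mul]
    exact mul_le_of_le_one_right' ((w.val_le_one_iff _).mpr c.2)

variable {m} {w : FinitePlace F} {a : F}

lemma IsGenerator.mem_ring (hw : Place.finite w ∉ S) (h : m.IsGenerator w a) : a ∈ w.ring := by
  obtain ⟨b, -, rfl⟩ := h.mem
  exact b.2 w hw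

lemma IsGenerator.localIdeal_eq (hw : Place.finite w ∉ S) (h : m.IsGenerator w a) :
    m.localIdeal w = Ideal.span {⟨a, h.mem_ring hw⟩} := by
  refine le_antisymm (Ideal.span_le.mpr ?_) (Ideal.span_le.mpr ?_)
  · rintro y ⟨b, hb, hby⟩
    have hle := h.val_le b hb
    have hdvd : (y : F) / a ∈ w.ring := by
      rw [← FinitePlace.val_le_one_iff, map_div₀, ← hby]
      exact div_le_one_of_le₀ hle zero_le
    exact Ideal.mem_span_singleton.mpr
      ⟨⟨(y : F) / a, hdvd⟩, Subtype.ext (mul_div_cancel₀ _ h.ne_zero).symm⟩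
  · rintro _ rfl
    exact Ideal.subset_span h.mem

lemma IsGenerator.mem_localIdeal_iff (hw : Place.finite w ∉ S) (h : m.IsGenerator w a)
    {y : w.ring} : y ∈ m.localIdeal w ↔ w.val (y : F) ≤ w.val a := by
  rw [h.localIdeal_eq hw, Ideal.mem_span_singleton]
  constructor
  · rintro ⟨c, rfl⟩
    change w.val (a * c) ≤ _
    rw [map_mul]
    exact mul_le_of_le_one_right' ((w.val_le_one_iff _).mpr c.2)
  · intro hle
    have hdvd : (y : F) / a ∈ w.ring := by
      rw [← FinitePlace.val_le_one_iff, map_div₀]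
      exact div_le_one_of_le₀ hle zero_le
    exact ⟨⟨(y : F) / a, hdvd⟩, Subtype.ext (mul_div_cancel₀ _ h.ne_zero).symm⟩

lemma IsGenerator.mem_completedIdeal_iff (hw : Place.finite w ∉ S) (h : m.IsGenerator w a)
    {y : w.Integers} : y ∈ m.completedIdeal w ↔ Valued.v (y : w.Completion) ≤ w.val a := by
  rw [completedIdeal, h.localIdeal_eq hw, Ideal.map_span, Set.image_singleton,
    Ideal.mem_span_singleton]
  have ha0 : algebraMap F w.Completion a ≠ 0 := by simpa using h.ne_zero
  have hcoe : ((algebraMap w.ring w.Integers ⟨a, h.mem_ring hw⟩ : w.Integers) : w.Completion) =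
      algebraMap F w.Completion a := rfl
  constructor
  · rintro ⟨c, rfl⟩
    change Valued.v (((algebraMap w.ring w.Integers ⟨a, h.mem_ring hw⟩ : w.Integers) :
      w.Completion) * c) ≤ _
    rw [hcoe, map_mul, FinitePlace.valued_algebraMap]
    exact mul_le_of_le_one_right' c.2
  · intro hle
    have hdvd : (y : w.Completion) / algebraMap F w.Completion a ∈ w.Integers := by
      rw [FinitePlace.mem_integers_iff, map_div₀, FinitePlace.valued_algebraMap]
      exact div_le_one_of_le₀ hle zero_le
    exact ⟨⟨_, hdvd⟩, Subtype.ext (mul_div_cancel₀ _ ha0).symm⟩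

lemma IsGenerator.mem_finSupport_iff (hw : Place.finite w ∉ S) (h : m.IsGenerator w a) :
    w ∈ m.finSupport ↔ w.val a < 1 := by
  rw [finSupport, Set.mem_ofPred_eq, Ideal.ne_top_iff_one, h.mem_localIdeal_iff hw]
  change _ ∧ ¬ w.val 1 ≤ _ ↔ _
  rw [map_one, not_le]
  exact and_iff_right hw

lemma IsGenerator.mem_rayUnits_iff (hw : w ∈ m.finSupport) (h : m.IsGenerator w a)
    {u : (w.Completion)ˣ} :
    u ∈ m.rayUnits w ↔ Valued.v ((u : w.Completion) - 1) ≤ w.val a := by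
  rw [m.mem_rayUnits_iff hw]
  constructor
  · rintro ⟨y, hy, hu⟩
    rw [hu, add_sub_cancel_left]
    exact (h.mem_completedIdeal_iff hw.1).mp hy
  · intro hle
    have hmem : (u : w.Completion) - 1 ∈ w.Integers :=
      hle.trans ((h.mem_finSupport_iff hw.1).mp hw).le
    exact ⟨⟨_, hmem⟩, (h.mem_completedIdeal_iff hw.1).mpr hle, (add_sub_cancel _ _).symm⟩

variable (m)

/-- Any nonzero element of 𝔪_f is a non-unit at each place of the support. -/
lemma finite_finSupport (h : HasFinitePlaces F) : m.finSupport.Finite := by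
  obtain ⟨b, hb, hb0⟩ := m.exists_mem_fin_ne_zero
  refine (h.finite_val_ne_one _ hb0).subset fun w hw ↦ ?_
  obtain ⟨a, ha⟩ := m.exists_isGenerator hw.1
  exact ((ha.val_le b hb).trans_lt ((ha.mem_finSupport_iff hw.1).mp hw)).ne

lemma exists_generators : ∃ a : FinitePlace F → F, (∀ w, a w ≠ 0) ∧
    ∀ w ∈ m.finSupport, m.IsGenerator w (a w) := by
  have : ∀ w : FinitePlace F, ∃ a : F, a ≠ 0 ∧ (w ∈ m.finSupport → m.IsGenerator w a) := by
    intro w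
    by_cases hw : w ∈ m.finSupport
    · obtain ⟨a, ha⟩ := m.exists_isGenerator hw.1
      exact ⟨a, ha.ne_zero, fun _ ↦ ha⟩
    · exact ⟨1, one_ne_zero, fun h ↦ absurd h hw⟩
  choose a ha0 ha using this
  exact ⟨a, ha0, ha⟩

end

section Extension

variable {k K : Type*} [Field k] [Field K] [Algebra k K] [FiniteDimensional k K]
  {S : Set (Place k)} {m : Modulus k S} {v : FinitePlace k} {a : k}

lemma IsGenerator.induced (hv : Place.finite v ∉ S) (h : m.IsGenerator v a) (w : v.Over K) :
    (m.induced K).IsGenerator w.1 (algebraMap k K a) := by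
  refine ⟨by simpa using h.ne_zero, ?_, fun b hb ↦ ?_⟩
  · obtain ⟨b, hb, rfl⟩ := h.mem
    exact ⟨SIntegers.map K S b, Ideal.mem_map_of_mem _ hb, rfl⟩
  · have hw : Place.finite w.1 ∉ (Place.under k ⁻¹' S : Set (Place K)) := by
      rw [Set.mem_preimage, Place.under, w.2]
      exact hv
    change b ∈ Ideal.span _ at hb
    induction hb using Submodule.span_induction with
    | mem x hx =>
      obtain ⟨y, hy, rfl⟩ := hx
      exact w.val_le_val_iff.mpr (h.val_le y hy)
    | zero => simp
    | add x y _ _ hx hy =>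
      change w.1.val ((x : K) + y) ≤ _
      exact Valuation.map_add_le _ hx hy
    | smul s x _ hx =>
      change w.1.val ((s : K) * x) ≤ _
      rw [map_mul]
      exact mul_le_of_le_one_of_le ((w.1.val_le_one_iff _).mpr (s.2 w.1 hw)) hx

lemma mem_finSupport_induced_iff (w : v.Over K) :
    w.1 ∈ (m.induced K).finSupport ↔ v ∈ m.finSupport := by
  have hS : Place.finite w.1 ∈ (Place.under k ⁻¹' S : Set (Place K)) ↔ Place.finite v ∈ S := by
    rw [Set.mem_preimage, Place.under, w.2]
  by_cases hv : Place.finite v ∈ S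
  · exact ⟨fun h ↦ absurd (hS.mpr hv) h.1, fun h ↦ absurd hv h.1⟩
  · obtain ⟨a, ha⟩ := m.exists_isGenerator hv
    rw [ha.mem_finSupport_iff hv, (ha.induced hv w).mem_finSupport_iff (fun h ↦ hv (hS.mp h)),
      w.val_lt_one_iff]

lemma IsGenerator.mem_rayProduct_iff (hv : v ∈ m.finSupport) (h : m.IsGenerator v a)
    {x : LocalUnits v K} :
    x ∈ m.rayProduct K v ↔ LocalUnits.coe x - 1 ∈ LocalAlg.ball v K a := by
  refine forall_congr' fun w ↦ ?_
  rw [(h.induced hv.1 w).mem_rayUnits_iff ((mem_finSupport_induced_iff w).mpr hv)]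
  rfl

end Extension

end Modulus

/-! ### Norm indices of the groups 1 + 𝔪𝒪_w -/

namespace Modulus

variable {k K : Type*} [Field k] [Field K] [Algebra k K] [FiniteDimensional k K]
  {S : Set (Place k)} (m : Modulus k S) {v : FinitePlace k}

variable (K v) in
/-- The inclusion `∏_{w ∣ v} (1 + 𝔪 𝒪_w) → ∏_{w ∣ v} K_w`. -/
def rayProductCoe : m.rayProduct K v →* LocalAlg v K :=
  LocalUnits.coe.comp (m.rayProduct K v).subtype

lemma rayProductCoe_injective : Function.Injective (m.rayProductCoe K v) :=
  LocalUnits.coe_injective.comp Subtype.val_injective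

lemma rayProductCoe_smul (σ : K ≃ₐ[k] K) (x : m.rayProduct K v) :
    m.rayProductCoe K v (σ • x) = σ • m.rayProductCoe K v x := rfl

variable {m}

lemma exists_rayProductCoe_eq (hv : v ∈ m.finSupport) {a : k} (ha : m.IsGenerator v a)
    {x : LocalAlg v K} (hx : x ∈ LocalAlg.ball v K a) : ∃ u, m.rayProductCoe K v u = 1 + x := by
  have hne : ∀ w : v.Over K, 1 + LocalAlg.proj w x ≠ 0 := by
    intro w h0
    have hlt : Valued.v (LocalAlg.proj w x) < 1 :=
      (hx w).trans_lt (w.val_lt_one_iff.mpr ((ha.mem_finSupport_iff hv.1).mp hv))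
    rw [← neg_eq_of_add_eq_zero_right h0, Valuation.map_neg, map_one] at hlt
    exact lt_irrefl _ hlt
  let u : LocalUnits v K := fun w ↦ Units.mk0 (1 + LocalAlg.proj w x) (hne w)
  have hu : LocalUnits.coe u = 1 + x := rfl
  refine ⟨⟨u, (ha.mem_rayProduct_iff hv).mpr ?_⟩, hu⟩
  rwa [hu, add_sub_cancel_left]

variable (K v) in
/-- The diagonal embedding `k_vˣ → ∏_{w ∣ v} K_wˣ`. -/
def unitsDiag : (v.Completion)ˣ →* LocalUnits v K where
  toFun x w := Units.map (FinitePlace.completionMap (algebraMap k K) w.comap_ring).toMonoidHom x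
  map_one' := by
    funext w
    exact map_one _
  map_mul' x y := by
    funext w
    exact map_mul _ _ _

lemma coe_unitsDiag (x : (v.Completion)ˣ) :
    LocalUnits.coe (unitsDiag K v x) = LocalAlg.ofBase v K x := rfl

lemma gNorm_rayProduct_coe (x : m.rayProduct K v) :
    ((gNorm (K ≃ₐ[k] K) (m.rayProduct K v) x : m.rayProduct K v) : LocalUnits v K) =
      gNorm (K ≃ₐ[k] K) (LocalUnits v K) x := by
  rw [gNorm_apply, gNorm_apply, Subgroup.val_finsetProd]
  rfl

variable [IsGalois k K]

lemma unitsDiag_injective : Function.Injective (unitsDiag K v) := fun _ _ h ↦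
  Units.ext (LocalAlg.ofBase_injective (K := K) (congrArg LocalUnits.coe h))

lemma unitsDiag_mem_rayProduct_iff (hv : v ∈ m.finSupport) {x : (v.Completion)ˣ} :
    unitsDiag K v x ∈ m.rayProduct K v ↔ x ∈ m.rayUnits v := by
  have := v.nonempty_over K
  obtain ⟨a, ha⟩ := m.exists_isGenerator hv.1
  rw [ha.mem_rayProduct_iff hv, ha.mem_rayUnits_iff hv, coe_unitsDiag,
    ← map_one (LocalAlg.ofBase v K), ← map_sub, LocalAlg.ofBase_mem_ball_iff ha.ne_zero]

lemma unitsDiag_normMap (hk : HasFinitePlaces k) (x : LocalUnits v K) :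
    unitsDiag K v (normMap v x) = gNorm (K ≃ₐ[k] K) (LocalUnits v K) x := by
  have hK : HasFinitePlaces K := hk.of_finiteDimensional
  obtain ⟨D, -⟩ := LocalAlg.exists_normalLattice hK v
  apply LocalUnits.coe_injective
  rw [coe_unitsDiag, ofBase_normMap hk D, gNorm_apply, map_prod]
  rfl

/-- Inside ∏ K_wˣ the norm is the product of the conjugates, which stays in the G-stable group ∏(1 +
𝔪𝒪_w); an element of k_vˣ in that group lies in 1 + 𝔪𝒪_v. -/
lemma map_normMap_le (hk : HasFinitePlaces k) (hv : v ∈ m.finSupport) :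
    (m.rayProduct K v).map (normMap v) ≤ m.rayUnits v := by
  rintro _ ⟨x, hx, rfl⟩
  rw [← unitsDiag_mem_rayProduct_iff (K := K) hv, unitsDiag_normMap hk,
    ← gNorm_rayProduct_coe ⟨x, hx⟩]
  exact Subtype.prop _

lemma exists_unitsDiag_eq (hk : HasFinitePlaces k) {x : LocalUnits v K}
    (hx : ∀ σ : K ≃ₐ[k] K, σ • x = x) : ∃ y, unitsDiag K v y = x := by
  obtain ⟨w⟩ := v.nonempty_over K
  obtain ⟨y, hy⟩ := LocalAlg.exists_ofBase_eq hk (x := LocalUnits.coe x) fun σ ↦ by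
    rw [← LocalUnits.coe_smul, hx]
  have hy0 : y ≠ 0 := by
    rintro rfl
    rw [map_zero] at hy
    exact (x w).ne_zero (congrArg (LocalAlg.proj w) hy).symm
  exact ⟨Units.mk0 y hy0, LocalUnits.coe_injective hy⟩

variable (m) in
/-- The index formula for the norm on `∏_{w ∣ v} (1 + 𝔪 𝒪_w)`. -/
theorem relIndex_gDiff_eq (hk : HasFinitePlaces k) (hv : v ∈ m.finSupport) (g : K ≃ₐ[k] K)
    (hg : ∀ x, x ∈ Subgroup.zpowers g) :
    (gDiff (m.rayProduct K v) g).range.relIndex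
        (gNorm (K ≃ₐ[k] K) (m.rayProduct K v)).ker =
      ((m.rayProduct K v).map (normMap v)).relIndex (m.rayUnits v) ∧
    (gDiff (m.rayProduct K v) g).range.relIndex
        (gNorm (K ≃ₐ[k] K) (m.rayProduct K v)).ker ≠ 0 := by
  have hK : HasFinitePlaces K := hk.of_finiteDimensional
  obtain ⟨a, ha⟩ := m.exists_isGenerator hv.1
  obtain ⟨D, hDO, π, hπ0, hπ, hDπ⟩ := LocalAlg.exists_normalLattice hK v
  -- For this n the power πⁿ is divisible by the local generator a, so ∏(1 + 𝔪𝒪_w) contains 1 + ϖⁿO.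
  obtain ⟨n, hn⟩ := exists_pow_lt₀ hπ (Units.mk0 (v.val a) (by simpa using ha.ne_zero))
  have hO : ∀ u, m.rayProductCoe K v u ∈ D.O := by
    intro u
    have h1 := (ha.mem_rayProduct_iff hv).mp u.2
    rw [hDO, ← sub_add_cancel (m.rayProductCoe K v u) 1]
    refine add_mem (LocalAlg.mem_ball_one.mp (LocalAlg.ball_anti ?_ h1)) (one_mem _)
    rw [map_one]
    exact ((ha.mem_finSupport_iff hv.1).mp hv).le
  have hU : ∀ x ∈ D.F n, ∃ u, m.rayProductCoe K v u = 1 + x := by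
    rintro x ⟨y, hy, rfl⟩
    refine exists_rayProductCoe_eq hv ha ?_
    rw [hDO, ← LocalAlg.mem_ball_one] at hy
    have h1 := LocalAlg.mul_mem_ball (LocalAlg.diag_mem_ball (K := K) (π ^ n)) hy
    rw [mul_one, map_pow, map_pow, ← hDπ] at h1
    refine LocalAlg.ball_anti ?_ h1
    rw [map_pow]
    exact hn.le
  obtain ⟨h1, h2⟩ := D.relIndex_eq (m.rayProductCoe K v) m.rayProductCoe_injective
    m.rayProductCoe_smul hO n hU g hg
  refine ⟨h1.trans ?_, h2⟩
  -- Both indices are compared inside ∏ K_wˣ: there N corresponds to the local norm map, and the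
  -- kernel of g - 1 to the diagonal image of 1 + 𝔪𝒪_v.
  rw [← Subgroup.relIndex_map_map_of_injective _ _ (m.rayProduct K v).subtype_injective,
    ← Subgroup.relIndex_map_map_of_injective _ _ (unitsDiag_injective (v := v) (K := K))]
  congr 1
  · ext x
    constructor
    · rintro ⟨_, ⟨u, rfl⟩, rfl⟩
      refine ⟨_, ⟨u, u.2, rfl⟩, ?_⟩
      rw [unitsDiag_normMap hk]
      exact (gNorm_rayProduct_coe u).symm
    · rintro ⟨_, ⟨u, hu, rfl⟩, rfl⟩
      refine ⟨_, ⟨⟨u, hu⟩, rfl⟩, ?_⟩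
      rw [unitsDiag_normMap hk]
      exact gNorm_rayProduct_coe ⟨u, hu⟩
  · ext x
    constructor
    · rintro ⟨u, hu, rfl⟩
      have hgu : g • u = u := div_eq_one.mp hu
      have hfix : ∀ σ : K ≃ₐ[k] K, σ • (u : LocalUnits v K) = u := fun σ ↦ by
        have : g ∈ MulAction.stabilizer (K ≃ₐ[k] K) u := hgu
        exact congrArg Subtype.val ((Subgroup.zpowers_le.mpr this) (hg σ))
      obtain ⟨y, hy⟩ := exists_unitsDiag_eq hk hfix
      exact ⟨y, (unitsDiag_mem_rayProduct_iff (K := K) hv).mp (hy ▸ u.2), hy⟩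
    · rintro ⟨y, hy, rfl⟩
      refine ⟨⟨_, (unitsDiag_mem_rayProduct_iff (K := K) hv).mpr hy⟩, ?_, rfl⟩
      refine div_eq_one.mpr (Subtype.ext (LocalUnits.coe_injective ?_))
      exact LocalAlg.smul_ofBase g _

end Modulus

/-! ### Approximation by global elements -/

namespace LocalUnits

variable {k K : Type*} [Field k] [Field K] [Algebra k K] [FiniteDimensional k K]

/-- The diagonal embedding `Kˣ → ∏_{w ∣ v} K_wˣ`. -/
def diag (v : FinitePlace k) (K : Type*) [Field K] [Algebra k K] [FiniteDimensional k K] :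
    Kˣ →* LocalUnits v K where
  toFun x w := Units.map (algebraMap K w.1.Completion).toMonoidHom x
  map_one' := by
    funext w
    exact map_one _
  map_mul' x y := by
    funext w
    exact map_mul _ _ _

variable {v : FinitePlace k}

lemma coe_diag (x : Kˣ) : coe (diag v K x) = LocalAlg.diag v K x := rfl

lemma smul_diag (σ : K ≃ₐ[k] K) (x : Kˣ) : σ • diag v K x = diag v K (σ • x) :=
  coe_injective (LocalAlg.smul_diag σ (x : K))

/-- Additive closeness a πⁿ becomes multiplicative closeness a, where πⁿ clears the denominator of
x⁻¹. The approximant z need not be a unit. -/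
lemma exists_mul_coe_inv_sub_one_mem (x : LocalUnits v K) {a : k} (ha : a ≠ 0) :
    ∃ e : k, e ≠ 0 ∧ ∀ z, z - coe x ∈ LocalAlg.ball v K e →
      z * coe x⁻¹ - 1 ∈ LocalAlg.ball v K a := by
  obtain ⟨π, hπ0, hπ⟩ := v.exists_val_lt_one
  obtain ⟨n, hn⟩ := LocalAlg.exists_pow_mul_mem hπ (coe x⁻¹)
  have hp0 : π ^ n ≠ 0 := pow_ne_zero n hπ0
  refine ⟨a * π ^ n, mul_ne_zero ha hp0, fun z hz w ↦ ?_⟩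
  have h1 : z * coe x⁻¹ - 1 = (z - coe x) * coe x⁻¹ := by
    rw [sub_mul, ← map_mul, mul_inv_cancel, map_one]
  have h2 := (LocalAlg.mem_ball_one.mpr hn) w
  rw [map_one, map_one, map_mul, map_mul, LocalAlg.proj_diag, FinitePlace.valued_algebraMap] at h2
  have h3 := hz w
  rw [map_mul, map_mul] at h3
  rw [h1, map_mul, map_mul]
  refine (mul_le_mul_left h3 _).trans ?_
  rw [mul_assoc, map_pow]
  exact mul_le_of_le_one_right' h2

end LocalUnits

/-- The fibres of restriction to k are empty or orbits of the finite group G. -/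
lemma finite_infinitePlace_of_isGalois (k K : Type*) [Field k] [Field K] [Algebra k K]
    [FiniteDimensional k K] [IsGalois k K] [Finite (InfinitePlace k)] :
    Finite (InfinitePlace K) := by
  refine Set.finite_univ_iff.mp (Set.Finite.preimage' (s := Set.univ)
    (f := fun w : InfinitePlace K ↦ w.comap (algebraMap k K)) Set.finite_univ fun u _ ↦ ?_)
  rcases (((fun w : InfinitePlace K ↦ w.comap (algebraMap k K)) ⁻¹' {u})).eq_empty_or_nonempty
    with h | ⟨w, hw⟩
  · rw [h]
    exact Set.finite_empty
  · refine (Set.finite_range fun σ : K ≃ₐ[k] K ↦ σ • w).subset fun w' hw' ↦ ?_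
    exact InfinitePlace.exists_smul_eq_of_comap_eq (Eq.trans hw (Eq.symm hw'))

lemma embedding_pos_of_lt_one {F : Type*} [Field F] {w : InfinitePlace F} (hw : w.IsReal) {x : F}
    (h : w (x - 1) < 1) : 0 < InfinitePlace.embedding_of_isReal hw x := by
  rw [← InfinitePlace.norm_embedding_of_isReal hw, Real.norm_eq_abs, map_sub, map_one,
    abs_lt] at h
  linarith [h.1]

namespace Modulus

variable {k K : Type*} [Field k] [Field K] [Algebra k K] [FiniteDimensional k K]
  {S : Set (Place k)} {m : Modulus k S}

lemma exists_embedding_apply_eq (σ : K ≃ₐ[k] K) {w : InfinitePlace K}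
    (hw : w ∈ (m.induced K).inf) : ∃ (w' : InfinitePlace K) (hw' : w' ∈ (m.induced K).inf),
      ∀ x : K, InfinitePlace.embedding_of_isReal hw.1 (σ x) =
        InfinitePlace.embedding_of_isReal hw'.1 x := by
  have hw' : w.comap (σ : K →+* K) ∈ (m.induced K).inf := by
    refine ⟨hw.1.comap _, ?_⟩
    rw [← InfinitePlace.comap_comp]
    convert! hw.2 using 2
    ext x
    exact σ.commutes x
  refine ⟨_, hw', fun x ↦ Complex.ofReal_injective ?_⟩
  rw [InfinitePlace.embedding_of_isReal_apply, InfinitePlace.embedding_of_isReal_apply,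
    InfinitePlace.comap_embedding_of_isReal _ (hw.1.comap _)]
  rfl

lemma mem_rayGroup_induced_iff {x : Kˣ} : x ∈ (m.induced K).rayGroup ↔
    (∀ v ∈ m.finSupport, LocalUnits.diag v K x ∈ m.rayProduct K v) ∧
      ∀ (w : InfinitePlace K) (hw : w ∈ (m.induced K).inf),
        0 < InfinitePlace.embedding_of_isReal hw.1 (x : K) := by
  refine and_congr_left fun _ ↦ ?_
  have key : ∀ (v : FinitePlace k) (w : v.Over K), v ∈ m.finSupport →
      ((∃ y ∈ (m.induced K).localIdeal w.1, (y : K) = (x : K) - 1) ↔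
        LocalUnits.diag v K x w ∈ (m.induced K).rayUnits w.1) := by
    intro v w hv
    have hw := (mem_finSupport_induced_iff (K := K) (m := m) w).mpr hv
    obtain ⟨a, ha⟩ := (m.induced K).exists_isGenerator hw.1
    rw [ha.mem_rayUnits_iff hw]
    change _ ↔ Valued.v (algebraMap K w.1.Completion x - 1) ≤ _
    rw [← map_one (algebraMap K w.1.Completion), ← map_sub, FinitePlace.valued_algebraMap]
    constructor
    · rintro ⟨y, hy, hyx⟩
      rw [← hyx]
      exact (ha.mem_localIdeal_iff hw.1).mp hy
    · intro hle
      have hmem : (x : K) - 1 ∈ w.1.ring := by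
        rw [← FinitePlace.val_le_one_iff]
        exact hle.trans ((ha.mem_finSupport_iff hw.1).mp hw).le
      exact ⟨⟨_, hmem⟩, (ha.mem_localIdeal_iff hw.1).mpr hle, rfl⟩
  constructor
  · intro h v hv w
    exact (key v w hv).mp (h w.1 ((mem_finSupport_induced_iff w).mpr hv))
  · intro h w hw
    have hv : w.under k ∈ m.finSupport :=
      (mem_finSupport_induced_iff (K := K) (m := m) (v := w.under k) ⟨w, rfl⟩).mp hw
    exact (key (w.under k) ⟨w, rfl⟩ hv).mpr (h _ hv ⟨w, rfl⟩)

/-- This excludes 0 as an approximation to a local unit, since 0 · x⁻¹ - 1 = -1. -/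
lemma IsGenerator.not_neg_one_mem_ball [Algebra.IsSeparable k K] {v : FinitePlace k}
    (hv : v ∈ m.finSupport) {a : k} (ha : m.IsGenerator v a) : -1 ∉ LocalAlg.ball v K a := by
  obtain ⟨w⟩ := v.nonempty_over K
  intro h
  have := h w
  rw [map_neg, Valuation.map_neg, map_one, map_one] at this
  exact (w.val_lt_one_iff.mpr ((ha.mem_finSupport_iff hv.1).mp hv)).not_ge this

lemma IsGenerator.diag_div_mem_rayProduct {v : FinitePlace k} (hv : v ∈ m.finSupport) {a : k}
    (ha : m.IsGenerator v a) {b : Kˣ} {x : LocalUnits v K}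
    (h : LocalAlg.diag v K b * LocalUnits.coe x⁻¹ - 1 ∈ LocalAlg.ball v K a) :
    LocalUnits.diag v K b / x ∈ m.rayProduct K v := by
  rw [ha.mem_rayProduct_iff hv, div_eq_mul_inv, map_mul, LocalUnits.coe_diag]
  exact h

variable (K m) in
/-- The diagonal map `K^𝔪 → ∏_{w ∣ v} (1 + 𝔪 𝒪_w)`. -/
def rayGroupDiag (v : m.finSupport) : (m.induced K).rayGroup →* m.rayProduct K v.1 where
  toFun x := ⟨LocalUnits.diag v.1 K x, (mem_rayGroup_induced_iff.mp x.2).1 v.1 v.2⟩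
  map_one' := Subtype.ext (map_one _)
  map_mul' x y := Subtype.ext (map_mul (LocalUnits.diag v.1 K) (x : Kˣ) (y : Kˣ))

lemma rayGroupDiag_smul (v : m.finSupport) (σ : K ≃ₐ[k] K) (x : (m.induced K).rayGroup) :
    m.rayGroupDiag K v (σ • x) = σ • m.rayGroupDiag K v x :=
  Subtype.ext (LocalUnits.smul_diag (v := v.1) σ (x : Kˣ)).symm

variable [IsGalois k K]

/-- Approximation of local units by a unit of `K` that is positive at the places in `𝔪_∞`. -/
lemma exists_units_diag_div_mem [Finite (InfinitePlace K)] (hk : HasFinitePlaces k)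
    (x : ∀ v, LocalUnits v K) :
    ∃ b : Kˣ, (∀ v ∈ m.finSupport, LocalUnits.diag v K b / x v ∈ m.rayProduct K v) ∧
      ∀ (w : InfinitePlace K) (hw : w ∈ (m.induced K).inf),
        0 < InfinitePlace.embedding_of_isReal hw.1 (b : K) := by
  obtain ⟨a, ha0, ha⟩ := m.exists_generators
  choose e he0 he using fun v ↦ LocalUnits.exists_mul_coe_inv_sub_one_mem (x v) (ha0 v)
  obtain ⟨b, hb, hb'⟩ := LocalAlg.exists_diag_sub_mem_ball (K := K) (m.finite_finSupport hk)
    (T' := Set.univ) Set.finite_univ (fun v ↦ LocalUnits.coe (x v)) e he0 1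
  have hpos : ∀ (w : InfinitePlace K) (hw : w ∈ (m.induced K).inf),
      0 < InfinitePlace.embedding_of_isReal hw.1 b := fun w hw ↦
    embedding_pos_of_lt_one hw.1 (hb' w trivial)
  -- The value b = 0 contradicts every single condition. It can occur only when there are none, and
  -- then 1 serves.
  by_cases hb0 : b = 0
  · subst hb0
    refine ⟨1, fun v hv ↦ ?_, fun w hw ↦ ?_⟩
    · have := he v _ (hb v hv)
      rw [map_zero, zero_mul, zero_sub] at this
      exact absurd this ((ha v hv).not_neg_one_mem_ball hv)
    · have := hpos w hw
      rw [map_zero] at this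
      exact absurd this (lt_irrefl _)
  · exact ⟨Units.mk0 b hb0, fun v hv ↦
      (ha v hv).diag_div_mem_rayProduct hv (he v _ (hb v hv)), hpos⟩

/-- Approximation of Galois invariant local units by a unit of `k`. -/
lemma exists_base_units_diag_div_mem [Finite (InfinitePlace k)] (hk : HasFinitePlaces k)
    (x : ∀ v, LocalUnits v K) (hx : ∀ v ∈ m.finSupport, ∀ σ : K ≃ₐ[k] K, σ • x v = x v)
    (s : InfinitePlace k → k) (hs : ∀ u : InfinitePlace k, u (s u) = 1) :
    ∃ c : kˣ, (∀ v ∈ m.finSupport,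
      LocalUnits.diag v K (Units.map (algebraMap k K).toMonoidHom c) / x v ∈ m.rayProduct K v) ∧
      ∀ u : InfinitePlace k, u (c - s u) < 1 := by
  obtain ⟨a, ha0, ha⟩ := m.exists_generators
  choose e he0 he using fun v ↦ LocalUnits.exists_mul_coe_inv_sub_one_mem (x v) (ha0 v)
  have hex : ∀ v : FinitePlace k, ∃ c : k, v ∈ m.finSupport →
      LocalAlg.diag v K (algebraMap k K c) - LocalUnits.coe (x v) ∈ LocalAlg.ball v K (e v) := by
    intro v
    by_cases hv : v ∈ m.finSupport
    · obtain ⟨c, hc⟩ := LocalAlg.exists_algebraMap_sub_mem (x := LocalUnits.coe (x v))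
        (fun σ ↦ by rw [← LocalUnits.coe_smul, hx v hv]) (he0 v)
      exact ⟨c, fun _ ↦ hc⟩
    · exact ⟨0, fun h ↦ absurd h hv⟩
  choose y hy using hex
  obtain ⟨c, hc, hc'⟩ := exists_approx (m.finite_finSupport hk) (T' := Set.univ) Set.finite_univ
    y e (fun v _ ↦ he0 v) s
  have hball : ∀ v ∈ m.finSupport,
      LocalAlg.diag v K (algebraMap k K c) - LocalUnits.coe (x v) ∈ LocalAlg.ball v K (e v) := by
    intro v hv
    rw [← sub_add_sub_cancel _ (LocalAlg.diag v K (algebraMap k K (y v)))]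
    refine add_mem ?_ (hy v hv)
    rw [← map_sub, ← map_sub]
    exact LocalAlg.ball_anti (hc v hv).le (LocalAlg.diag_mem_ball _)
  -- As |s_u| = 1, the value c = 0 contradicts the conditions at infinite as well as finite places,
  -- so it occurs only when there are none.
  by_cases hc0 : c = 0
  · subst hc0
    refine ⟨1, fun v hv ↦ ?_, fun u ↦ ?_⟩
    · have := he v _ (hball v hv)
      rw [map_zero, map_zero, zero_mul, zero_sub] at this
      exact absurd this ((ha v hv).not_neg_one_mem_ball hv)
    · have := hc' u trivial
      rw [zero_sub, show u (-s u) = u (s u) from u.1.map_neg _, hs u] at this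
      exact absurd this (lt_irrefl _)
  · exact ⟨Units.mk0 c hc0, fun v hv ↦ (ha v hv).diag_div_mem_rayProduct hv
      (he v _ (hball v hv)), fun u ↦ hc' u trivial⟩

/-! ### Cohomology of the ray group -/

open groupCohomology

/-- Injectivity: a global b with coboundary f is determined up to kˣ, and this freedom suffices to
move b into K^𝔪. -/
lemma isMulCoboundary₁_of_forall [Finite (InfinitePlace k)] (hk : HasFinitePlaces k)
    (f : (K ≃ₐ[k] K) → (m.induced K).rayGroup) (hf : IsMulCocycle₁ f)
    (h : ∀ v, IsMulCoboundary₁ fun σ ↦ m.rayGroupDiag K v (f σ)) : IsMulCoboundary₁ f := by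
  classical
  obtain ⟨b, hb⟩ := isMulCoboundary₁_of_isMulCocycle₁_of_aut_to_units
    (fun σ ↦ (f σ : Kˣ)) fun σ τ ↦ congrArg Subtype.val (hf σ τ)
  replace hb : ∀ σ : K ≃ₐ[k] K, σ • b / b = (f σ : Kˣ) := hb
  choose u hu using h
  let x : ∀ v, LocalUnits v K := fun v ↦
    if hv : v ∈ m.finSupport then LocalUnits.diag v K b / (u ⟨v, hv⟩ : LocalUnits v K) else 1
  have hx : ∀ v (hv : v ∈ m.finSupport),
      x v = LocalUnits.diag v K b / (u ⟨v, hv⟩ : LocalUnits v K) := fun v hv ↦ dif_pos hv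
  have hfix : ∀ v ∈ m.finSupport, ∀ σ : K ≃ₐ[k] K, σ • x v = x v := by
    intro v hv σ
    have h1 : σ • (u ⟨v, hv⟩ : LocalUnits v K) / u ⟨v, hv⟩ = LocalUnits.diag v K (f σ) :=
      congrArg Subtype.val (hu ⟨v, hv⟩ σ)
    rw [hx v hv, smul_div', LocalUnits.smul_diag, div_eq_div_iff_div_eq_div, h1, ← hb σ, map_div]
  have hb0 : ∀ (w : InfinitePlace K) (hw : w ∈ (m.induced K).inf),
      InfinitePlace.embedding_of_isReal hw.1 (b : K) ≠ 0 := fun w hw ↦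
    (map_ne_zero _).mpr b.ne_zero
  have hbσ : ∀ σ : K ≃ₐ[k] K, σ (b : K) = (f σ : Kˣ) * (b : K) := by
    intro σ
    have := hb σ
    rw [div_eq_iff_eq_mul] at this
    exact congrArg Units.val this
  have hfpos : ∀ (σ : K ≃ₐ[k] K) (w : InfinitePlace K) (hw : w ∈ (m.induced K).inf),
      0 < InfinitePlace.embedding_of_isReal hw.1 ((f σ : Kˣ) : K) := fun σ w hw ↦
    (f σ).2.2 w hw
  -- The sign of b above u, with 1 as default where no sign is prescribed.
  let s : InfinitePlace k → k := fun u ↦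
    if ∃ (w : InfinitePlace K) (hw : w ∈ (m.induced K).inf), w.comap (algebraMap k K) = u ∧
      InfinitePlace.embedding_of_isReal hw.1 (b : K) < 0 then -1 else 1
  have hsign : ∀ (w : InfinitePlace K) (hw : w ∈ (m.induced K).inf),
      0 < InfinitePlace.embedding_of_isReal hw.1 ((b : K) *
        algebraMap k K (s (w.comap (algebraMap k K)))) := by
    intro w hw
    rcases lt_or_gt_of_ne (hb0 w hw) with hlt | hgt
    · have : s (w.comap (algebraMap k K)) = -1 := if_pos ⟨w, hw, rfl, hlt⟩
      rw [this]
      simpa using hlt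
    · have : s (w.comap (algebraMap k K)) = 1 := by
        refine if_neg ?_
        rintro ⟨w', hw', hcomap, hlt⟩
        -- Places above the same u are conjugate, and σ⁻¹b/b is a value of f, hence positive; b
        -- therefore cannot have different signs at them, and s is consistent.
        obtain ⟨σ, rfl⟩ := InfinitePlace.exists_smul_eq_of_comap_eq hcomap.symm
        have h1 : InfinitePlace.embedding_of_isReal hw'.1 (b : K) =
            InfinitePlace.embedding_of_isReal hw.1 (σ.symm b) := by
          apply Complex.ofReal_injective
          rw [InfinitePlace.embedding_of_isReal_apply, InfinitePlace.embedding_of_isReal_apply]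
          have := InfinitePlace.comap_embedding_of_isReal (σ.symm : K →+* K) (w := w) hw'.1
          exact DFunLike.congr_fun this (b : K)
        rw [h1, hbσ, map_mul] at hlt
        exact hlt.not_gt (mul_pos (hfpos _ w hw) hgt)
      rw [this]
      simpa using hgt
  have hs1 : ∀ u, s u = -1 ∨ s u = 1 := fun u ↦ by
    simp only [s]
    split_ifs
    · exact Or.inl rfl
    · exact Or.inr rfl
  obtain ⟨c, hc, hc'⟩ := exists_base_units_diag_div_mem hk x hfix s fun u ↦ by
    rcases hs1 u with h | h
    · rw [h]
      exact (u.1.map_neg 1).trans (map_one u)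
    · rw [h]
      exact map_one u
  let c' : Kˣ := Units.map (algebraMap k K).toMonoidHom c
  have hmem : b / c' ∈ (m.induced K).rayGroup := by
    refine mem_rayGroup_induced_iff.mpr ⟨fun v hv ↦ ?_, fun w hw ↦ ?_⟩
    · have h1 := hc v hv
      have h2 : LocalUnits.diag v K (b / c') =
          (u ⟨v, hv⟩ : LocalUnits v K) / (LocalUnits.diag v K c' / x v) := by
        rw [hx v hv, map_div, div_div_eq_mul_div, mul_div_cancel]
      rw [h2]
      exact div_mem (u ⟨v, hv⟩).2 h1
    · have h1 := hsign w hw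
      have h2 := hc' (w.comap (algebraMap k K))
      rw [InfinitePlace.comap_apply, ← InfinitePlace.norm_embedding_of_isReal hw.1,
        Real.norm_eq_abs, map_sub, map_sub, abs_lt] at h2
      have h3 : ((b / c' : Kˣ) : K) = b / algebraMap k K c := Units.val_div_eq_div_val _ _
      rw [h3, map_div₀]
      rw [map_mul] at h1
      rcases hs1 (w.comap (algebraMap k K)) with h | h
      · rw [h, map_neg, map_neg, map_one, map_one] at h1 h2
        exact div_pos_of_neg_of_neg (by linarith) (by linarith)
      · rw [h, map_one, map_one] at h1 h2
        exact div_pos (by linarith) (by linarith)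
  refine ⟨⟨b / c', hmem⟩, fun σ ↦ Subtype.ext ?_⟩
  change σ • (b / c') / (b / c') = f σ
  have hσc : σ • c' = c' := Units.ext (σ.commutes _)
  rw [smul_div', hσc, div_div_div_cancel_right]
  exact hb σ

/-- Surjectivity: the local cocycles are split by units x_v of ∏ K_w, and a global b approximating
the x_v gives the cocycle σb/b. It differs from the given ones by the coboundaries of b/x_v ∈ ∏(1 +
𝔪𝒪_w). -/
lemma exists_isMulCocycle₁ [Finite (InfinitePlace K)] (hk : HasFinitePlaces k)
    (f : ∀ v : m.finSupport, (K ≃ₐ[k] K) → m.rayProduct K v.1) (hf : ∀ v, IsMulCocycle₁ (f v)) :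
    ∃ f' : (K ≃ₐ[k] K) → (m.induced K).rayGroup, IsMulCocycle₁ f' ∧
      ∀ v, IsMulCoboundary₁ fun σ ↦ m.rayGroupDiag K v (f' σ) / f v σ := by
  classical
  have hex : ∀ v : m.finSupport, IsMulCoboundary₁ fun σ ↦ (f v σ : LocalUnits v.1 K) := fun v ↦
    isMulCoboundary₁_localUnits fun σ τ ↦ congrArg Subtype.val (hf v σ τ)
  choose x hx using hex
  replace hx : ∀ v (σ : K ≃ₐ[k] K), σ • x v / x v = (f v σ : LocalUnits v.1 K) := hx
  obtain ⟨b, hb, hpos⟩ := exists_units_diag_div_mem (m := m) hk fun v ↦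
    if hv : v ∈ m.finSupport then x ⟨v, hv⟩ else 1
  have ht : ∀ v : m.finSupport, LocalUnits.diag v.1 K b / x v ∈ m.rayProduct K v.1 := by
    intro v
    have := hb v.1 v.2
    rwa [dif_pos v.2] at this
  let t : ∀ v : m.finSupport, m.rayProduct K v.1 := fun v ↦ ⟨_, ht v⟩
  have hdiag : ∀ (v : m.finSupport) (σ : K ≃ₐ[k] K), LocalUnits.diag v.1 K (σ • b / b) =
      ((σ • t v / t v * f v σ : m.rayProduct K v.1) : LocalUnits v.1 K) := by
    intro v σ
    change _ = σ • (LocalUnits.diag v.1 K b / x v) / (LocalUnits.diag v.1 K b / x v) * f v σ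
    rw [← hx v σ, map_div, smul_div', LocalUnits.smul_diag, div_mul_div_comm,
      div_mul_cancel, div_mul_cancel]
  have hmem : ∀ σ : K ≃ₐ[k] K, σ • b / b ∈ (m.induced K).rayGroup := by
    refine fun σ ↦ mem_rayGroup_induced_iff.mpr ⟨fun v hv ↦ ?_, fun w hw ↦ ?_⟩
    · rw [hdiag ⟨v, hv⟩ σ]
      exact Subtype.prop _
    -- G permutes the real places above 𝔪_∞, so σb is positive at them along with b.
    · obtain ⟨w', hw', h⟩ := exists_embedding_apply_eq (m := m) σ hw
      rw [Units.val_div_eq_div_val, map_div₀]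
      refine div_pos ?_ (hpos w hw)
      have := h b
      rw [← AlgEquiv.smul_def] at this
      exact this ▸ hpos w' hw'
  refine ⟨fun σ ↦ ⟨_, hmem σ⟩, fun σ τ ↦ Subtype.ext ?_, fun v ↦ ⟨t v, fun σ ↦ ?_⟩⟩
  · change (σ * τ) • b / b = σ • (τ • b / b) * (σ • b / b)
    rw [mul_smul, smul_div', div_mul_div_cancel]
  · rw [eq_div_iff_mul_eq']
    exact Subtype.ext (hdiag v σ).symm

end Modulus

end RayClass

end

theorem proposition4p2 (k K : Type) [Field k] [Field K] [Algebra k K] [FiniteDimensional k K]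
    [IsGalois k K] (hk : RayClass.IsGlobalField k) (S : Set (RayClass.Place k))
    (hSfin : S.Finite) (hSne : S.Nonempty)
    (hSinf : ∀ v : NumberField.InfinitePlace k, RayClass.Place.infinite v ∈ S)
    (m : RayClass.Modulus k S) :
    Nonempty (groupCohomology.H1 (Rep.ofMulDistribMulAction (K ≃ₐ[k] K) (m.induced K).rayGroup) ≃+
      ((v : m.finSupport) →
        groupCohomology.H1 (Rep.ofMulDistribMulAction (K ≃ₐ[k] K) (m.rayProduct K v.1)))) ∧
    (IsCyclic (K ≃ₐ[k] K) →
      Finite (groupCohomology.H1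
        (Rep.ofMulDistribMulAction (K ≃ₐ[k] K) (m.induced K).rayGroup)) ∧
      (∀ v ∈ m.finSupport, (m.rayProduct K v).map (RayClass.normMap v) ≤ m.rayUnits v) ∧
      Nat.card (groupCohomology.H1
          (Rep.ofMulDistribMulAction (K ≃ₐ[k] K) (m.induced K).rayGroup)) =
        ∏ᶠ v : m.finSupport,
          ((m.rayProduct K v.1).map (RayClass.normMap v.1)).relIndex (m.rayUnits v.1)) := by
  have hk' := hk.hasFinitePlaces
  have : Finite (NumberField.InfinitePlace k) := by
    have := hSfin.to_subtype
    refine Finite.of_injective (fun v ↦ (⟨_, hSinf v⟩ : S)) fun v v' h ↦ ?_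
    exact RayClass.Place.infinite.inj (congrArg Subtype.val h)
  have : Finite (NumberField.InfinitePlace K) := RayClass.finite_infinitePlace_of_isGalois k K
  have hiso := RayClass.nonempty_H1_equiv_pi (m.rayGroupDiag K)
    RayClass.Modulus.rayGroupDiag_smul
    (RayClass.Modulus.isMulCoboundary₁_of_forall hk')
    (RayClass.Modulus.exists_isMulCocycle₁ hk')
  refine ⟨hiso, ?_⟩
  rintro ⟨g, hg⟩
  obtain ⟨e⟩ := hiso
  have hindex := fun v : m.finSupport ↦ m.relIndex_gDiff_eq hk' v.2 g hg
  have hcard := fun v : m.finSupport ↦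
    (RayClass.card_H1_of_cyclic (M := m.rayProduct K v.1) g hg).trans (hindex v).1
  have := (m.finite_finSupport hk').to_subtype
  have := Fintype.ofFinite m.finSupport
  have hfin : ∀ v : m.finSupport, Finite (groupCohomology.H1
      (Rep.ofMulDistribMulAction (K ≃ₐ[k] K) (m.rayProduct K v.1))) := fun v ↦ by
    -- An infinite group has `Nat.card` equal to 0, so the nonvanishing of the index carries the
    -- finiteness.
    refine Nat.finite_of_card_ne_zero ?_
    rw [hcard v, ← (hindex v).1]
    exact (hindex v).2
  refine ⟨Finite.of_equiv _ e.symm.toEquiv, fun v hv ↦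
    RayClass.Modulus.map_normMap_le hk' hv, ?_⟩
  rw [Nat.card_congr e.toEquiv, Nat.card_pi, finprod_eq_prod_of_fintype]
  exact Finset.prod_congr rfl fun v _ ↦ hcard v
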